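/- Let $n>4$ and let $X=\{\psi_1=\psi_2=0\}\subset\mathbb P(V)=\mathbb P^{n+2}$, $V=\mathbb C^{n+3}$, be a nonsingular intersection of two quadric hypersurfaces (the differentials of $\psi_1,\psi_2$ are linearly independent at every point of $X$), and let $\Phi=\langle\psi_1,\psi_2\rangle$ be its pencil of quadratic forms. A pencil (two-dimensional space) of quadratic forms on an $n$-dimensional complex vector space $W$ is nonsingular if it has a nondegenerate member and exactly $n$ degenerate members up to scalars. Let $\mathcal M_n^{\rm PQ}$ be the orbit space under ${\rm PGL}(W)$ of the nonsingular pencils on $W$, and $\widetilde{\mathcal M}_n^{\rm PQ}$ the orbit space under ${\rm PGL}(W)$ of the pairs of a nonsingular pencil on $W$ and a three-dimensional subspace of $W$, with their quotient structures (holomorphic functions near a point of the orbit space are the invariant holomorphic functions near the orbit). The differential of a map $f$ to such a space is given by the derivatives of the functions $h\circ f$, where $h$ is a germ of a holomorphic function at the image point. For $x\in X$ let $II_{X,x}$ be the projective second fundamental form, as a linear system of quadratic forms on $T_x(X)$, and let $\mu^X(x)=[II_{X,x}]\in\mathcal M_n^{\rm PQ}$ where $II_{X,x}$ is a nonsingular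 pencil. There are linearly independent nondegenerate forms $\varphi_1,\varphi_2$ that span $\Phi$. Fix any such pair, and call $x\in X$ regular, $x\in X^{\rm reg}$, if (i) in a basis of $V$ with $\varphi_1=\sum\tau_iz_i^2$ and $\varphi_2=\sum z_i^2$, with distinct $\tau_i$, all coordinates of $x$ are nonzero; (ii) $II_{X,x}$ is a nonsingular pencil; (iii) the identity is the only projective automorphism of the projective line $\mathbb P(II_{X,x})$ that preserves its set of degenerate members; (iv) $\varphi_1$ and $\varphi_2$ induce nondegenerate quadratic forms on $T_x(X)$. The refined moduli map $\widetilde\mu^X:X^{\rm reg}\to\widetilde{\mathcal M}_n^{\rm PQ}$ sends $x$ to the class of the pair $(II_{X,x},\mathcal P_x)$, where $\mathcal P_x={\rm Ker}(d_x\mu^X)\subset T_x(X)$. Then the set $X^{\rm good}=\{x\in X^{\rm reg}\mid {\rm Ker}(d_x\widetilde\mu^X)=0\}$ is nonempty. -/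

import Mathlib

open scoped LinearAlgebra.Projectivization Topology

noncomputable section

namespace TwoQuadrics

/-! ### Pencils of quadratic forms -/

/-- `Sing(q)`: the vectors that are orthogonal to the whole space. -/
def sing {W : Type*} [AddCommGroup W] [Module ℂ W] (q : QuadraticForm ℂ W) : Submodule ℂ W :=
  LinearMap.ker q.polarBilin

/-- A quadratic form is degenerate if `Sing(q)` is nontrivial. -/
def IsDegenerate {W : Type*} [AddCommGroup W] [Module ℂ W] (q : QuadraticForm ℂ W) : Prop :=
  sing q ≠ ⊥

/-- The intersection of the projective linear system of `Φ` with the hypersurface of degenerate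
quadratic forms. -/
def degeneratePoints {W : Type*} [AddCommGroup W] [Module ℂ W]
    (Φ : Submodule ℂ (QuadraticForm ℂ W)) : Set (ℙ ℂ (QuadraticForm ℂ W)) :=
  {p | p.submodule ≤ Φ ∧ IsDegenerate p.rep}

/-- Nonsingular pencils of quadratic forms. A pencil is a two-dimensional space `Φ` of forms;
it is nondegenerate if some (equivalently, a general) member is nondegenerate, and nonsingular if
moreover it has exactly `dim W` degenerate members up to scalars. -/
structure IsNonsingularPencil {W : Type*} [AddCommGroup W] [Module ℂ W]
    (Φ : Submodule ℂ (QuadraticForm ℂ W)) : Prop where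
  finrank_eq : Module.finrank ℂ Φ = 2
  nondegenerate : ∃ q ∈ Φ, ¬ IsDegenerate q
  ncard_eq : (degeneratePoints Φ).ncard = Module.finrank ℂ W

/-- The identity is the only projective automorphism of the projective line of `Φ` that
preserves the set of degenerate members. -/
def HasOnlyTrivialAut {W : Type*} [AddCommGroup W] [Module ℂ W]
    (Φ : Submodule ℂ (QuadraticForm ℂ W)) : Prop :=
  ∀ g : Φ ≃ₗ[ℂ] Φ, (∀ q : Φ, IsDegenerate (q : QuadraticForm ℂ W) ↔
    IsDegenerate (g q : QuadraticForm ℂ W)) → ∃ c : ℂ, ∀ q : Φ, g q = c • q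

/-- A pair of linearly independent nondegenerate forms spanning the pencil `Φ`. -/
structure IsGoodPair {W : Type*} [AddCommGroup W] [Module ℂ W]
    (Φ : Submodule ℂ (QuadraticForm ℂ W)) (φ₁ φ₂ : QuadraticForm ℂ W) : Prop where
  linearIndependent : LinearIndependent ℂ ![φ₁, φ₂]
  span_eq : Submodule.span ℂ {φ₁, φ₂} = Φ
  nondegenerate₁ : ¬ IsDegenerate φ₁
  nondegenerate₂ : ¬ IsDegenerate φ₂

/-- Standard bases with respect to `(φ₁, φ₂)`: in the coordinates `z` of the basis,
`φ₁ = ∑ τᵢ zᵢ²` and `φ₂ = ∑ zᵢ²` with distinct nonzero `τᵢ`. -/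
def IsStandardBasis {W ι : Type*} [AddCommGroup W] [Module ℂ W] [Fintype ι]
    (φ₁ φ₂ : QuadraticForm ℂ W) (b : Module.Basis ι ℂ W) : Prop :=
  ∃ τ : ι → ℂ, Function.Injective τ ∧ (∀ i, τ i ≠ 0) ∧
    (∀ v, φ₁ v = ∑ i, τ i * b.repr v i ^ 2) ∧ (∀ v, φ₂ v = ∑ i, b.repr v i ^ 2)

/-! ### Orbit spaces of pencils, and of pencils with a subspace

A point of an orbit space is a `GL`-orbit, as a set. The orbits of nonsingular pencils form the
moduli space of pencils; the orbits of pairs of a nonsingular pencil and a three-dimensional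
subspace form the refined moduli space. -/

/-- Linear systems of quadratic forms on `ℂⁿ`. -/
abbrev QuadSys (n : ℕ) : Type := Submodule ℂ (QuadraticForm ℂ (Fin n → ℂ))

/-- The projective equivalence class of a linear system `Φ` on an `n`-dimensional space `W`,
as an orbit of linear systems on `ℂⁿ`: all `T^* Φ` for isomorphisms `T : ℂⁿ → W`. -/
def pencilClass (n : ℕ) {W : Type*} [AddCommGroup W] [Module ℂ W]
    (Φ : Submodule ℂ (QuadraticForm ℂ W)) : Set (QuadSys n) :=
  {Ψ | ∃ T : (Fin n → ℂ) ≃ₗ[ℂ] W,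
    (Ψ : Set (QuadraticForm ℂ (Fin n → ℂ))) =
      (fun q : QuadraticForm ℂ W => q.comp (T : (Fin n → ℂ) →ₗ[ℂ] W)) '' Φ}

/-- The projective equivalence class of a pair `(Φ, P)` of a linear system and a subspace of an
`n`-dimensional space `W`: all `(T^* Φ, T⁻¹ P)` for isomorphisms `T : ℂⁿ → W`. -/
def pairClass (n : ℕ) {W : Type*} [AddCommGroup W] [Module ℂ W]
    (Φ : Submodule ℂ (QuadraticForm ℂ W)) (P : Submodule ℂ W) :
    Set (QuadSys n × Submodule ℂ (Fin n → ℂ)) :=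
  {y | ∃ T : (Fin n → ℂ) ≃ₗ[ℂ] W,
    (y.1 : Set (QuadraticForm ℂ (Fin n → ℂ))) =
      (fun q : QuadraticForm ℂ W => q.comp (T : (Fin n → ℂ) →ₗ[ℂ] W)) '' Φ ∧
    y.2 = P.comap (T : (Fin n → ℂ) →ₗ[ℂ] W)}

/-- The moduli space of nonsingular pencils of quadratic forms on `ℂⁿ`. -/
def moduliPQ (n : ℕ) : Set (Set (QuadSys n)) :=
  {m | ∃ Φ : QuadSys n, IsNonsingularPencil Φ ∧ m = pencilClass n Φ}

/-- The refined moduli space: orbits of pairs of a nonsingular pencil and a three-dimensional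
subspace. -/
def refinedModuliPQ (n : ℕ) : Set (Set (QuadSys n × Submodule ℂ (Fin n → ℂ))) :=
  {m | ∃ (Φ : QuadSys n) (P : Submodule ℂ (Fin n → ℂ)),
    IsNonsingularPencil Φ ∧ Module.finrank ℂ P = 3 ∧ m = pairClass n Φ P}

/-- The linear system spanned by the two quadratic forms `z ↦ ∑ᵢⱼ Aᵢⱼ zᵢ zⱼ` of two matrices. -/
def frameSys {n : ℕ} (A : Fin 2 → Fin n → Fin n → ℂ) : QuadSys n :=
  Submodule.span ℂ (Set.range fun k => (Matrix.of (A k)).toQuadraticForm')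

/-- Germs of holomorphic functions on the moduli space of pencils at a point `m`. The orbit space
carries the quotient structure: a function is holomorphic at `m` if its pullback to the pencils
is holomorphic near the orbit `m`. Holomorphy on the Grassmannian of pencils is holomorphy in terms
of bases of pencils, and on quadratic forms it is holomorphy in the entries of a matrix. The
germ is represented by a function on all orbits, of which only the values near `m` matter. -/
def holGerms (n : ℕ) (m : Set (QuadSys n)) : Set (Set (QuadSys n) → ℂ) :=
  {h | m ∈ moduliPQ n ∧ ∀ A : Fin 2 → Fin n → Fin n → ℂ, pencilClass n (frameSys A) = m →
    ∀ᶠ B in 𝓝 A, DifferentiableAt ℂ (fun C => h (pencilClass n (frameSys C))) B}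

/-- Germs of holomorphic functions on the refined moduli space at a point `m`, described in the
same way in terms of bases of the pencil and of the three-dimensional subspace. -/
def refinedHolGerms (n : ℕ) (m : Set (QuadSys n × Submodule ℂ (Fin n → ℂ))) :
    Set (Set (QuadSys n × Submodule ℂ (Fin n → ℂ)) → ℂ) :=
  {h | m ∈ refinedModuliPQ n ∧
    ∀ A : (Fin 2 → Fin n → Fin n → ℂ) × (Fin 3 → Fin n → ℂ),
      pairClass n (frameSys A.1) (Submodule.span ℂ (Set.range A.2)) = m →
      ∀ᶠ B in 𝓝 A, DifferentiableAt ℂ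
        (fun C : (Fin 2 → Fin n → Fin n → ℂ) × (Fin 3 → Fin n → ℂ) =>
          h (pairClass n (frameSys C.1) (Submodule.span ℂ (Set.range C.2)))) B}

/-! ### Intersections of quadrics and their second fundamental forms

`Φ` is the pencil spanned by the equations of `X ⊂ ℙ(V)`, with `V = ℂᴺ`. -/

/-- The affine cone over the intersection `X` of the quadrics in `Φ`, without its vertex. -/
def cone {N : ℕ} (Φ : QuadSys N) : Set (Fin N → ℂ) :=
  {v | v ≠ 0 ∧ ∀ φ ∈ Φ, φ v = 0}

/-- The intersection `X` of the quadrics in `Φ`. -/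
def variety {N : ℕ} (Φ : QuadSys N) : Set (ℙ ℂ (Fin N → ℂ)) :=
  {x | x.rep ∈ cone Φ}

/-- The intersection of the quadrics `ψ₁ = 0` and `ψ₂ = 0` is nonsingular (of codimension two):
the differentials of the two equations are linearly independent at all of its points. -/
def IsNonsingularIntersection {N : ℕ} (ψ₁ ψ₂ : QuadraticForm ℂ (Fin N → ℂ)) : Prop :=
  ∀ v : Fin N → ℂ, v ≠ 0 → ψ₁ v = 0 → ψ₂ v = 0 →
    LinearIndependent ℂ ![ψ₁.polarBilin v, ψ₂.polarBilin v]

/-- The affine tangent space at `v` of the cone over `X`, that is, the common kernel of the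
differentials `2 B_φ(v, ·)` of the equations `φ ∈ Φ`. -/
def affineTangent {N : ℕ} (Φ : QuadSys N) (v : Fin N → ℂ) : Submodule ℂ (Fin N → ℂ) :=
  ⨅ φ ∈ Φ, LinearMap.ker (φ.polarBilin v)

/-- The tangent space of `X` at `x`: the affine tangent space modulo the line of `x`. (This is
canonical up to the choice of a vector of that line, which only rescales the tangent space.) -/
abbrev TangentAt {N : ℕ} (Φ : QuadSys N) (x : ℙ ℂ (Fin N → ℂ)) : Type :=
  affineTangent Φ x.rep ⧸ x.submodule.submoduleOf (affineTangent Φ x.rep)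

/-- The tangent vector of `X` at `x` given by a vector of the affine tangent space. -/
def toTangent {N : ℕ} (Φ : QuadSys N) (x : ℙ ℂ (Fin N → ℂ)) :
    affineTangent Φ x.rep →ₗ[ℂ] TangentAt Φ x :=
  (x.submodule.submoduleOf (affineTangent Φ x.rep)).mkQ

/-- The second fundamental form of `X` at `x`, as a linear system of quadratic forms on the
tangent space. The derivative of the Gauss map `X → Gr(V)`, `[v] ↦ affineTangent v`, in the direction
`γ'(0)` of a curve `γ` in the cone is the linear map from the affine tangent space `T` to `V / T` that
sends `w(0)` to the class of `w'(0)`, for every curve `w` with `w(t)` in the affine tangent space at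
`γ(t)`. The linear system consists of the compositions of this symmetric bilinear map with
the linear forms `l` on `V / T`. -/
def secondFundamentalForm {N : ℕ} (Φ : QuadSys N) (x : ℙ ℂ (Fin N → ℂ)) :
    Submodule ℂ (QuadraticForm ℂ (TangentAt Φ x)) where
  carrier := {q | ∃ l : (Fin N → ℂ) →ₗ[ℂ] ℂ, (∀ u ∈ affineTangent Φ x.rep, l u = 0) ∧
    ∀ γ w : ℂ → (Fin N → ℂ), AnalyticAt ℂ γ 0 → AnalyticAt ℂ w 0 → γ 0 = x.rep →
      (∀ᶠ t in 𝓝 (0 : ℂ), γ t ∈ cone Φ) → (∀ᶠ t in 𝓝 (0 : ℂ), w t ∈ affineTangent Φ (γ t)) →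
      ∀ a b : affineTangent Φ x.rep, (a : Fin N → ℂ) = deriv γ 0 → (b : Fin N → ℂ) = w 0 →
        QuadraticMap.polar q (toTangent Φ x a) (toTangent Φ x b) = l (deriv w 0)}
  zero_mem' := ⟨0, by simp, by intros; simp [QuadraticMap.polar]⟩
  add_mem' := by
    rintro q q' ⟨l, hl, h⟩ ⟨l', hl', h'⟩
    refine ⟨l + l', fun u hu => by simp [hl u hu, hl' u hu], ?_⟩
    intro γ w h1 h2 h3 h4 h5 a b ha hb
    have e := h γ w h1 h2 h3 h4 h5 a b ha hb
    have e' := h' γ w h1 h2 h3 h4 h5 a b ha hb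
    rw [LinearMap.add_apply, ← e, ← e', FunLike.coe_add, QuadraticMap.polar_add]
  smul_mem' := by
    rintro c q ⟨l, hl, h⟩
    refine ⟨c • l, fun u hu => by simp [hl u hu], ?_⟩
    intro γ w h1 h2 h3 h4 h5 a b ha hb
    have e := h γ w h1 h2 h3 h4 h5 a b ha hb
    rw [LinearMap.smul_apply, ← e, FunLike.coe_smul, QuadraticMap.polar_smul]

/-! ### The moduli map, the refined moduli map, and their differentials -/

/-- A function on projective space, as a homogeneous function of degree zero. -/
def coneFun {N : ℕ} (g : ℙ ℂ (Fin N → ℂ) → ℂ) (v : Fin N → ℂ) : ℂ :=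
  open Classical in if hv : v = 0 then 0 else g (Projectivization.mk ℂ v hv)

/-- The kernel of the differential at `x` of a map `f` from (an open subset of) `X` to a space whose
germs of holomorphic functions are given by `germs`: the tangent vectors of `X` along which the
derivatives of all the functions `h ∘ f`, with `h` a germ at `f x`, vanish. The derivative of
`h ∘ f` along `X` is taken on the cone; `fderivWithin` is determined by the function on the affine
tangent space, where alone it is used. -/
def kerDifferential {N : ℕ} (Φ : QuadSys N) {M : Type*} (germs : M → Set (M → ℂ))
    (f : ℙ ℂ (Fin N → ℂ) → M) (x : ℙ ℂ (Fin N → ℂ)) : Submodule ℂ (TangentAt Φ x) :=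
  (⨅ h ∈ germs (f x), LinearMap.ker
    ((fderivWithin ℂ (coneFun (h ∘ f)) (cone Φ) x.rep : (Fin N → ℂ) →ₗ[ℂ] ℂ) ∘ₗ
      (affineTangent Φ x.rep).subtype)).map (toTangent Φ x)

/-- The moduli map of second fundamental forms, for `X ⊂ ℙⁿ⁺²`; it takes values in the moduli space
of nonsingular pencils at the points where the second fundamental form is nonsingular. -/
def moduliMap {n : ℕ} (Φ : QuadSys (n + 3)) (x : ℙ ℂ (Fin (n + 3) → ℂ)) : Set (QuadSys n) :=
  pencilClass n (secondFundamentalForm Φ x)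

/-- The kernel `𝒫ₓ` of the differential of the moduli map. -/
def kerModuliMap {n : ℕ} (Φ : QuadSys (n + 3)) (x : ℙ ℂ (Fin (n + 3) → ℂ)) :
    Submodule ℂ (TangentAt Φ x) :=
  kerDifferential Φ (holGerms n) (moduliMap Φ) x

/-- The refined moduli map of second fundamental forms. -/
def refinedModuliMap {n : ℕ} (Φ : QuadSys (n + 3)) (x : ℙ ℂ (Fin (n + 3) → ℂ)) :
    Set (QuadSys n × Submodule ℂ (Fin n → ℂ)) :=
  pairClass n (secondFundamentalForm Φ x) (kerModuliMap Φ x)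

/-- The regular points `X^reg` of the intersection `X` of the quadrics in `Φ`, with respect to a
good pair `(φ₁, φ₂)` of `Φ`. -/
structure IsRegularPoint {n : ℕ} (Φ : QuadSys (n + 3))
    (φ₁ φ₂ : QuadraticForm ℂ (Fin (n + 3) → ℂ)) (x : ℙ ℂ (Fin (n + 3) → ℂ)) : Prop where
  mem : x ∈ variety Φ
  general : ∃ b : Module.Basis (Fin (n + 3)) ℂ (Fin (n + 3) → ℂ), IsStandardBasis φ₁ φ₂ b ∧
    ∀ i, b.repr x.rep i ≠ 0
  nonsingular : IsNonsingularPencil (secondFundamentalForm Φ x)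
  onlyTrivialAut : HasOnlyTrivialAut (secondFundamentalForm Φ x)
  /-- The form induced by `φ₁` on the tangent space is nondegenerate. -/
  nondegenerate₁ : ∀ u ∈ affineTangent Φ x.rep,
    (∀ w ∈ affineTangent Φ x.rep, φ₁.polarBilin u w = 0) → u ∈ x.submodule
  /-- The form induced by `φ₂` on the tangent space is nondegenerate. -/
  nondegenerate₂ : ∀ u ∈ affineTangent Φ x.rep,
    (∀ w ∈ affineTangent Φ x.rep, φ₂.polarBilin u w = 0) → u ∈ x.submodule

/-- The set `X^good` of regular points at which the differential of the refined moduli map is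
injective. -/
def goodPoints {n : ℕ} (Φ : QuadSys (n + 3)) (φ₁ φ₂ : QuadraticForm ℂ (Fin (n + 3) → ℂ)) :
    Set (ℙ ℂ (Fin (n + 3) → ℂ)) :=
  {x | IsRegularPoint Φ φ₁ φ₂ x ∧
    kerDifferential Φ (refinedHolGerms n) (refinedModuliMap Φ) x = ⊥}

end TwoQuadrics

end

/-!
In coordinates with `φ₁ = ∑ τᵢ zᵢ²` and `φ₂ = ∑ zᵢ²`, which exist because no common eigenvector of the
two forms is isotropic on a nonsingular intersection, a point `z` of `X` determines the polynomial
`f(t) = ∑ zᵢ² ∏_{j ≠ i} (t - τⱼ)`. The equations of `X` say that its degree is at most `n`, so that the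
squares `zᵢ²` are, up to scaling, parametrized by the `n` roots `l₁, …, lₙ` of `f` (`RootDatum`).
At a point with distinct roots the vectors `eₖ = (zᵢ / (τᵢ - lₖ))ᵢ` are a basis of the tangent space
that diagonalizes both forms, and the second fundamental form is the pencil spanned by
`∑ lₖ βₖ uₖ²` and `∑ βₖ uₖ²` (`secondFundamentalForm_eq`), with explicit `βₖ` (`sqLength`). Its
degenerate members are the roots, so its isomorphism class is the class of the roots under
projective transformations of the line.

The tangent vector `∑ αₖ eₖ` moves the root `lₖ` with velocity `-2 αₖ`. Cross ratios of the
roots are holomorphic on the moduli space near pencils without symmetries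
(`exists_crossRatio_germ`), and conversely projective motions of the line do not change the class of
the pencil. Hence `𝒫ₓ` consists of the tangent vectors for which `αₖ` is a polynomial of degree
at most two in `lₖ` (`kerModuliMap_eq`). In the basis `eₖ` the class of `(II, 𝒫ₓ)` is therefore
given by `l`, `β` and the frame `(1, lₖ, lₖ²)` (`refinedModuliMap_eq`).

For triples `S` of indices let `E_S = (Δ_S² ∏_{k ∈ S} βₖ)² V_S`, where `Δ_S` is the Plücker
coordinate of the three-dimensional subspace and `V_S` the product of the differences of the roots.
Rescaling the basis, changing the frame, and projective transformations of the line multiply all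
`E_S` by the same factor, so that the quotients of two of them are holomorphic on the refined
moduli space (`exists_pairInvariant_germ`). If the motion `μₖ = p(lₖ)` of the roots, with
`p = A + B t + C t²`, is killed by the differentials of these quotients, then their logarithmic
derivatives show that `(n + 3) C lₖ - p(lₖ) g'(lₖ) / g(lₖ)` is the same number for all `k`, where
`g = ∏ (t - τᵢ)` (`rootRate_sum_eq`). This is a system of linear equations for the three
coefficients of `p` and the unknown number; four of the equations have only the trivial solution
for generic roots, since their determinant does not vanish when three of the roots are zeros of `g`
and the fourth is not. Five or more generic points of the line have no projective symmetries, so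
that generic roots give good points.
-/

noncomputable section

namespace TwoQuadrics

/-! ### Holomorphic functions -/

/-- Simple roots depend holomorphically on parameters. -/
theorem exists_root_branch {E : Type*} [NormedAddCommGroup E] [NormedSpace ℂ E] [CompleteSpace E]
    (F : E → ℂ → ℂ) (hF : ContDiff ℂ 1 (Function.uncurry F)) (x₀ : E) (z₀ d : ℂ)
    (h0 : F x₀ z₀ = 0) (hd : HasDerivAt (F x₀) d z₀) (hd0 : d ≠ 0) :
    ∃ r : E → ℂ, r x₀ = z₀ ∧ (∀ᶠ x in 𝓝 x₀, DifferentiableAt ℂ r x) ∧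
      ∀ᶠ x in 𝓝 x₀, F x (r x) = 0 := by
  have cdf : ContDiffAt ℂ 1 (Function.uncurry F) (x₀, z₀) := hF.contDiffAt
  have hfd := (cdf.differentiableAt one_ne_zero).hasFDerivAt
  set f' := fderiv ℂ (Function.uncurry F) (x₀, z₀)
  have hinr : f' ∘L .inr ℂ E ℂ = ContinuousLinearMap.toSpanSingleton ℂ d := by
    have hcomp : HasFDerivAt (F x₀) (f' ∘L .inr ℂ E ℂ) z₀ :=
      HasFDerivAt.comp z₀ (f := fun z => (x₀, z)) (g := Function.uncurry F) hfd
        (hasFDerivAt_prodMk_right x₀ z₀)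
    exact hcomp.unique hd.hasFDerivAt
  have hinv : (f' ∘L .inr ℂ E ℂ).IsInvertible := by
    rw [hinr]
    refine ⟨ContinuousLinearEquiv.smulLeft (Units.mk0 d hd0), ?_⟩
    ext
    simp
  refine ⟨cdf.implicitFunction one_ne_zero hinv, ?_, ?_, ?_⟩
  · exact cdf.implicitFunction_apply_self one_ne_zero hinv
  · have h := cdf.contDiffAt_implicitFunction one_ne_zero hinv
    exact (h.eventually (by simp)).mono fun x hx => hx.differentiableAt one_ne_zero
  · refine (cdf.eventually_apply_implicitFunction one_ne_zero hinv).mono fun x hx => ?_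
    simpa [Function.uncurry, h0] using hx

theorem differentiableAt_det {E : Type*} [NormedAddCommGroup E] [NormedSpace ℂ E] {m : ℕ}
    {M : E → Matrix (Fin m) (Fin m) ℂ} {x : E}
    (hM : ∀ i j, DifferentiableAt ℂ (fun y => M y i j) x) :
    DifferentiableAt ℂ (fun y => (M y).det) x := by
  simp only [Matrix.det_apply']
  refine DifferentiableAt.fun_sum fun σ _ => ?_
  refine DifferentiableAt.const_mul ?_ _
  fun_prop (disch := assumption)

theorem contDiff_det {E : Type*} [NormedAddCommGroup E] [NormedSpace ℂ E] {m : ℕ}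
    {M : E → Matrix (Fin m) (Fin m) ℂ}
    (hM : ∀ i j, ContDiff ℂ 1 (fun y => M y i j)) :
    ContDiff ℂ 1 (fun y => (M y).det) := by
  simp only [Matrix.det_apply']
  refine ContDiff.sum fun σ _ => ?_
  refine contDiff_const.mul ?_
  exact contDiff_prod fun i _ => hM _ _

theorem differentiableAt_adjugate {E : Type*} [NormedAddCommGroup E] [NormedSpace ℂ E] {m : ℕ}
    {M : E → Matrix (Fin m) (Fin m) ℂ} {x : E}
    (hM : ∀ i j, DifferentiableAt ℂ (fun y => M y i j) x) (i j : Fin m) :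
    DifferentiableAt ℂ (fun y => (M y).adjugate i j) x := by
  simp only [Matrix.adjugate_apply]
  refine differentiableAt_det fun k l => ?_
  by_cases hk : k = j
  · subst hk; simp
  · simpa [Matrix.updateRow_ne hk] using hM k l

/-- Germs on a quotient. `cls` sends frames to classes, `nf` sends normal forms to classes, and
`ν` puts the frames near `A₀` into normal form. If every frame of the class `m` can be moved to
`A₀` by a holomorphic map that respects classes, then a function `φ` of normal
forms that only depends on the class near `ν A₀` descends to a function `h` of classes with
holomorphic pullback near all frames of the class `m`. -/
theorem exists_germ {F N M : Type*} [NormedAddCommGroup F] [NormedSpace ℂ F]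
    [NormedAddCommGroup N] [NormedSpace ℂ N] (cls : F → M) (nf : N → M) (A₀ : F) (ν : F → N)
    (φ : N → ℂ) (U : Set N) (hU : U ∈ 𝓝 (ν A₀))
    (hν : ∀ᶠ B in 𝓝 A₀, DifferentiableAt ℂ ν B)
    (hcls : ∀ᶠ B in 𝓝 A₀, cls B = nf (ν B))
    (hφ : ∀ᶠ y in 𝓝 (ν A₀), DifferentiableAt ℂ φ y)
    (hinv : ∀ y ∈ U, ∀ y' ∈ U, nf y = nf y' → φ y = φ y')
    (hom : ∀ A, cls A = cls A₀ → ∃ L : F → F, Differentiable ℂ L ∧ L A = A₀ ∧ ∀ B, cls (L B) = cls B) :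
    ∃ h : M → ℂ, (∀ A, cls A = cls A₀ → ∀ᶠ B in 𝓝 A, DifferentiableAt ℂ (fun C => h (cls C)) B) ∧
      ∀ᶠ y in 𝓝 (ν A₀), h (nf y) = φ y := by
  classical
  let h : M → ℂ := fun m => if hm : ∃ y ∈ U, nf y = m then φ hm.choose else 0
  have hval : ∀ y ∈ U, h (nf y) = φ y := by
    intro y hy
    have hm : ∃ y' ∈ U, nf y' = nf y := ⟨y, hy, rfl⟩
    simp only [h, dif_pos hm]
    exact hinv _ hm.choose_spec.1 _ hy hm.choose_spec.2
  refine ⟨h, fun A hA => ?_, Filter.mem_of_superset hU hval⟩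
  have hcont : ContinuousAt ν A₀ := hν.self_of_nhds.continuousAt
  have hbase : ∀ᶠ B in 𝓝 A₀, DifferentiableAt ℂ (fun C => h (cls C)) B := by
    have h1 : ∀ᶠ B in 𝓝 A₀, h (cls B) = φ (ν B) := by
      filter_upwards [hcls, hcont hU] with B hB hB'
      rw [hB, hval _ hB']
    filter_upwards [h1.eventually_nhds, hν, hcont.eventually hφ] with B hB hνB hφB
    exact (DifferentiableAt.comp B hφB hνB).congr_of_eventuallyEq hB
  obtain ⟨L, hLd, hLA, hL⟩ := hom A hA
  have hLc : Filter.Tendsto L (𝓝 A) (𝓝 A₀) := hLA ▸ hLd.continuous.continuousAt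
  filter_upwards [hLc.eventually hbase] with B hB
  have : DifferentiableAt ℂ (fun C => h (cls (L C))) B :=
    DifferentiableAt.comp (g := fun C => h (cls C)) B hB hLd.differentiableAt
  simpa only [hL] using this

/-- The logarithmic derivative of `f` at `t` is `l`, in a form without division. -/
def HasLogDerivAt (f : ℂ → ℂ) (l t : ℂ) : Prop := HasDerivAt f (f t * l) t

namespace HasLogDerivAt
variable {f g : ℂ → ℂ} {l m t : ℂ}

theorem mul (hf : HasLogDerivAt f l t) (hg : HasLogDerivAt g m t) :
    HasLogDerivAt (fun s => f s * g s) (l + m) t := by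
  have := HasDerivAt.fun_mul hf hg
  exact this.congr_deriv (by ring)

theorem inv (hf : HasLogDerivAt f l t) (h0 : f t ≠ 0) :
    HasLogDerivAt (fun s => (f s)⁻¹) (-l) t := by
  have := HasDerivAt.fun_inv hf h0
  exact this.congr_deriv (by field_simp)

theorem div (hf : HasLogDerivAt f l t) (hg : HasLogDerivAt g m t) (h0 : g t ≠ 0) :
    HasLogDerivAt (fun s => f s / g s) (l - m) t := by
  simpa only [div_eq_mul_inv, sub_eq_add_neg] using hf.mul (hg.inv h0)

theorem pow (hf : HasLogDerivAt f l t) (k : ℕ) :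
    HasLogDerivAt (fun s => f s ^ k) (k * l) t := by
  induction k with
  | zero => simpa [HasLogDerivAt] using hasDerivAt_const t (1 : ℂ)
  | succ k ih =>
    simp only [pow_succ]
    convert ih.mul hf using 1
    push_cast; ring

theorem const (c : ℂ) : HasLogDerivAt (fun _ => c) 0 t := by
  simpa [HasLogDerivAt] using hasDerivAt_const t c

theorem prod {ι : Type*} (s : Finset ι) {f : ι → ℂ → ℂ} {l : ι → ℂ}
    (hf : ∀ i ∈ s, HasLogDerivAt (f i) (l i) t) :
    HasLogDerivAt (fun z => ∏ i ∈ s, f i z) (∑ i ∈ s, l i) t := by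
  classical
  induction s using Finset.induction_on with
  | empty => simpa using const 1
  | insert a s ha ih =>
    simp only [Finset.prod_insert ha, Finset.sum_insert ha]
    exact (hf a (by simp)).mul (ih fun i hi => hf i (by simp [hi]))

end HasLogDerivAt

/-! ### Diagonal pencils of quadratic forms -/

section Diagonal
variable {W ι : Type*} [AddCommGroup W] [Module ℂ W] [Fintype ι]

/-- The quadratic form `∑ wᵢ zᵢ²` in the coordinates of a basis. -/
def diagForm (e : Module.Basis ι ℂ W) (w : ι → ℂ) : QuadraticForm ℂ W :=
  (QuadraticMap.weightedSumSquares ℂ w).comp (e.equivFun : W →ₗ[ℂ] ι → ℂ)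

theorem diagForm_apply (e : Module.Basis ι ℂ W) (w : ι → ℂ) (v : W) :
    diagForm e w v = ∑ i, w i * e.repr v i ^ 2 := by
  simp [diagForm, QuadraticMap.weightedSumSquares_apply, pow_two]

theorem polar_diagForm (e : Module.Basis ι ℂ W) (w : ι → ℂ) (u v : W) :
    QuadraticMap.polar (diagForm e w) u v = 2 * ∑ i, w i * (e.repr u i * e.repr v i) := by
  simp only [QuadraticMap.polar, diagForm_apply, map_add, Finsupp.add_apply,
    ← Finset.sum_sub_distrib, Finset.mul_sum]
  exact Finset.sum_congr rfl fun i _ => by ring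

theorem diagForm_basis [DecidableEq ι] (e : Module.Basis ι ℂ W) (w : ι → ℂ) (k : ι) :
    diagForm e w (e k) = w k := by
  simp [diagForm_apply, Finsupp.single_apply]

theorem diagForm_comb (e : Module.Basis ι ℂ W) (s t : ℂ) (w w' : ι → ℂ) :
    s • diagForm e w + t • diagForm e w' = diagForm e (fun i => s * w i + t * w' i) := by
  ext v
  simp only [add_apply, smul_apply, diagForm_apply, smul_eq_mul,
    Finset.mul_sum, ← Finset.sum_add_distrib]
  exact Finset.sum_congr rfl fun i _ => by ring

theorem isDegenerate_diagForm (e : Module.Basis ι ℂ W) (w : ι → ℂ) :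
    IsDegenerate (diagForm e w) ↔ ∃ k, w k = 0 := by
  classical
  unfold IsDegenerate sing
  rw [Submodule.ne_bot_iff]
  constructor
  · rintro ⟨v, hv, hv0⟩
    by_contra! hw
    apply hv0
    apply e.repr.injective
    ext k
    have := congrArg (fun f => f (e k)) (LinearMap.mem_ker.mp hv)
    simp only [QuadraticMap.polarBilin_apply_apply, LinearMap.zero_apply, polar_diagForm] at this
    simpa [Finsupp.single_apply, hw k] using this
  · rintro ⟨k, hk⟩
    refine ⟨e k, ?_, e.ne_zero k⟩
    rw [LinearMap.mem_ker]
    ext v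
    simp [polar_diagForm, Finsupp.single_apply, hk]

/-- A quadratic form over `ℂ` is determined by its polarization. -/
theorem quadraticForm_ext_polar {q q' : QuadraticForm ℂ W}
    (h : ∀ u v, QuadraticMap.polar q u v = QuadraticMap.polar q' u v) : q = q' := by
  ext v
  have := h v v
  rw [QuadraticMap.polar_self, QuadraticMap.polar_self] at this
  simpa using this

theorem eq_diagForm_of_polar (e : Module.Basis ι ℂ W) (w : ι → ℂ) (q : QuadraticForm ℂ W)
    (hd : ∀ k, q (e k) = w k)
    (ho : ∀ k l, k ≠ l → QuadraticMap.polar q (e k) (e l) = 0) : q = diagForm e w := by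
  classical
  have hB : q.polarBilin = (diagForm e w).polarBilin := by
    refine LinearMap.ext_basis e e fun k l => ?_
    simp only [QuadraticMap.polarBilin_apply_apply]
    rcases eq_or_ne k l with rfl | hkl
    · rw [QuadraticMap.polar_self, QuadraticMap.polar_self, hd, diagForm_basis]
    · rw [ho k l hkl, polar_diagForm]
      simp [Finsupp.single_apply, hkl]
  exact quadraticForm_ext_polar fun u v => by
    simpa using congrArg (fun B => B u v) hB

/-- The pencil spanned by `∑ λᵢ βᵢ zᵢ²` and `∑ βᵢ zᵢ²` in the coordinates of a basis. Its degenerate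
members are given by the `λᵢ`. -/
def diagPencil (e : Module.Basis ι ℂ W) (l β : ι → ℂ) : Submodule ℂ (QuadraticForm ℂ W) :=
  Submodule.span ℂ {diagForm e (fun i => l i * β i), diagForm e β}

theorem mem_diagPencil (e : Module.Basis ι ℂ W) (l β : ι → ℂ) (q : QuadraticForm ℂ W) :
    q ∈ diagPencil e l β ↔ ∃ s t : ℂ, q = diagForm e (fun i => (s * l i + t) * β i) := by
  simp only [diagPencil, Submodule.mem_span_pair, diagForm_comb]
  refine exists_congr fun s => exists_congr fun t => ?_
  rw [eq_comm]
  have : (fun i => s * (l i * β i) + t * β i) = fun i => (s * l i + t) * β i := by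
    funext i; ring
  rw [this]

end Diagonal

theorem quadratic_eq_zero {x y z A B C : ℂ} (hxy : x ≠ y) (hyz : y ≠ z) (hxz : x ≠ z)
    (hx : A + B * x + C * x ^ 2 = 0) (hy : A + B * y + C * y ^ 2 = 0)
    (hz : A + B * z + C * z ^ 2 = 0) : A = 0 ∧ B = 0 ∧ C = 0 := by
  have h1 : B + C * (x + y) = 0 :=
    mul_left_cancel₀ (sub_ne_zero.mpr hxy) (by linear_combination hx - hy)
  have h2 : B + C * (y + z) = 0 :=
    mul_left_cancel₀ (sub_ne_zero.mpr hyz) (by linear_combination hy - hz)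
  have hC : C = 0 := mul_left_cancel₀ (sub_ne_zero.mpr hxz) (by linear_combination h1 - h2)
  subst hC
  have hB : B = 0 := by linear_combination h1
  subst hB
  exact ⟨by linear_combination hx, rfl, rfl⟩

/-- `l` and `m` have the same cross ratios, in a form without denominators. -/
def CrossEq {ι : Type*} (l m : ι → ℂ) : Prop :=
  ∀ i j k r, (l i - l j) * (l k - l r) * ((m i - m r) * (m k - m j)) =
    (m i - m j) * (m k - m r) * ((l i - l r) * (l k - l j))

/-- No nontrivial permutation of the points `lᵢ` of the line preserves their cross ratios. -/
def Asym {ι : Type*} (l : ι → ℂ) : Prop :=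
  ∀ σ : Equiv.Perm ι, CrossEq l (l ∘ σ) → σ = 1

theorem moebius_sub {ι : Type*} {l m : ι → ℂ} {a b c d : ℂ}
    (h : ∀ k, l k * (c * m k + d) = a * m k + b) (i j : ι) :
    (l i - l j) * ((c * m i + d) * (c * m j + d)) = (a * d - b * c) * (m i - m j) := by
  linear_combination (c * m j + d) * h i - (c * m i + d) * h j

theorem crossEq_of_moebius {ι : Type*} {l m : ι → ℂ} {a b c d : ℂ}
    (h0 : ∀ k, c * m k + d ≠ 0) (h : ∀ k, l k * (c * m k + d) = a * m k + b) : CrossEq l m := by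
  intro i j k r
  have H := moebius_sub h
  refine mul_right_cancel₀ (mul_ne_zero (mul_ne_zero (h0 i) (h0 j)) (mul_ne_zero (h0 k) (h0 r))) ?_
  calc _ = ((l i - l j) * ((c * m i + d) * (c * m j + d))) *
        ((l k - l r) * ((c * m k + d) * (c * m r + d))) * ((m i - m r) * (m k - m j)) := by ring
    _ = ((l i - l r) * ((c * m i + d) * (c * m r + d))) *
        ((l k - l j) * ((c * m k + d) * (c * m j + d))) * ((m i - m j) * (m k - m r)) := by
      rw [H, H, H, H]; ring
    _ = _ := by ring

section Pencil
variable {W : Type*} [AddCommGroup W] [Module ℂ W] {n : ℕ}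

theorem isNonsingularPencil_diagPencil (hn : 2 ≤ n) (e : Module.Basis (Fin n) ℂ W)
    {l β : Fin n → ℂ} (hl : Function.Injective l) (hβ : ∀ i, β i ≠ 0) :
    IsNonsingularPencil (diagPencil e l β) := by
  classical
  have : Nontrivial (Fin n) := Fin.nontrivial_iff_two_le.mpr hn
  have hne : ∀ k, diagForm e (fun i => (l i - l k) * β i) ≠ 0 := by
    intro k h0
    obtain ⟨j, hj⟩ := exists_ne k
    have := congrArg (fun q => q (e j)) h0
    simp only [diagForm_basis, zero_apply, mul_eq_zero, hβ j, or_false] at this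
    exact hj (hl (sub_eq_zero.mp this))
  refine ⟨?_, ⟨diagForm e β, Submodule.subset_span (by simp), ?_⟩, ?_⟩
  · have hli : LinearIndependent ℂ ![diagForm e (fun i => l i * β i), diagForm e β] := by
      rw [LinearIndependent.pair_iff]
      intro s t hst
      rw [diagForm_comb] at hst
      have hk : ∀ k, s * l k + t = 0 := by
        intro k
        have := congrArg (fun q => q (e k)) hst
        simp only [diagForm_basis, zero_apply] at this
        exact mul_right_cancel₀ (hβ k) (by linear_combination this)
      obtain ⟨i, j, hij⟩ := exists_pair_ne (Fin n)
      have hs : s = 0 := mul_right_cancel₀ (sub_ne_zero.mpr (hl.ne hij))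
        (by linear_combination hk i - hk j)
      subst hs
      exact ⟨rfl, by simpa using hk i⟩
    have := finrank_span_eq_card hli
    rwa [Matrix.range_cons_cons_empty, Fintype.card_fin] at this
  · rw [isDegenerate_diagForm]
    simpa using hβ
  · have hrange : degeneratePoints (diagPencil e l β) =
        Set.range fun k => Projectivization.mk ℂ _ (hne k) := by
      ext p
      simp only [degeneratePoints, Set.mem_ofPred_eq, Set.mem_range]
      rw [Projectivization.submodule_eq, Submodule.span_singleton_le_iff_mem, mem_diagPencil]
      constructor
      · rintro ⟨⟨s, t, hp⟩, hdeg⟩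
        rw [hp, isDegenerate_diagForm] at hdeg
        obtain ⟨k, hk⟩ := hdeg
        have hk' : s * l k + t = 0 := by simpa [hβ k] using hk
        refine ⟨k, ?_⟩
        conv_rhs => rw [← p.mk_rep]
        rw [Projectivization.mk_eq_mk_iff']
        have hrep : p.rep = s • diagForm e (fun i => (l i - l k) * β i) := by
          have := diagForm_comb e s 0 (fun i => (l i - l k) * β i) 0
          rw [zero_smul, add_zero] at this
          rw [hp, this]
          congr 1
          funext i
          simp only [Pi.zero_apply, mul_zero, add_zero]
          linear_combination β i * hk'
        have hs : s ≠ 0 := by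
          rintro rfl
          exact p.rep_nonzero (by rw [hrep, zero_smul])
        exact ⟨s⁻¹, by rw [hrep, smul_smul, inv_mul_cancel₀ hs, one_smul]⟩
      · rintro ⟨k, rfl⟩
        obtain ⟨a, ha⟩ := Projectivization.exists_smul_eq_mk_rep ℂ _ (hne k)
        have hrep : (Projectivization.mk ℂ _ (hne k)).rep =
            diagForm e (fun i => ((a : ℂ) * l i + -(a * l k)) * β i) := by
          rw [← ha]
          have := diagForm_comb e a 0 (fun i => (l i - l k) * β i) 0
          rw [zero_smul, add_zero] at this
          rw [Units.smul_def, this]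
          congr 1
          funext i
          simp only [Pi.zero_apply, mul_zero, add_zero]
          ring
        refine ⟨⟨_, _, hrep⟩, ?_⟩
        rw [hrep, isDegenerate_diagForm]
        exact ⟨k, by ring⟩
    have hinj : Function.Injective fun k => Projectivization.mk ℂ _ (hne k) := by
      intro k k' h
      obtain ⟨a, ha⟩ := (Projectivization.mk_eq_mk_iff' ..).mp h
      by_contra hkk
      have h1 := congrArg (fun q => q (e k)) ha
      simp only [smul_apply, diagForm_basis, sub_self, zero_mul, smul_eq_mul,
        mul_eq_zero, hβ k, or_false, sub_eq_zero, hl.eq_iff, hkk] at h1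
      subst h1
      exact hne k (by rw [← ha, zero_smul])
    rw [hrange, ← Set.image_univ, Set.ncard_image_of_injective _ hinj, Set.ncard_univ,
      Nat.card_fin, Module.finrank_eq_card_basis e, Fintype.card_fin]

/-- A projective automorphism that preserves the degenerate members of a diagonal pencil permutes
the `lᵢ` by a Möbius transformation. -/
theorem hasOnlyTrivialAut_diagPencil (hn : 3 ≤ n) (e : Module.Basis (Fin n) ℂ W)
    {l β : Fin n → ℂ} (hl : Function.Injective l) (hβ : ∀ i, β i ≠ 0) (ha : Asym l) :
    HasOnlyTrivialAut (diagPencil e l β) := by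
  classical
  intro g hg
  let Q₁ : diagPencil e l β := ⟨diagForm e (fun i => l i * β i), Submodule.subset_span (by simp)⟩
  let Q₂ : diagPencil e l β := ⟨diagForm e β, Submodule.subset_span (by simp)⟩
  obtain ⟨a, b, h1⟩ := (mem_diagPencil e l β _).mp (g Q₁).2
  obtain ⟨c, d, h2⟩ := (mem_diagPencil e l β _).mp (g Q₂).2
  have hcd : ∀ j, c * l j + d ≠ 0 := by
    have hQ : ¬ IsDegenerate (Q₂ : QuadraticForm ℂ W) := by
      simpa [Q₂, isDegenerate_diagForm] using hβ
    rw [hg Q₂, h2, isDegenerate_diagForm] at hQ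
    push Not at hQ
    exact fun j hj => hQ j (by rw [hj, zero_mul])
  have hσ : ∀ k, ∃ j, l k * (c * l j + d) = a * l j + b := by
    intro k
    have hQ : IsDegenerate ((Q₁ - l k • Q₂ : diagPencil e l β) : QuadraticForm ℂ W) := by
      have : ((Q₁ - l k • Q₂ : diagPencil e l β) : QuadraticForm ℂ W) =
          (1 : ℂ) • diagForm e (fun i => l i * β i) + (-l k) • diagForm e β := by
        simp [Q₁, Q₂, sub_eq_add_neg]
      rw [this, diagForm_comb, isDegenerate_diagForm]
      exact ⟨k, by ring⟩
    rw [hg, map_sub, map_smul] at hQ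
    have : ((g Q₁ - l k • g Q₂ : diagPencil e l β) : QuadraticForm ℂ W) =
        (1 : ℂ) • diagForm e (fun i => (a * l i + b) * β i) +
          (-l k) • diagForm e (fun i => (c * l i + d) * β i) := by
      simp [h1, h2, sub_eq_add_neg]
    rw [this, diagForm_comb, isDegenerate_diagForm] at hQ
    obtain ⟨j, hj⟩ := hQ
    refine ⟨j, mul_right_cancel₀ (hβ j) ?_⟩
    linear_combination -hj
  choose σ hσ using hσ
  have hinj : Function.Injective σ := by
    intro k k' h
    apply hl
    apply mul_right_cancel₀ (hcd (σ k))
    rw [hσ k, h, hσ k']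
  let τ : Equiv.Perm (Fin n) := Equiv.ofBijective σ (Finite.injective_iff_bijective.mp hinj)
  have hτ : τ = 1 := ha τ (crossEq_of_moebius (fun k => hcd (σ k)) hσ)
  have hfix : ∀ k, -b + (d - a) * l k + c * l k ^ 2 = 0 := by
    intro k
    have h := hσ k
    have : σ k = k := congrArg (fun t : Equiv.Perm (Fin n) => t k) hτ
    rw [this] at h
    linear_combination h
  have hne : ∀ i j : Fin n, i ≠ j → l i ≠ l j := fun i j h => hl.ne h
  obtain ⟨hb, hda, hc⟩ := quadratic_eq_zero
    (hne ⟨0, by omega⟩ ⟨1, by omega⟩ (by simp)) (hne ⟨1, by omega⟩ ⟨2, by omega⟩ (by simp))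
    (hne ⟨0, by omega⟩ ⟨2, by omega⟩ (by simp)) (hfix _) (hfix _) (hfix _)
  have hg1 : g Q₁ = a • Q₁ := by
    apply Subtype.ext
    rw [h1, neg_eq_zero.mp hb]
    ext v
    simp only [Q₁, Submodule.coe_smul, smul_apply, diagForm_apply, smul_eq_mul,
      Finset.mul_sum]
    exact Finset.sum_congr rfl fun i _ => by ring
  have hg2 : g Q₂ = a • Q₂ := by
    apply Subtype.ext
    rw [h2, hc, sub_eq_zero.mp hda]
    ext v
    simp only [Q₂, Submodule.coe_smul, smul_apply, diagForm_apply, smul_eq_mul,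
      Finset.mul_sum]
    exact Finset.sum_congr rfl fun i _ => by ring
  refine ⟨a, fun q => ?_⟩
  obtain ⟨s, t, hq⟩ := Submodule.mem_span_pair.mp q.2
  have : q = s • Q₁ + t • Q₂ := Subtype.ext (by simp [Q₁, Q₂, hq])
  rw [this, map_add, map_smul, map_smul, hg1, hg2, smul_add, smul_comm a s, smul_comm a t]

end Pencil

/-! ### Nonsingular intersections of two quadrics in standard coordinates -/

theorem exists_quadratic_root {a : ℂ} (ha : a ≠ 0) (b c : ℂ) :
    ∃ x, a * (x * x) + b * x + c = 0 := by
  obtain ⟨z, hz⟩ := IsAlgClosed.exists_pow_nat_eq (discrim a b c) (n := 2) (by norm_num)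
  exact exists_quadratic_eq_zero ha ⟨z, by rw [← hz, pow_two]⟩

section Spectral
variable {V : Type*} [AddCommGroup V] [Module ℂ V] [FiniteDimensional ℂ V]

/-- Simultaneous diagonalization: if no common eigenvector is isotropic, then there is an orthonormal
eigenbasis for the second form, and the eigenvalues are distinct. -/
theorem exists_simultaneous_diagonalization (q₁ q₂ : QuadraticForm ℂ V)
    (hq₁ : ¬ IsDegenerate q₁) (hq₂ : ¬ IsDegenerate q₂)
    (hiso : ∀ (v : V) (μ : ℂ), v ≠ 0 → q₁.polarBilin v = μ • q₂.polarBilin v → q₂ v ≠ 0) :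
    ∃ (b : Module.Basis (Fin (Module.finrank ℂ V)) ℂ V) (τ : Fin (Module.finrank ℂ V) → ℂ),
      Function.Injective τ ∧ (∀ i, τ i ≠ 0) ∧ q₁ = diagForm b τ ∧ q₂ = diagForm b 1 := by
  classical
  have hinj : Function.Injective q₂.polarBilin :=
    LinearMap.ker_eq_bot.mp (not_not.mp hq₂)
  let D : V ≃ₗ[ℂ] Module.Dual ℂ V :=
    LinearEquiv.ofInjectiveOfFinrankEq q₂.polarBilin hinj (Subspace.dual_finrank_eq).symm
  have hD : ∀ v, D v = q₂.polarBilin v := fun v => rfl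
  let A : Module.End ℂ V := (D.symm : Module.Dual ℂ V →ₗ[ℂ] V) ∘ₗ q₁.polarBilin
  have hA : ∀ v, q₂.polarBilin (A v) = q₁.polarBilin v := fun v => D.apply_symm_apply _
  have hAiff : ∀ (v : V) (μ : ℂ), A v = μ • v ↔ q₁.polarBilin v = μ • q₂.polarBilin v := by
    intro v μ
    rw [← hinj.eq_iff, hA, map_smul]
  have hsymm₂ : ∀ u v, q₂.polarBilin u v = q₂.polarBilin v u := fun u v => QuadraticMap.polar_comm ..
  have hsymm₁ : ∀ u v, q₁.polarBilin u v = q₁.polarBilin v u := fun u v => QuadraticMap.polar_comm ..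
  -- eigenvectors span: otherwise there is one that is orthogonal to all of them
  let U : Submodule ℂ V := Submodule.span ℂ {v | ∃ μ : ℂ, A v = μ • v}
  have hU : U = ⊤ := by
    by_contra hU
    let R : V →ₗ[ℂ] Module.Dual ℂ U := U.dualRestrict ∘ₗ q₂.polarBilin
    have hR : LinearMap.ker R ≠ ⊥ := by
      intro hbot
      have h1 := LinearMap.finrank_le_finrank_of_injective (LinearMap.ker_eq_bot.mp hbot)
      rw [Subspace.dual_finrank_eq] at h1
      exact absurd (Submodule.finrank_lt hU) (not_lt.mpr h1)
    have hmem : ∀ v, v ∈ LinearMap.ker R ↔ ∀ u ∈ U, q₂.polarBilin v u = 0 := by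
      intro v
      rw [LinearMap.mem_ker]
      constructor
      · intro h u hu
        exact congrArg (fun f => f ⟨u, hu⟩) h
      · intro h
        ext u
        exact h u u.2
    have hmaps : ∀ v ∈ LinearMap.ker R, A v ∈ LinearMap.ker R := by
      intro v hv
      rw [hmem] at hv ⊢
      intro u hu
      refine Submodule.span_induction (p := fun u _ => q₂.polarBilin (A v) u = 0) ?_ ?_ ?_ ?_ hu
      · rintro u ⟨μ, hu⟩
        rw [hA, hsymm₁, (hAiff u μ).mp hu, LinearMap.smul_apply, hsymm₂,
          hv u (Submodule.subset_span ⟨μ, hu⟩), smul_zero]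
      · simp
      · intro x y _ _ hx hy
        rw [map_add, hx, hy, add_zero]
      · intro c x _ hx
        rw [map_smul, hx, smul_zero]
    have : Nontrivial (LinearMap.ker R) := Submodule.nontrivial_iff_ne_bot.mpr hR
    obtain ⟨μ, hμ⟩ := Module.End.exists_eigenvalue (A.restrict hmaps)
    obtain ⟨v, hv⟩ := hμ.exists_hasEigenvector
    have hv1 : A v = μ • (v : V) := congrArg Subtype.val hv.apply_eq_smul
    have hv0 : (v : V) ≠ 0 := fun h => hv.2 (Subtype.ext h)
    apply hiso v μ hv0 ((hAiff _ _).mp hv1)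
    have := (hmem v).mp v.2 v (Submodule.subset_span ⟨μ, hv1⟩)
    rw [QuadraticMap.polarBilin_apply_apply, QuadraticMap.polar_self] at this
    simpa using this
  have hex : ∀ μ : A.Eigenvalues, ∃ v, A.HasEigenvector μ v ∧ q₂ v = 1 := by
    intro μ
    obtain ⟨v, hv⟩ := Module.End.HasEigenvalue.exists_hasEigenvector (f := A) μ.2
    have h0 := hiso v μ hv.2 ((hAiff _ _).mp hv.apply_eq_smul)
    obtain ⟨s, hs⟩ := IsAlgClosed.exists_pow_nat_eq (q₂ v) (n := 2) (by norm_num)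
    have hs0 : s ≠ 0 := by
      rintro rfl
      exact h0 (by rw [← hs]; norm_num)
    refine ⟨s⁻¹ • v, ⟨Submodule.smul_mem _ _ hv.1, smul_ne_zero (inv_ne_zero hs0) hv.2⟩, ?_⟩
    rw [QuadraticMap.map_smul, ← hs, smul_eq_mul]
    field_simp
  choose x hx hx1 using hex
  have hli : LinearIndependent ℂ x :=
    Module.End.eigenvectors_linearIndependent' A (fun μ : A.Eigenvalues => (μ : ℂ))
      Subtype.val_injective x hx
  have hspan : ⊤ ≤ Submodule.span ℂ (Set.range x) := by
    rw [← hU]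
    refine Submodule.span_le.mpr ?_
    rintro v ⟨μ, hv⟩
    by_cases hv0 : v = 0
    · rw [hv0]; exact zero_mem _
    have hev : A.HasEigenvector μ v := ⟨Module.End.mem_eigenspace_iff.mpr hv, hv0⟩
    let m : A.Eigenvalues := ⟨μ, Module.End.hasEigenvalue_of_hasEigenvector hev⟩
    -- an isotropic vector of the span of `v` and `x m` is an eigenvector, hence zero
    obtain ⟨s, hs⟩ := exists_quadratic_root one_ne_zero (QuadraticMap.polar q₂ v (x m)) (q₂ v)
    have hz : q₂ (v + s • x m) = 0 := by
      rw [QuadraticMap.map_add q₂, QuadraticMap.map_smul, QuadraticMap.polar_smul_right, hx1]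
      simp only [smul_eq_mul]
      linear_combination hs
    have hzero : v + s • x m = 0 := by
      by_contra hne
      refine hiso _ μ hne ((hAiff _ _).mp ?_) hz
      rw [map_add, map_smul, hv, (hx m).apply_eq_smul, smul_add, smul_comm μ s]
      rfl
    rw [eq_neg_of_add_eq_zero_left hzero]
    exact neg_mem (Submodule.smul_mem _ _ (Submodule.subset_span ⟨m, rfl⟩))
  let B := Module.Basis.mk hli hspan
  have hcard : Fintype.card A.Eigenvalues = Module.finrank ℂ V :=
    (Module.finrank_eq_card_basis B).symm
  let ε := Fintype.equivFinOfCardEq hcard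
  have hb : ∀ i, B.reindex ε i = x (ε.symm i) := fun i => by simp [B]
  have hq : ∀ i, q₁.polarBilin (x i) = (i : ℂ) • q₂.polarBilin (x i) :=
    fun i => (hAiff _ _).mp (hx i).apply_eq_smul
  have horth : ∀ i j, i ≠ j → q₂.polarBilin (x i) (x j) = 0 := by
    intro i j hij
    have h1 : q₁.polarBilin (x i) (x j) = (i : ℂ) * q₂.polarBilin (x i) (x j) := by
      rw [hq]; rfl
    have h2 : q₁.polarBilin (x i) (x j) = (j : ℂ) * q₂.polarBilin (x i) (x j) := by
      rw [hsymm₁, hq, hsymm₂ (x i)]; rfl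
    have : ((i : ℂ) - j) * q₂.polarBilin (x i) (x j) = 0 := by linear_combination h2 - h1
    exact (mul_eq_zero.mp this).resolve_left (sub_ne_zero.mpr (fun h => hij (Subtype.ext h)))
  have hq1 : ∀ i, q₁ (x i) = i := by
    intro i
    have h1 : q₁.polarBilin (x i) (x i) = (i : ℂ) * q₂.polarBilin (x i) (x i) := by
      rw [hq]; rfl
    rw [QuadraticMap.polarBilin_apply_apply, QuadraticMap.polarBilin_apply_apply,
      QuadraticMap.polar_self, QuadraticMap.polar_self, hx1] at h1
    simp only [nsmul_eq_mul, Nat.cast_ofNat, mul_one] at h1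
    linear_combination h1 / 2
  refine ⟨B.reindex ε, fun i => (ε.symm i : A.Eigenvalues), ?_, ?_, ?_, ?_⟩
  · exact Subtype.val_injective.comp ε.symm.injective
  · intro i h0
    apply hq₁
    unfold IsDegenerate sing
    rw [Submodule.ne_bot_iff]
    refine ⟨x (ε.symm i), ?_, (hx _).2⟩
    rw [LinearMap.mem_ker, hq]
    exact (congrArg (fun c : ℂ => c • _) h0).trans (zero_smul ..)
  · refine eq_diagForm_of_polar _ _ _ (fun k => by rw [hb, hq1]) fun k l hkl => ?_
    have : q₁.polarBilin (x (ε.symm k)) (x (ε.symm l)) = 0 := by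
      rw [hq, LinearMap.smul_apply, horth _ _ (ε.symm.injective.ne hkl), smul_zero]
    rwa [hb, hb]
  · refine eq_diagForm_of_polar _ _ _ (fun k => by rw [hb, hx1]; rfl) fun k l hkl => ?_
    rw [hb, hb]
    exact horth _ _ (ε.symm.injective.ne hkl)

end Spectral

section Existence
variable {N : ℕ}

/-- The Gram matrix of the polarization of a quadratic form. -/
def polarMatrix (q : QuadraticForm ℂ (Fin N → ℂ)) : Matrix (Fin N) (Fin N) ℂ :=
  LinearMap.toMatrix₂' ℂ q.polarBilin

theorem polar_eq_dotProduct (q : QuadraticForm ℂ (Fin N → ℂ)) (u v : Fin N → ℂ) :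
    QuadraticMap.polar q u v = ∑ i, u i * ∑ j, polarMatrix q i j * v j := by
  have h : Matrix.toLinearMap₂' ℂ (polarMatrix q) = q.polarBilin := by
    simp [polarMatrix]
  have := congrArg (fun B => B u v) h
  simp only [QuadraticMap.polarBilin_apply_apply] at this
  rw [← this, Matrix.toLinearMap₂'_apply']
  rfl

theorem polarMatrix_comm (q : QuadraticForm ℂ (Fin N → ℂ)) (i j : Fin N) :
    polarMatrix q i j = polarMatrix q j i := by
  simp only [polarMatrix, LinearMap.toMatrix₂'_apply, QuadraticMap.polarBilin_apply_apply]
  exact QuadraticMap.polar_comm ..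

theorem not_isDegenerate_of_det_ne_zero (q : QuadraticForm ℂ (Fin N → ℂ))
    (h : (polarMatrix q).det ≠ 0) : ¬ IsDegenerate q := by
  intro hd
  obtain ⟨v, hv, hv0⟩ := (Submodule.ne_bot_iff _).mp hd
  apply h
  rw [← Matrix.exists_mulVec_eq_zero_iff]
  refine ⟨v, hv0, ?_⟩
  funext i
  have h1 : QuadraticMap.polar q (Pi.single i 1) v = 0 := by
    rw [QuadraticMap.polar_comm]
    exact congrArg (fun f => f (Pi.single i 1)) (LinearMap.mem_ker.mp hv)
  rw [polar_eq_dotProduct] at h1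
  simpa [Pi.single_apply, Matrix.mulVec, dotProduct] using h1

theorem polarMatrix_comb (s t : ℂ) (q q' : QuadraticForm ℂ (Fin N → ℂ)) :
    polarMatrix (s • q + t • q') = s • polarMatrix q + t • polarMatrix q' := by
  ext i j
  simp only [polarMatrix, LinearMap.toMatrix₂'_apply, QuadraticMap.polarBilin_apply_apply,
    Matrix.add_apply, Matrix.smul_apply]
  rw [FunLike.coe_add, QuadraticMap.polar_add, FunLike.coe_smul, FunLike.coe_smul,
    QuadraticMap.polar_smul, QuadraticMap.polar_smul]

open Polynomial in
/-- A pencil with nonsingular base locus has a nondegenerate member. Otherwise there is a polynomial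
family `v` of kernel vectors of the members `q₁ - X q₂`, and differentiation of the equation
`(q₁ - X q₂) v = 0` shows that `v` lies in the base locus, where it is a singular point. -/
theorem det_pencil_ne_zero (q₁ q₂ : QuadraticForm ℂ (Fin N → ℂ))
    (hX : IsNonsingularIntersection q₁ q₂) :
    ((polarMatrix q₁).map C - (X : ℂ[X]) • (polarMatrix q₂).map C).det ≠ 0 := by
  intro hdet
  obtain ⟨v, hv0, hv⟩ := Matrix.exists_mulVec_eq_zero_iff.mpr hdet
  have hM : ∀ i, ∑ j, (C (polarMatrix q₁ i j) - X * C (polarMatrix q₂ i j)) * v j = 0 := by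
    intro i
    have := congrFun hv i
    simpa [Matrix.mulVec, dotProduct] using this
  have hM' : ∀ i, ∑ j, (-C (polarMatrix q₂ i j) * v j +
      (C (polarMatrix q₁ i j) - X * C (polarMatrix q₂ i j)) * derivative (v j)) = 0 := by
    intro i
    have := congrArg derivative (hM i)
    rw [derivative_sum, derivative_zero] at this
    rw [← this]
    refine Finset.sum_congr rfl fun j _ => ?_
    simp [derivative_mul]
  have hswap : ∑ i, v i * ∑ j, (C (polarMatrix q₁ i j) - X * C (polarMatrix q₂ i j)) *
      derivative (v j) = 0 := by
    simp only [Finset.mul_sum]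
    rw [Finset.sum_comm]
    refine Finset.sum_eq_zero fun j _ => ?_
    have : ∑ i, v i * ((C (polarMatrix q₁ i j) - X * C (polarMatrix q₂ i j)) * derivative (v j)) =
        derivative (v j) * ∑ i, (C (polarMatrix q₁ j i) - X * C (polarMatrix q₂ j i)) * v i := by
      rw [Finset.mul_sum]
      refine Finset.sum_congr rfl fun i _ => ?_
      rw [polarMatrix_comm q₁ j i, polarMatrix_comm q₂ j i]
      ring
    rw [this, hM, mul_zero]
  have h2 : ∑ i, v i * ∑ j, C (polarMatrix q₂ i j) * v j = 0 := by
    have h : ∑ i, v i * ∑ j, (-C (polarMatrix q₂ i j) * v j +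
        (C (polarMatrix q₁ i j) - X * C (polarMatrix q₂ i j)) * derivative (v j)) = 0 :=
      Finset.sum_eq_zero fun i _ => by rw [hM', mul_zero]
    simp only [Finset.sum_add_distrib, mul_add, hswap, add_zero, neg_mul, Finset.sum_neg_distrib,
      mul_neg] at h
    exact neg_eq_zero.mp h
  obtain ⟨k, hk⟩ := Function.ne_iff.mp hv0
  obtain ⟨z, hz⟩ : ∃ z, (v k).eval z ≠ 0 := by
    by_contra! h
    exact hk (Polynomial.funext fun z => by rw [h z]; simp)
  let u : Fin N → ℂ := fun i => (v i).eval z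
  have hu0 : u ≠ 0 := fun h => hz (congrFun h k)
  have hu2 : QuadraticMap.polar q₂ u u = 0 := by
    have := congrArg (eval z) h2
    rw [polar_eq_dotProduct]
    simpa [eval_finsetSum, u] using this
  have hu : ∀ i, ∑ j, polarMatrix q₁ i j * u j = z * ∑ j, polarMatrix q₂ i j * u j := by
    intro i
    have := congrArg (eval z) (hM i)
    simp only [eval_finsetSum, eval_mul, eval_sub, eval_C, eval_X, eval_zero, sub_mul,
      Finset.sum_sub_distrib, sub_eq_zero] at this
    rw [Finset.mul_sum, this]
    exact Finset.sum_congr rfl fun j _ => by simp [u]; ring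
  have hpol : q₁.polarBilin u = z • q₂.polarBilin u := by
    ext w
    simp only [LinearMap.comp_apply, LinearMap.smul_apply, QuadraticMap.polarBilin_apply_apply]
    rw [QuadraticMap.polar_comm, QuadraticMap.polar_comm q₂, polar_eq_dotProduct,
      polar_eq_dotProduct, smul_eq_mul, Finset.mul_sum]
    refine Finset.sum_congr rfl fun i _ => ?_
    rw [hu]; ring
  have hu1 : QuadraticMap.polar q₁ u u = 0 := by
    have := congrArg (fun f => f u) hpol
    simpa [hu2] using this
  rw [QuadraticMap.polar_self] at hu1 hu2
  have := hX u hu0 (by simpa using hu1) (by simpa using hu2)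
  rw [LinearIndependent.pair_iff] at this
  have h1 := (this 1 (-z) (by rw [hpol, one_smul, neg_smul, add_neg_cancel])).1
  exact one_ne_zero h1

theorem exists_isotropic (hN : 2 ≤ N) (q : QuadraticForm ℂ (Fin N → ℂ)) : ∃ v, v ≠ 0 ∧ q v = 0 := by
  let u : Fin N → ℂ := Pi.single ⟨0, by omega⟩ 1
  let w : Fin N → ℂ := Pi.single ⟨1, by omega⟩ 1
  by_cases hw : q w = 0
  · exact ⟨w, by simp [w], hw⟩
  obtain ⟨s, hs⟩ := exists_quadratic_root hw (QuadraticMap.polar q u w) (q u)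
  refine ⟨u + s • w, ?_, ?_⟩
  · intro h
    have := congrFun h ⟨0, by omega⟩
    simp [u, w] at this
  · rw [QuadraticMap.map_add q, QuadraticMap.map_smul, QuadraticMap.polar_smul_right]
    simp only [smul_eq_mul]
    linear_combination hs

theorem linearIndependent_of_nonsingular (hN : 2 ≤ N) (q₁ q₂ : QuadraticForm ℂ (Fin N → ℂ))
    (hX : IsNonsingularIntersection q₁ q₂) : LinearIndependent ℂ ![q₁, q₂] := by
  rw [LinearIndependent.pair_iff]
  intro s t hst
  by_contra hne
  have key : ∀ v, s * q₁ v + t * q₂ v = 0 := fun v => by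
    have := congrArg (fun q => q v) hst
    simpa using this
  obtain ⟨v, hv0, hv1, hv2⟩ : ∃ v, v ≠ 0 ∧ q₁ v = 0 ∧ q₂ v = 0 := by
    by_cases hs : s = 0
    · have ht : t ≠ 0 := fun ht => hne ⟨hs, ht⟩
      obtain ⟨v, hv0, hv⟩ := exists_isotropic hN q₁
      exact ⟨v, hv0, hv, by simpa [hs, ht] using key v⟩
    · obtain ⟨v, hv0, hv⟩ := exists_isotropic hN q₂
      exact ⟨v, hv0, by simpa [hv, hs] using key v, hv⟩
  have := hX v hv0 hv1 hv2
  rw [LinearIndependent.pair_iff] at this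
  refine hne (this s t ?_)
  ext w
  have h := congrArg (fun q : QuadraticForm ℂ (Fin N → ℂ) => QuadraticMap.polar q v (Pi.single w 1)) hst
  simp only [FunLike.coe_add, QuadraticMap.polar_add, FunLike.coe_smul,
    QuadraticMap.polar_smul] at h
  simpa [QuadraticMap.polar] using h

theorem exists_isGoodPair (hN : 2 ≤ N) (q₁ q₂ : QuadraticForm ℂ (Fin N → ℂ))
    (hX : IsNonsingularIntersection q₁ q₂) :
    ∃ φ₁ φ₂, IsGoodPair (Submodule.span ℂ {q₁, q₂}) φ₁ φ₂ := by
  classical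
  set P := ((polarMatrix q₁).map Polynomial.C -
    (Polynomial.X : Polynomial ℂ) • (polarMatrix q₂).map Polynomial.C).det with hP
  have hP0 : P ≠ 0 := det_pencil_ne_zero q₁ q₂ hX
  have heval : ∀ z, P.eval z = (polarMatrix (q₁ + (-z) • q₂)).det := by
    intro z
    have h1 := polarMatrix_comb 1 (-z) q₁ q₂
    rw [one_smul, one_smul] at h1
    rw [h1, hP, ← Polynomial.coe_evalRingHom, RingHom.map_det]
    congr 1
    ext i j
    simp
    ring
  have hfin : Set.Infinite {z | ¬ P.IsRoot z} :=
    (Polynomial.finite_setOfPred_isRoot hP0).infinite_compl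
  obtain ⟨z, hz, z', hz', hzz⟩ := hfin.nontrivial
  have hnd : ∀ z, ¬ P.IsRoot z → ¬ IsDegenerate (q₁ + (-z) • q₂) := fun z hz =>
    not_isDegenerate_of_det_ne_zero _ (by rw [← heval]; exact hz)
  have hli := linearIndependent_of_nonsingular hN q₁ q₂ hX
  have hd : z' - z ≠ 0 := sub_ne_zero.mpr hzz.symm
  refine ⟨q₁ + (-z) • q₂, q₁ + (-z') • q₂, ?_, ?_, hnd z hz, hnd z' hz'⟩
  · rw [LinearIndependent.pair_iff] at hli ⊢
    intro s t hst
    obtain ⟨h1, h2⟩ := hli (s + t) (-(s * z + t * z')) (by rw [← hst]; module)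
    have ht : t = 0 := mul_right_cancel₀ hd (by linear_combination (-z) * h1 - h2)
    exact ⟨by linear_combination h1 - ht, ht⟩
  · apply le_antisymm
    · rw [Submodule.span_le]
      rintro q (rfl | rfl)
      · exact Submodule.mem_span_pair.mpr ⟨1, -z, by rw [one_smul]⟩
      · exact Submodule.mem_span_pair.mpr ⟨1, -z', by rw [one_smul]⟩
    · rw [Submodule.span_le]
      have e2 : q₂ = (z' - z)⁻¹ • (q₁ + (-z) • q₂) + (-(z' - z)⁻¹) • (q₁ + (-z') • q₂) := by
        have : q₂ = ((z' - z)⁻¹ * (z' - z)) • q₂ := by rw [inv_mul_cancel₀ hd, one_smul]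
        nth_rewrite 1 [this]
        module
      have e1 : q₁ = (z' * (z' - z)⁻¹) • (q₁ + (-z) • q₂) +
          (-(z * (z' - z)⁻¹)) • (q₁ + (-z') • q₂) := by
        have : q₁ = ((z' - z)⁻¹ * (z' - z)) • q₁ := by rw [inv_mul_cancel₀ hd, one_smul]
        nth_rewrite 1 [this]
        module
      rintro q (rfl | rfl)
      · exact Submodule.mem_span_pair.mpr ⟨_, _, e1.symm⟩
      · exact Submodule.mem_span_pair.mpr ⟨_, _, e2.symm⟩

/-- A good pair of the equations of a nonsingular intersection has a standard basis. -/
theorem exists_standard_basis (q₁ q₂ φ₁ φ₂ : QuadraticForm ℂ (Fin N → ℂ))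
    (hX : IsNonsingularIntersection q₁ q₂)
    (hφ : IsGoodPair (Submodule.span ℂ {q₁, q₂}) φ₁ φ₂) :
    ∃ (b : Module.Basis (Fin N) ℂ (Fin N → ℂ)) (τ : Fin N → ℂ),
      Function.Injective τ ∧ (∀ i, τ i ≠ 0) ∧ φ₁ = diagForm b τ ∧ φ₂ = diagForm b 1 := by
  have h := exists_simultaneous_diagonalization φ₁ φ₂ hφ.nondegenerate₁ hφ.nondegenerate₂ ?_
  · rwa [Module.finrank_fin_fun] at h
  intro v μ hv0 hv h2
  have h1 : φ₁ v = 0 := by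
    have := congrArg (fun f => f v) hv
    simp only [LinearMap.smul_apply, QuadraticMap.polarBilin_apply_apply,
      QuadraticMap.polar_self, h2] at this
    simpa using this
  have hcomb : ∀ q ∈ Submodule.span ℂ {q₁, q₂}, q v = 0 ∧ ∃ c : ℂ, q.polarBilin v =
      c • φ₂.polarBilin v := by
    intro q hq
    rw [← hφ.span_eq] at hq
    obtain ⟨s, t, rfl⟩ := Submodule.mem_span_pair.mp hq
    refine ⟨by simp [h1, h2], s * μ + t, ?_⟩
    have e : (s • φ₁ + t • φ₂).polarBilin v = s • φ₁.polarBilin v + t • φ₂.polarBilin v := by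
      refine LinearMap.ext fun w => ?_
      simp only [QuadraticMap.polarBilin_apply_apply, LinearMap.add_apply, LinearMap.smul_apply]
      rw [FunLike.coe_add, QuadraticMap.polar_add, FunLike.coe_smul, FunLike.coe_smul,
        QuadraticMap.polar_smul, QuadraticMap.polar_smul]
    rw [e, hv, smul_smul, ← add_smul]
  obtain ⟨z1, c1, e1⟩ := hcomb q₁ (Submodule.subset_span (by simp))
  obtain ⟨z2, c2, e2⟩ := hcomb q₂ (Submodule.subset_span (by simp))
  have := hX v hv0 z1 z2
  rw [LinearIndependent.pair_iff] at this
  obtain ⟨h3, h4⟩ := this c2 (-c1) (by rw [e1, e2, smul_smul, smul_smul]; module)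
  rw [neg_eq_zero] at h4
  rw [h4, zero_smul] at e1
  exact one_ne_zero (this 1 0 (by rw [e1]; simp)).1

end Existence

/-! ### Orbits of pencils and of pairs -/

section Classes
variable {n : ℕ} {W : Type*} [AddCommGroup W] [Module ℂ W]

theorem pencilClass_eq_image (Φ : Submodule ℂ (QuadraticForm ℂ W)) (P : Submodule ℂ W) :
    pencilClass n Φ = Prod.fst '' pairClass n Φ P := by
  ext Ψ
  constructor
  · rintro ⟨T, hT⟩
    exact ⟨(Ψ, P.comap (T : (Fin n → ℂ) →ₗ[ℂ] W)), ⟨T, hT, rfl⟩, rfl⟩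
  · rintro ⟨y, ⟨T, hT, -⟩, rfl⟩
    exact ⟨T, hT⟩

theorem pairClass_congr {Φ : Submodule ℂ (QuadraticForm ℂ W)} {P : Submodule ℂ W}
    {Ψ : QuadSys n} {R : Submodule ℂ (Fin n → ℂ)} (S : (Fin n → ℂ) ≃ₗ[ℂ] W)
    (hΨ : (Ψ : Set (QuadraticForm ℂ (Fin n → ℂ))) =
      (fun q : QuadraticForm ℂ W => q.comp (S : (Fin n → ℂ) →ₗ[ℂ] W)) '' Φ)
    (hR : R = P.comap (S : (Fin n → ℂ) →ₗ[ℂ] W)) :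
    pairClass n Φ P = pairClass n Ψ R := by
  have hcomp : ∀ T' : (Fin n → ℂ) ≃ₗ[ℂ] (Fin n → ℂ),
      (fun q : QuadraticForm ℂ W => q.comp ((T'.trans S : (Fin n → ℂ) ≃ₗ[ℂ] W) :
        (Fin n → ℂ) →ₗ[ℂ] W)) '' Φ =
      (fun q : QuadraticForm ℂ (Fin n → ℂ) => q.comp (T' : (Fin n → ℂ) →ₗ[ℂ] (Fin n → ℂ))) '' Ψ ∧
      P.comap ((T'.trans S : (Fin n → ℂ) ≃ₗ[ℂ] W) : (Fin n → ℂ) →ₗ[ℂ] W) =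
        R.comap (T' : (Fin n → ℂ) →ₗ[ℂ] (Fin n → ℂ)) := by
    intro T'
    rw [hΨ, hR, Set.image_image]
    exact ⟨rfl, rfl⟩
  ext y
  constructor
  · rintro ⟨T, h1, h2⟩
    obtain ⟨e1, e2⟩ := hcomp (T.trans S.symm)
    have : (T.trans S.symm).trans S = T := by ext; simp
    rw [this] at e1 e2
    exact ⟨T.trans S.symm, h1.trans e1, h2.trans e2⟩
  · rintro ⟨T', h1, h2⟩
    obtain ⟨e1, e2⟩ := hcomp T'
    exact ⟨T'.trans S, h1.trans e1.symm, h2.trans e2.symm⟩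

theorem pencilClass_congr {Φ : Submodule ℂ (QuadraticForm ℂ W)}
    {Ψ : QuadSys n} (S : (Fin n → ℂ) ≃ₗ[ℂ] W)
    (hΨ : (Ψ : Set (QuadraticForm ℂ (Fin n → ℂ))) =
      (fun q : QuadraticForm ℂ W => q.comp (S : (Fin n → ℂ) →ₗ[ℂ] W)) '' Φ) :
    pencilClass n Φ = pencilClass n Ψ := by
  rw [pencilClass_eq_image Φ ⊥, pencilClass_eq_image Ψ _, pairClass_congr S hΨ rfl]

theorem mem_pairClass_self (Φ : QuadSys n) (P : Submodule ℂ (Fin n → ℂ)) :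
    (Φ, P) ∈ pairClass n Φ P := by
  refine ⟨LinearEquiv.refl ℂ _, ?_, rfl⟩
  simp only [LinearEquiv.refl_toLinearMap]
  exact (Set.image_id _).symm

theorem mem_pencilClass_self (Φ : QuadSys n) : Φ ∈ pencilClass n Φ := by
  rw [pencilClass_eq_image Φ ⊥]
  exact ⟨_, mem_pairClass_self Φ ⊥, rfl⟩

theorem comp_comb {U : Type*} [AddCommGroup U] [Module ℂ U] (T : U →ₗ[ℂ] W) (s t : ℂ)
    (q q' : QuadraticForm ℂ W) : (s • q + t • q').comp T = s • q.comp T + t • q'.comp T := by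
  ext; simp

theorem image_comp_span_pair {U : Type*} [AddCommGroup U] [Module ℂ U] (T : U →ₗ[ℂ] W)
    (q q' : QuadraticForm ℂ W) :
    (fun r : QuadraticForm ℂ W => r.comp T) '' (Submodule.span ℂ {q, q'} : Submodule ℂ _) =
      (Submodule.span ℂ {q.comp T, q'.comp T} : Submodule ℂ (QuadraticForm ℂ U)) := by
  ext r
  simp only [Set.mem_image, SetLike.mem_coe, Submodule.mem_span_pair]
  constructor
  · rintro ⟨_, ⟨s, t, rfl⟩, rfl⟩
    exact ⟨s, t, (comp_comb ..).symm⟩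
  · rintro ⟨s, t, rfl⟩
    exact ⟨_, ⟨s, t, rfl⟩, comp_comb ..⟩

theorem span_range_two {M : Type*} [AddCommGroup M] [Module ℂ M] (f : Fin 2 → M) :
    Submodule.span ℂ (Set.range f) = Submodule.span ℂ {f 0, f 1} := by
  congr 1
  ext x
  simp [Fin.exists_fin_two, eq_comm]

theorem span_range_comb {m : ℕ} {M : Type*} [AddCommGroup M] [Module ℂ M]
    (R : Matrix (Fin m) (Fin m) ℂ) (hR : R.det ≠ 0) (x : Fin m → M) :
    Submodule.span ℂ (Set.range fun k => ∑ j, R k j • x j) = Submodule.span ℂ (Set.range x) := by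
  apply le_antisymm
  · rw [Submodule.span_le]
    rintro _ ⟨k, rfl⟩
    exact Submodule.sum_mem _ fun j _ => Submodule.smul_mem _ _ (Submodule.subset_span ⟨j, rfl⟩)
  · rw [Submodule.span_le]
    rintro _ ⟨i, rfl⟩
    have h : x i = ∑ k, R⁻¹ i k • ∑ j, R k j • x j := by
      simp only [Finset.smul_sum, smul_smul]
      rw [Finset.sum_comm]
      simp only [← Finset.sum_smul, ← Matrix.mul_apply]
      rw [Matrix.nonsing_inv_mul _ (Ne.isUnit hR)]
      simp [Matrix.one_apply]
    rw [h]
    exact Submodule.sum_mem _ fun k _ => Submodule.smul_mem _ _ (Submodule.subset_span ⟨k, rfl⟩)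

/-- Two families with `y = R x`, of which `y` is linearly independent: the matrix `R` is
invertible. -/
theorem det_ne_zero_of_linearIndependent {m : ℕ} {M : Type*} [AddCommGroup M] [Module ℂ M]
    (R : Matrix (Fin m) (Fin m) ℂ) (x y : Fin m → M) (hy : LinearIndependent ℂ y)
    (h : ∀ k, y k = ∑ j, R k j • x j) : R.det ≠ 0 := by
  intro h0
  obtain ⟨v, hv0, hv⟩ := Matrix.exists_vecMul_eq_zero_iff.mpr h0
  apply hv0
  funext k
  refine Fintype.linearIndependent_iff.mp hy v ?_ k
  simp only [h, Finset.smul_sum, smul_smul]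
  rw [Finset.sum_comm]
  simp only [← Finset.sum_smul]
  refine Finset.sum_eq_zero fun j _ => ?_
  have := congrFun hv j
  simp only [Matrix.vecMul, dotProduct, Pi.zero_apply] at this
  rw [this, zero_smul]

end Classes

/-! ### The orbits of diagonal pencils -/

section Std
variable {n : ℕ}

/-- The pencil on `ℂⁿ` spanned by `∑ lᵢ βᵢ zᵢ²` and `∑ βᵢ zᵢ²`. -/
def stdSys (l β : Fin n → ℂ) : QuadSys n := diagPencil (Pi.basisFun ℂ (Fin n)) l β

/-- The pair of diagonal matrices of the two forms that span `stdSys`. -/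
def stdFrame (l β : Fin n → ℂ) : Fin 2 → Fin n → Fin n → ℂ :=
  ![Matrix.diagonal fun i => l i * β i, Matrix.diagonal β]

theorem toQuadraticForm'_apply (A : Matrix (Fin n) (Fin n) ℂ) (v : Fin n → ℂ) :
    A.toQuadraticForm' v = dotProduct v (A.mulVec v) := by
  simp [Matrix.toQuadraticForm', Matrix.toLinearMap₂'_apply']

theorem toQuadraticForm'_diagonal (w : Fin n → ℂ) :
    (Matrix.diagonal w).toQuadraticForm' = diagForm (Pi.basisFun ℂ (Fin n)) w := by
  ext v
  rw [toQuadraticForm'_apply, diagForm_apply]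
  simp only [dotProduct, Matrix.mulVec_diagonal, Pi.basisFun_repr]
  exact Finset.sum_congr rfl fun i _ => by ring

theorem frameSys_eq (A : Fin 2 → Fin n → Fin n → ℂ) :
    frameSys A = Submodule.span ℂ {(Matrix.of (A 0)).toQuadraticForm',
      (Matrix.of (A 1)).toQuadraticForm'} := span_range_two _

theorem frameSys_stdFrame (l β : Fin n → ℂ) : frameSys (stdFrame l β) = stdSys l β := by
  rw [frameSys_eq, stdSys, diagPencil, ← toQuadraticForm'_diagonal, ← toQuadraticForm'_diagonal]
  rfl

theorem stdSys_smul (l β : Fin n → ℂ) {c : ℂ} (hc : c ≠ 0) :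
    stdSys l (fun i => c * β i) = stdSys l β := by
  ext q
  simp only [stdSys, mem_diagPencil]
  constructor
  · rintro ⟨s, t, rfl⟩
    exact ⟨s * c, t * c, congrArg _ (by funext i; ring)⟩
  · rintro ⟨s, t, rfl⟩
    exact ⟨s / c, t / c, congrArg _ (by funext i; field_simp)⟩

/-- An isomorphism of diagonal pencils is monomial, and permutes the degenerate members by
a Möbius transformation. -/
theorem monomial_of_stdSys {l β l' β' : Fin n → ℂ} (hl : Function.Injective l)
    (hβ : ∀ i, β i ≠ 0) (T : (Fin n → ℂ) ≃ₗ[ℂ] (Fin n → ℂ))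
    (hT : (stdSys l' β' : Set (QuadraticForm ℂ (Fin n → ℂ))) =
      (fun q : QuadraticForm ℂ (Fin n → ℂ) => q.comp (T : (Fin n → ℂ) →ₗ[ℂ] (Fin n → ℂ))) ''
        (stdSys l β)) :
    ∃ (σ : Equiv.Perm (Fin n)) (a b c d : ℂ) (t : Fin n → ℂ),
      (∀ j, c * l' j + d ≠ 0) ∧ (∀ j, l (σ j) * (c * l' j + d) = a * l' j + b) ∧
      (∀ j, T (Pi.single j 1) = Pi.single (σ j) (t j)) ∧
      ∀ j, β (σ j) * t j ^ 2 = (c * l' j + d) * β' j := by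
  classical
  let e := Pi.basisFun ℂ (Fin n)
  have hpull : ∀ w : Fin n → ℂ, diagForm e w ∈ stdSys l β →
      ∃ s t : ℂ, ∀ i j, ∑ k, w k * (T (Pi.single i 1) k * T (Pi.single j 1) k) =
        if i = j then (s * l' i + t) * β' i else 0 := by
    intro w hw
    have hmem : (diagForm e w).comp (T : (Fin n → ℂ) →ₗ[ℂ] (Fin n → ℂ)) ∈ stdSys l' β' := by
      rw [← SetLike.mem_coe, hT]
      exact ⟨_, hw, rfl⟩
    obtain ⟨s, t, hst⟩ := (mem_diagPencil ..).mp hmem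
    refine ⟨s, t, fun i j => ?_⟩
    have h := congrArg (fun q : QuadraticForm ℂ (Fin n → ℂ) =>
      QuadraticMap.polar q (Pi.single i 1) (Pi.single j 1)) hst
    simp only [polar_diagForm] at h
    have h2 : QuadraticMap.polar ((diagForm e w).comp (T : (Fin n → ℂ) →ₗ[ℂ] (Fin n → ℂ)))
        (Pi.single i 1) (Pi.single j 1) =
        QuadraticMap.polar (diagForm e w) (T (Pi.single i 1)) (T (Pi.single j 1)) := by
      simp [QuadraticMap.polar]
    rw [h2, polar_diagForm] at h
    have h3 := mul_left_cancel₀ (two_ne_zero) h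
    simp only [e, Pi.basisFun_repr] at h3
    rw [h3]
    rcases eq_or_ne i j with rfl | hij
    · simp [Pi.single_apply]
    · simp [Pi.single_apply, hij, hij.symm]
  obtain ⟨a, b, h1⟩ := hpull (fun i => l i * β i) (Submodule.subset_span (by simp [e]))
  obtain ⟨c, d, h2⟩ := hpull β (Submodule.subset_span (by simp [e]))
  -- a vector that is orthogonal to the image of `T` vanishes
  have horth : ∀ u : Fin n → ℂ, (∀ i, ∑ k, u k * T (Pi.single i 1) k = 0) → u = 0 := by
    intro u hu
    have hall : ∀ x, ∑ k, u k * T x k = 0 := by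
      intro x
      have hx : x = ∑ i, x i • (Pi.single i 1 : Fin n → ℂ) := by
        conv_lhs => rw [← e.sum_repr x]
        simp [e]
      rw [hx, map_sum]
      simp only [map_smul, Finset.sum_apply, Pi.smul_apply, smul_eq_mul, Finset.mul_sum]
      rw [Finset.sum_comm]
      refine Finset.sum_eq_zero fun i _ => ?_
      have := congrArg (x i * ·) (hu i)
      simp only [Finset.mul_sum, mul_zero] at this
      rw [← this]
      exact Finset.sum_congr rfl fun k _ => by ring
    funext k
    have := hall (T.symm (Pi.single k 1))
    simpa [Pi.single_apply] using this
  have hne : ∀ j, T (Pi.single j 1) ≠ 0 := fun j h => by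
    have : (Pi.single j 1 : Fin n → ℂ) = 0 := T.injective (by rw [h, map_zero])
    simpa using congrFun this j
  have hcd : ∀ j, c * l' j + d ≠ 0 := by
    intro j h0
    apply hne j
    have := horth (fun k => β k * T (Pi.single j 1) k) fun i => by
      have := h2 i j
      rw [show (if i = j then (c * l' i + d) * β' i else 0) = 0 by
        split_ifs with hij
        · rw [hij, h0, zero_mul]
        · rfl] at this
      rw [← this]
      exact Finset.sum_congr rfl fun k _ => by ring
    funext k
    exact (mul_eq_zero.mp (congrFun this k)).resolve_left (hβ k)
  have hsupp : ∀ j k, T (Pi.single j 1) k ≠ 0 → l k * (c * l' j + d) = a * l' j + b := by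
    intro j k hk
    have := horth (fun k => β k * T (Pi.single j 1) k *
        (l k * (c * l' j + d) - (a * l' j + b))) fun i => by
      have e1 := congrArg (· * (c * l' j + d)) (h1 i j)
      have e2 := congrArg (· * (a * l' j + b)) (h2 i j)
      simp only [Finset.sum_mul] at e1 e2
      have e3 := congrArg₂ (· - ·) e1 e2
      simp only [← Finset.sum_sub_distrib] at e3
      have e4 : (if i = j then (a * l' i + b) * β' i else 0) * (c * l' j + d) -
          (if i = j then (c * l' i + d) * β' i else 0) * (a * l' j + b) = 0 := by
        split_ifs with hij
        · rw [hij]; ring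
        · ring
      rw [e4] at e3
      rw [← e3]
      exact Finset.sum_congr rfl fun k _ => by ring
    have h := congrFun this k
    simp only [Pi.zero_apply, mul_eq_zero, hβ k, hk, false_or, or_self] at h
    exact sub_eq_zero.mp h
  have hex : ∀ j, ∃ k, T (Pi.single j 1) k ≠ 0 := fun j => Function.ne_iff.mp (hne j)
  choose σ hσ using hex
  have huniq : ∀ j k, T (Pi.single j 1) k ≠ 0 → k = σ j := by
    intro j k hk
    apply hl
    apply mul_right_cancel₀ (hcd j)
    rw [hsupp j k hk, hsupp j _ (hσ j)]
  have hsurj : Function.Surjective σ := by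
    intro k
    by_contra! hk
    have := horth (Pi.single k 1) fun i => by
      have h0 : T (Pi.single i 1) k = 0 := by
        by_contra h
        exact hk i (huniq i k h).symm
      simp [Pi.single_apply, h0]
    simpa using congrFun this k
  refine ⟨Equiv.ofBijective σ (Finite.surjective_iff_bijective.mp hsurj), a, b, c, d,
    fun j => T (Pi.single j 1) (σ j), hcd, fun j => hsupp j _ (hσ j), fun j => ?_, fun j => ?_⟩
  · funext k
    rw [Equiv.ofBijective_apply]
    by_cases hk : k = σ j
    · simp [hk]
    · rw [Pi.single_eq_of_ne hk]
      by_contra h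
      exact hk (huniq j k h)
  · have := h2 j j
    rw [if_pos rfl, Finset.sum_eq_single (σ j)] at this
    · rw [← this, Equiv.ofBijective_apply]; ring
    · intro k _ hk
      have : T (Pi.single j 1) k = 0 := by
        by_contra h
        exact hk (huniq j k h)
      rw [this]; ring
    · simp

theorem eventually_asym {l₀ : Fin n → ℂ} (h : Asym l₀) :
    ∀ᶠ p in 𝓝 (l₀, l₀), ∀ σ : Equiv.Perm (Fin n), CrossEq p.1 (p.2 ∘ σ) → σ = 1 := by
  rw [Filter.eventually_all]
  intro σ
  by_cases hσ : σ = 1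
  · exact Filter.Eventually.of_forall fun _ _ => hσ
  have hne : ¬ CrossEq l₀ (l₀ ∘ σ) := fun h' => hσ (h σ h')
  simp only [CrossEq, not_forall] at hne
  obtain ⟨i, j, k, r, hne⟩ := hne
  have hc : ContinuousAt (fun p : (Fin n → ℂ) × (Fin n → ℂ) =>
      (p.1 i - p.1 j) * (p.1 k - p.1 r) * ((p.2 (σ i) - p.2 (σ r)) * (p.2 (σ k) - p.2 (σ j))) -
      (p.2 (σ i) - p.2 (σ j)) * (p.2 (σ k) - p.2 (σ r)) * ((p.1 i - p.1 r) * (p.1 k - p.1 j)))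
      (l₀, l₀) := by fun_prop
  filter_upwards [hc.eventually_ne (sub_ne_zero.mpr hne)] with p hp hcross
  exact absurd (sub_eq_zero.mpr (hcross i j k r)) hp

theorem eventually_asym_self {l₀ : Fin n → ℂ} (h : Asym l₀) : ∀ᶠ l in 𝓝 l₀, Asym l := by
  have hc : Filter.Tendsto (fun l : Fin n → ℂ => (l, l)) (𝓝 l₀) (𝓝 (l₀, l₀)) :=
    (continuous_id.prodMk continuous_id).continuousAt
  exact hc.eventually (eventually_asym h)

theorem eventually_injective {l₀ : Fin n → ℂ} (h : Function.Injective l₀) :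
    ∀ᶠ l in 𝓝 l₀, Function.Injective l := by
  have : ∀ᶠ l in 𝓝 l₀, ∀ i j : Fin n, i ≠ j → l i ≠ l j := by
    simp only [Filter.eventually_all]
    intro i j hij
    have hc : ContinuousAt (fun l : Fin n → ℂ => l i - l j) l₀ := by fun_prop
    filter_upwards [hc.eventually_ne (sub_ne_zero.mpr (h.ne hij))] with l hl
    exact sub_ne_zero.mp hl
  filter_upwards [this] with l hl i j hij
  by_contra hne
  exact hl i j hne hij

theorem eventually_forall_ne_zero {β₀ : Fin n → ℂ} (h : ∀ i, β₀ i ≠ 0) :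
    ∀ᶠ β in 𝓝 β₀, ∀ i, β i ≠ 0 := by
  rw [Filter.eventually_all]
  intro i
  exact (continuous_apply i).continuousAt.eventually_ne (h i)

end Std

/-! ### Local normal forms of pencils -/

section NormalForm
variable {n : ℕ}

/-- The symmetric part of a bilinear form in a frame of a pencil. -/
def symPart (B : Fin 2 → Fin n → Fin n → ℂ) (k : Fin 2) : Matrix (Fin n) (Fin n) ℂ :=
  Matrix.of fun i j => (B k i j + B k j i) / 2

theorem symPart_transpose (B : Fin 2 → Fin n → Fin n → ℂ) (k : Fin 2) :
    (symPart B k).transpose = symPart B k := by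
  ext i j
  simp [symPart, add_comm]

theorem symPart_stdFrame (l β : Fin n → ℂ) :
    symPart (stdFrame l β) 0 = Matrix.diagonal (fun i => l i * β i) ∧
      symPart (stdFrame l β) 1 = Matrix.diagonal β := by
  constructor <;> ext i j <;> rcases eq_or_ne i j with rfl | hij <;>
    simp [symPart, stdFrame, *, Ne.symm]

theorem symPart_toQuadraticForm' (B : Fin 2 → Fin n → Fin n → ℂ) (k : Fin 2) :
    (symPart B k).toQuadraticForm' = (Matrix.of (B k)).toQuadraticForm' := by
  ext v
  simp only [toQuadraticForm'_apply, dotProduct, Matrix.mulVec, symPart, Matrix.of_apply,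
    Finset.mul_sum]
  have h : ∑ i, ∑ j, v i * (B k j i * v j) = ∑ i, ∑ j, v i * (B k i j * v j) := by
    rw [Finset.sum_comm]
    exact Finset.sum_congr rfl fun i _ => Finset.sum_congr rfl fun j _ => by ring
  have h2 : ∑ i, ∑ j, v i * ((B k i j + B k j i) / 2 * v j) =
      (∑ i, ∑ j, v i * (B k i j * v j) + ∑ i, ∑ j, v i * (B k j i * v j)) / 2 := by
    rw [← Finset.sum_add_distrib, Finset.sum_div]
    refine Finset.sum_congr rfl fun i _ => ?_
    rw [← Finset.sum_add_distrib, Finset.sum_div]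
    exact Finset.sum_congr rfl fun j _ => by ring
  rw [h2, h]
  ring

theorem comp_toQuadraticForm' (A T : Matrix (Fin n) (Fin n) ℂ)
    (Te : (Fin n → ℂ) →ₗ[ℂ] (Fin n → ℂ)) (hTe : ∀ v, Te v = T.mulVec v) :
    A.toQuadraticForm'.comp Te = (T.transpose * A * T).toQuadraticForm' := by
  ext v
  simp only [QuadraticMap.comp_apply, toQuadraticForm'_apply, hTe]
  rw [← Matrix.mulVec_mulVec, ← Matrix.mulVec_mulVec, Matrix.mulVec_transpose,
    dotProduct_comm v, ← Matrix.dotProduct_mulVec, dotProduct_comm]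

theorem symm_ext_toQuadraticForm' {A B : Matrix (Fin n) (Fin n) ℂ} (hA : A.transpose = A)
    (hB : B.transpose = B) (h : A.toQuadraticForm' = B.toQuadraticForm') : A = B := by
  have hpol : ∀ C : Matrix (Fin n) (Fin n) ℂ, C.transpose = C → ∀ i j,
      QuadraticMap.polar C.toQuadraticForm' (Pi.single i 1) (Pi.single j 1) = 2 * C i j := by
    intro C hC i j
    have hij : C j i = C i j := congrFun (congrFun hC i) j
    simp only [QuadraticMap.polar, toQuadraticForm'_apply, Matrix.mulVec_add, add_dotProduct,
      dotProduct_add, Matrix.mulVec_single_one, single_one_dotProduct]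
    simp only [Matrix.col_apply, hij]
    ring
  ext i j
  have := hpol A hA i j
  rw [h, hpol B hB i j] at this
  exact (mul_left_cancel₀ two_ne_zero this).symm

/-- Frames near `stdFrame l₀ β₀` have a diagonal normal form that depends holomorphically on the
frame. The `lᵢ` are simple roots of the characteristic polynomial, and the eigenvectors are columns
of adjugate matrices. The matrix `R` is the inverse of the matrix of eigenvectors. -/
theorem exists_normalForm {l₀ β₀ : Fin n → ℂ} (hl : Function.Injective l₀)
    (hβ : ∀ i, β₀ i ≠ 0) :
    ∃ (l β : (Fin 2 → Fin n → Fin n → ℂ) → Fin n → ℂ)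
      (R : (Fin 2 → Fin n → Fin n → ℂ) → Matrix (Fin n) (Fin n) ℂ),
      l (stdFrame l₀ β₀) = l₀ ∧ β (stdFrame l₀ β₀) = β₀ ∧ R (stdFrame l₀ β₀) = 1 ∧
      ∀ᶠ B in 𝓝 (stdFrame l₀ β₀), DifferentiableAt ℂ l B ∧ DifferentiableAt ℂ β B ∧
        (∀ i j, DifferentiableAt ℂ (fun C => R C i j) B) ∧
        ∃ T : (Fin n → ℂ) ≃ₗ[ℂ] (Fin n → ℂ), (∀ w, T.symm w = (R B).mulVec w) ∧
          (stdSys (l B) (β B) : Set (QuadraticForm ℂ (Fin n → ℂ))) =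
            (fun q : QuadraticForm ℂ (Fin n → ℂ) =>
              q.comp (T : (Fin n → ℂ) →ₗ[ℂ] (Fin n → ℂ))) '' (frameSys B) := by
  classical
  set A₀ := stdFrame l₀ β₀ with hA₀
  obtain ⟨hS0, hS1⟩ := symPart_stdFrame l₀ β₀
  have hSc : ∀ k i j, ContDiff ℂ 1 (fun B : Fin 2 → Fin n → Fin n → ℂ => symPart B k i j) := by
    intro k i j
    simp only [symPart, Matrix.of_apply]
    fun_prop
  have hSd : ∀ k i j, Differentiable ℂ (fun B : Fin 2 → Fin n → Fin n → ℂ => symPart B k i j) :=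
    fun k i j => (hSc k i j).differentiable one_ne_zero
  let F : (Fin 2 → Fin n → Fin n → ℂ) → ℂ → ℂ := fun B z => (symPart B 0 - z • symPart B 1).det
  have hF : ContDiff ℂ 1 (Function.uncurry F) := by
    refine contDiff_det (M := fun p : (Fin 2 → Fin n → Fin n → ℂ) × ℂ =>
      symPart p.1 0 - p.2 • symPart p.1 1) fun i j => ?_
    simp only [Matrix.sub_apply, Matrix.smul_apply, smul_eq_mul]
    exact ((hSc 0 i j).comp contDiff_fst).sub (contDiff_snd.mul ((hSc 1 i j).comp contDiff_fst))
  have hdiag : ∀ z, symPart A₀ 0 - z • symPart A₀ 1 =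
      Matrix.diagonal fun i => (l₀ i - z) * β₀ i := by
    intro z
    rw [hA₀, hS0, hS1, ← Matrix.diagonal_smul, Matrix.diagonal_sub]
    congr 1
    funext i
    simp; ring
  let m : Fin n → ℂ := fun k => ∏ j ∈ Finset.univ.erase k, (l₀ j - l₀ k) * β₀ j
  have hm : ∀ k, m k ≠ 0 := by
    intro k
    refine Finset.prod_ne_zero_iff.mpr fun j hj => mul_ne_zero ?_ (hβ j)
    exact sub_ne_zero.mpr (hl.ne (Finset.ne_of_mem_erase hj))
  have hFz : ∀ k, F A₀ = fun z => (l₀ k - z) * β₀ k *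
      ∏ j ∈ Finset.univ.erase k, (l₀ j - z) * β₀ j := by
    intro k
    funext z
    simp only [F]
    rw [hdiag, Matrix.det_diagonal, ← Finset.mul_prod_erase _ _ (Finset.mem_univ k)]
  have hroot : ∀ k, ∃ r : (Fin 2 → Fin n → Fin n → ℂ) → ℂ, r A₀ = l₀ k ∧
      (∀ᶠ B in 𝓝 A₀, DifferentiableAt ℂ r B) ∧ ∀ᶠ B in 𝓝 A₀, F B (r B) = 0 := by
    intro k
    refine exists_root_branch F hF A₀ (l₀ k) (-β₀ k * m k) ?_ ?_
      (mul_ne_zero (neg_ne_zero.mpr (hβ k)) (hm k))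
    · rw [hFz k]; simp
    · rw [hFz k]
      have h1 : HasDerivAt (fun z => (l₀ k - z) * β₀ k) (-β₀ k) (l₀ k) := by
        simpa using ((hasDerivAt_id (l₀ k)).const_sub (l₀ k)).mul_const (β₀ k)
      have h2 : DifferentiableAt ℂ
          (fun z => ∏ j ∈ Finset.univ.erase k, (l₀ j - z) * β₀ j) (l₀ k) := by fun_prop
      exact (h1.fun_mul h2.hasDerivAt).congr_deriv (by simp [m])
  choose r hr0 hrd hrF using hroot
  let T : (Fin 2 → Fin n → Fin n → ℂ) → Matrix (Fin n) (Fin n) ℂ := fun B =>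
    Matrix.of fun i k => (symPart B 0 - r k B • symPart B 1).adjugate i k / m k
  let G : (Fin 2 → Fin n → Fin n → ℂ) → Matrix (Fin n) (Fin n) ℂ := fun B =>
    (T B).transpose * symPart B 1 * T B
  let β : (Fin 2 → Fin n → Fin n → ℂ) → Fin n → ℂ := fun B k => G B k k
  let R : (Fin 2 → Fin n → Fin n → ℂ) → Matrix (Fin n) (Fin n) ℂ := fun B =>
    Matrix.of fun k i => (β B k)⁻¹ * ((T B).transpose * symPart B 1) k i
  have hT0 : T A₀ = 1 := by
    ext i k
    simp only [T, Matrix.of_apply, hr0, hdiag, Matrix.adjugate_diagonal]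
    rcases eq_or_ne i k with rfl | hik
    · rw [Matrix.diagonal_apply_eq, Matrix.one_apply_eq]
      exact div_self (hm i)
    · rw [Matrix.diagonal_apply_ne _ hik, Matrix.one_apply_ne hik, zero_div]
  have hβ0 : β A₀ = β₀ := by
    funext k
    simp only [β, G]
    rw [hT0, hA₀, hS1]
    simp
  have hR0 : R A₀ = 1 := by
    ext k i
    simp only [R, Matrix.of_apply, hβ0, hT0, Matrix.transpose_one, one_mul]
    rw [hA₀, hS1]
    rcases eq_or_ne k i with rfl | hik
    · rw [Matrix.diagonal_apply_eq, Matrix.one_apply_eq, inv_mul_cancel₀ (hβ k)]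
    · rw [Matrix.diagonal_apply_ne _ hik, Matrix.one_apply_ne hik, mul_zero]
  have hrd' : ∀ᶠ B in 𝓝 A₀, ∀ k, DifferentiableAt ℂ (r k) B := Filter.eventually_all.mpr hrd
  have hTd : ∀ B, (∀ k, DifferentiableAt ℂ (r k) B) →
      ∀ i j, DifferentiableAt ℂ (fun C => T C i j) B := by
    intro B hB i k
    simp only [T, Matrix.of_apply, div_eq_mul_inv]
    refine DifferentiableAt.mul_const (differentiableAt_adjugate (fun i j => ?_) i k) _
    simp only [Matrix.sub_apply, Matrix.smul_apply, smul_eq_mul]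
    exact (hSd 0 i j B).sub ((hB k).mul (hSd 1 i j B))
  have hTS : ∀ B, (∀ k, DifferentiableAt ℂ (r k) B) →
      ∀ i j, DifferentiableAt ℂ (fun C => ((T C).transpose * symPart C 1) i j) B := by
    intro B hB i j
    simp only [Matrix.mul_apply, Matrix.transpose_apply]
    exact DifferentiableAt.fun_sum fun p _ => (hTd B hB p i).mul (hSd 1 p j B)
  have hGd : ∀ B, (∀ k, DifferentiableAt ℂ (r k) B) →
      ∀ i j, DifferentiableAt ℂ (fun C => G C i j) B := by
    intro B hB i j
    simp only [G]
    simp_rw [Matrix.mul_apply (M := (T _).transpose * symPart _ 1)]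
    exact DifferentiableAt.fun_sum fun p _ => (hTS B hB i p).mul (hTd B hB p j)
  have hβd : ∀ B, (∀ k, DifferentiableAt ℂ (r k) B) → DifferentiableAt ℂ β B :=
    fun B hB => differentiableAt_pi.mpr fun k => hGd B hB k k
  have hld : ∀ B, (∀ k, DifferentiableAt ℂ (r k) B) →
      DifferentiableAt ℂ (fun C k => r k C) B :=
    fun B hB => differentiableAt_pi.mpr hB
  have hr0' : (fun k => r k A₀) = l₀ := funext hr0
  refine ⟨fun B k => r k B, β, R, hr0', hβ0, hR0, ?_⟩
  have hinj : ∀ᶠ B in 𝓝 A₀, Function.Injective (fun k => r k B) := by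
    have hc := (hld A₀ hrd'.self_of_nhds).continuousAt
    rw [ContinuousAt, hr0'] at hc
    exact hc.eventually (eventually_injective hl)
  have hβne : ∀ᶠ B in 𝓝 A₀, ∀ k, β B k ≠ 0 := by
    have hc := (hβd A₀ hrd'.self_of_nhds).continuousAt
    rw [ContinuousAt, hβ0] at hc
    exact hc.eventually (eventually_forall_ne_zero hβ)
  filter_upwards [hrd', hinj, hβne, Filter.eventually_all.mpr hrF] with B hB hBinj hBβ hBF
  refine ⟨hld B hB, hβd B hB, fun i j => ?_, ?_⟩
  · simp only [R, Matrix.of_apply]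
    exact ((differentiableAt_pi.mp (hβd B hB) i).inv (hBβ i)).mul (hTS B hB i j)
  -- the columns of `T` are eigenvectors
  have heig : symPart B 0 * T B = symPart B 1 * T B * Matrix.diagonal (fun k => r k B) := by
    ext i k
    have h1 : ((symPart B 0 - r k B • symPart B 1) *
        (symPart B 0 - r k B • symPart B 1).adjugate) i k = 0 := by
      rw [Matrix.mul_adjugate, show (symPart B 0 - r k B • symPart B 1).det = 0 from hBF k,
        zero_smul, Matrix.zero_apply]
    have h2 : (symPart B 0 * T B) i k - r k B * (symPart B 1 * T B) i k = 0 := by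
      have := congrArg (· / m k) h1
      simp only [zero_div] at this
      rw [← this]
      simp only [Matrix.mul_apply, T, Matrix.of_apply, Finset.mul_sum, Finset.sum_div,
        ← Finset.sum_sub_distrib, Matrix.sub_apply, Matrix.smul_apply, smul_eq_mul]
      exact Finset.sum_congr rfl fun j _ => by ring
    rw [Matrix.mul_diagonal]
    linear_combination h2
  have hG0 : (T B).transpose * symPart B 0 * T B = G B * Matrix.diagonal (fun k => r k B) := by
    simp only [G]
    rw [Matrix.mul_assoc, heig, Matrix.mul_assoc, Matrix.mul_assoc, Matrix.mul_assoc]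
  have hsymm : ∀ k, ((T B).transpose * symPart B k * T B).transpose =
      (T B).transpose * symPart B k * T B := by
    intro k
    rw [Matrix.transpose_mul, Matrix.transpose_mul, Matrix.transpose_transpose,
      symPart_transpose, Matrix.mul_assoc]
  have hGdiag : G B = Matrix.diagonal (β B) := by
    ext i j
    rcases eq_or_ne i j with rfl | hij
    · rw [Matrix.diagonal_apply_eq]
    rw [Matrix.diagonal_apply_ne _ hij]
    have h1 : G B i j = G B j i := congrFun (congrFun (hsymm 1) j) i
    have h2 := congrFun (congrFun (hsymm 0) i) j
    rw [hG0, Matrix.transpose_apply, Matrix.mul_diagonal, Matrix.mul_diagonal, ← h1] at h2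
    have h3 : G B i j * (r i B - r j B) = 0 := by linear_combination h2
    exact (mul_eq_zero.mp h3).resolve_right (sub_ne_zero.mpr (hBinj.ne hij))
  have hRT : R B * T B = 1 := by
    ext k j
    have : (R B * T B) k j = (β B k)⁻¹ * G B k j := by
      simp only [G]
      rw [Matrix.mul_apply, Matrix.mul_apply (M := (T B).transpose * symPart B 1), Finset.mul_sum]
      exact Finset.sum_congr rfl fun p _ => by simp only [R, Matrix.of_apply]; ring
    rw [this, hGdiag]
    rcases eq_or_ne k j with rfl | hik
    · rw [Matrix.diagonal_apply_eq, Matrix.one_apply_eq, inv_mul_cancel₀ (hBβ k)]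
    · rw [Matrix.diagonal_apply_ne _ hik, Matrix.one_apply_ne hik, mul_zero]
  have hTR : T B * R B = 1 := mul_eq_one_comm.mp hRT
  refine ⟨Matrix.toLin'OfInv hRT hTR, fun w => ?_, ?_⟩
  · simp [Matrix.toLin'OfInv]
  · have hG1 : (T B).transpose * symPart B 1 * T B = G B := rfl
    rw [frameSys_eq, image_comp_span_pair, ← symPart_toQuadraticForm', ← symPart_toQuadraticForm',
      comp_toQuadraticForm' _ (T B) _ (fun v => by simp [Matrix.toLin'OfInv]),
      comp_toQuadraticForm' _ (T B) _ (fun v => by simp [Matrix.toLin'OfInv]), hG0,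
      hG1, hGdiag, Matrix.diagonal_mul_diagonal, toQuadraticForm'_diagonal, toQuadraticForm'_diagonal,
      stdSys, diagPencil]
    have : (fun i => β B i * r i B) = fun i => r i B * β B i := funext fun i => mul_comm _ _
    rw [this]

/-- If a frame spans a pencil isomorphic to that of `stdFrame l₀ β₀`, then a linear change of
coordinates and of the basis of the pencil carries the symmetrized frame to `stdFrame l₀ β₀`. -/
theorem exists_move_frame {l₀ β₀ : Fin n → ℂ} (hn : 2 ≤ n) (hl : Function.Injective l₀)
    (hβ : ∀ i, β₀ i ≠ 0) (A : Fin 2 → Fin n → Fin n → ℂ) (T : (Fin n → ℂ) ≃ₗ[ℂ] (Fin n → ℂ))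
    (hT : (stdSys l₀ β₀ : Set (QuadraticForm ℂ (Fin n → ℂ))) =
      (fun q : QuadraticForm ℂ (Fin n → ℂ) => q.comp (T : (Fin n → ℂ) →ₗ[ℂ] (Fin n → ℂ))) ''
        (frameSys A)) :
    ∃ L : (Fin 2 → Fin n → Fin n → ℂ) → (Fin 2 → Fin n → Fin n → ℂ),
      Differentiable ℂ L ∧ L A = stdFrame l₀ β₀ ∧
      ∀ B, (frameSys (L B) : Set (QuadraticForm ℂ (Fin n → ℂ))) =
        (fun q : QuadraticForm ℂ (Fin n → ℂ) => q.comp (T : (Fin n → ℂ) →ₗ[ℂ] (Fin n → ℂ))) ''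
          (frameSys B) := by
  classical
  let t := LinearMap.toMatrix' (T : (Fin n → ℂ) →ₗ[ℂ] (Fin n → ℂ))
  have ht : ∀ v, (T : (Fin n → ℂ) →ₗ[ℂ] (Fin n → ℂ)) v = t.mulVec v := fun v =>
    (LinearMap.toMatrix'_mulVec _ v).symm
  let C : (Fin 2 → Fin n → Fin n → ℂ) → Fin 2 → Matrix (Fin n) (Fin n) ℂ := fun B k =>
    t.transpose * symPart B k * t
  have hC : ∀ B, (Submodule.span ℂ (Set.range fun k => (C B k).toQuadraticForm') :
      Set (QuadraticForm ℂ (Fin n → ℂ))) =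
        (fun q : QuadraticForm ℂ (Fin n → ℂ) => q.comp (T : (Fin n → ℂ) →ₗ[ℂ] (Fin n → ℂ))) ''
          (frameSys B) := by
    intro B
    rw [span_range_two, frameSys_eq, image_comp_span_pair, ← symPart_toQuadraticForm',
      ← symPart_toQuadraticForm', comp_toQuadraticForm' _ t _ ht, comp_toQuadraticForm' _ t _ ht]
  have hCsymm : ∀ k, (C A k).transpose = C A k := by
    intro k
    simp only [C]
    rw [Matrix.transpose_mul, Matrix.transpose_mul, Matrix.transpose_transpose,
      symPart_transpose, Matrix.mul_assoc]
  have hstd : ∀ k, (Matrix.of (stdFrame l₀ β₀ k)).toQuadraticForm' ∈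
      Submodule.span ℂ (Set.range fun k => (C A k).toQuadraticForm') := by
    intro k
    rw [← SetLike.mem_coe, hC, ← hT, ← frameSys_stdFrame]
    exact Submodule.subset_span ⟨k, rfl⟩
  choose M hM using fun k => (Submodule.mem_span_range_iff_exists_fun ℂ).mp (hstd k)
  have hadd : ∀ (R : Fin 2 → ℂ) (D : Fin 2 → Matrix (Fin n) (Fin n) ℂ),
      (∑ m, R m • D m).toQuadraticForm' = ∑ m, R m • (D m).toQuadraticForm' := by
    intro R D
    ext v
    simp [toQuadraticForm'_apply, Matrix.add_mulVec, Matrix.smul_mulVec]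
  have hli : LinearIndependent ℂ fun k => (Matrix.of (stdFrame l₀ β₀ k)).toQuadraticForm' := by
    rw [linearIndependent_iff_card_eq_finrank_span, Set.finrank]
    change _ = Module.finrank ℂ (frameSys (stdFrame l₀ β₀))
    rw [frameSys_stdFrame, stdSys,
      (isNonsingularPencil_diagPencil hn (Pi.basisFun ℂ (Fin n)) hl hβ).finrank_eq]
    rfl
  have hdet : (Matrix.of M).det ≠ 0 :=
    det_ne_zero_of_linearIndependent (Matrix.of M) _ _ hli fun k => (hM k).symm
  refine ⟨fun B k => (∑ m, M k m • C B m : Matrix (Fin n) (Fin n) ℂ), ?_, ?_, fun B => ?_⟩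
  · have hS : ∀ k i j, Differentiable ℂ
        (fun B : Fin 2 → Fin n → Fin n → ℂ => symPart B k i j) := by
      intro k i j
      simp only [symPart, Matrix.of_apply]
      fun_prop
    refine differentiable_pi.mpr fun k => differentiable_pi.mpr fun i =>
      differentiable_pi.mpr fun j => ?_
    simp only [Matrix.sum_apply, Matrix.smul_apply, C, Matrix.mul_apply, smul_eq_mul]
    fun_prop
  · funext k
    have hsymm : (∑ m, M k m • C A m).transpose = ∑ m, M k m • C A m := by
      simp [hCsymm]
    have hsymm' : (Matrix.of (stdFrame l₀ β₀ k)).transpose = Matrix.of (stdFrame l₀ β₀ k) := by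
      fin_cases k <;> exact Matrix.diagonal_transpose _
    have h := hM k
    rw [← hadd] at h
    refine symm_ext_toQuadraticForm' hsymm hsymm' h
  · rw [← hC]
    have h : frameSys (fun k => (∑ m, M k m • C B m : Matrix (Fin n) (Fin n) ℂ)) =
        Submodule.span ℂ (Set.range fun k => ∑ m, M k m • (C B m).toQuadraticForm') := by
      simp only [← hadd]
      rfl
    rw [h]
    exact congrArg _ (span_range_comb (Matrix.of M) hdet _)

end NormalForm

/-! ### Germs of holomorphic functions on the moduli spaces -/

section Germs
variable {n : ℕ}

/-- The cross ratio of four of the points `lᵢ`. -/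
def crossRatio (l : Fin n → ℂ) (i j k r : Fin n) : ℂ :=
  (l i - l j) * (l k - l r) / ((l i - l r) * (l k - l j))

theorem crossRatio_eq_of_crossEq {l l' : Fin n → ℂ} (hl : Function.Injective l)
    (hl' : Function.Injective l') (h : CrossEq l l') {i j k r : Fin n} (hir : i ≠ r) (hkj : k ≠ j) :
    crossRatio l i j k r = crossRatio l' i j k r := by
  unfold crossRatio
  rw [div_eq_div_iff
    (mul_ne_zero (sub_ne_zero.mpr (hl.ne hir)) (sub_ne_zero.mpr (hl.ne hkj)))
    (mul_ne_zero (sub_ne_zero.mpr (hl'.ne hir)) (sub_ne_zero.mpr (hl'.ne hkj)))]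
  exact h i j k r

theorem differentiableAt_crossRatio {l : Fin n → ℂ} (hl : Function.Injective l)
    {i j k r : Fin n} (hir : i ≠ r) (hkj : k ≠ j) :
    DifferentiableAt ℂ (fun l => crossRatio l i j k r) l := by
  simp only [crossRatio, div_eq_mul_inv]
  refine DifferentiableAt.fun_mul (by fun_prop) (DifferentiableAt.fun_inv (by fun_prop) ?_)
  exact (mul_ne_zero (sub_ne_zero.mpr (hl.ne hir)) (sub_ne_zero.mpr (hl.ne hkj)))

theorem exists_asym_nhds {l₀ : Fin n → ℂ} (hl : Function.Injective l₀) (ha : Asym l₀) :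
    ∃ U ∈ 𝓝 l₀, ∀ l ∈ U, Function.Injective l ∧ ∀ l' ∈ U, ∀ σ : Equiv.Perm (Fin n),
      CrossEq l (l' ∘ σ) → σ = 1 := by
  obtain ⟨U, hU, V, hV, hUV⟩ := mem_nhds_prod_iff.mp (eventually_asym ha)
  refine ⟨U ∩ V ∩ {l | Function.Injective l},
    Filter.inter_mem (Filter.inter_mem hU hV) (eventually_injective hl), fun l hl => ⟨hl.2, ?_⟩⟩
  intro l' hl' σ hσ
  exact hUV (Set.mk_mem_prod hl.1.1 hl'.1.2) σ hσ

/-- Near a pencil without automorphisms, an isomorphism of diagonal pencils is diagonal. -/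
theorem diagonal_of_stdSys {l β l' β' : Fin n → ℂ} (hl : Function.Injective l)
    (hβ : ∀ i, β i ≠ 0) (ha : ∀ σ : Equiv.Perm (Fin n), CrossEq l' (l ∘ σ) → σ = 1)
    (T : (Fin n → ℂ) ≃ₗ[ℂ] (Fin n → ℂ))
    (hT : (stdSys l' β' : Set (QuadraticForm ℂ (Fin n → ℂ))) =
      (fun q : QuadraticForm ℂ (Fin n → ℂ) => q.comp (T : (Fin n → ℂ) →ₗ[ℂ] (Fin n → ℂ))) ''
        (stdSys l β)) :
    ∃ (a b c d : ℂ) (t : Fin n → ℂ),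
      (∀ j, c * l' j + d ≠ 0) ∧ (∀ j, l j * (c * l' j + d) = a * l' j + b) ∧
      (∀ x j, T x j = t j * x j) ∧ ∀ j, β j * t j ^ 2 = (c * l' j + d) * β' j := by
  obtain ⟨σ, a, b, c, d, t, h0, h1, h2, h3⟩ := monomial_of_stdSys hl hβ T hT
  have hcross : CrossEq (l ∘ σ) l' := crossEq_of_moebius h0 h1
  have hσ : σ = 1 := ha σ fun i j k r => (hcross i j k r).symm
  subst hσ
  refine ⟨a, b, c, d, t, h0, h1, fun x j => ?_, h3⟩
  have hx : x = ∑ i, x i • (Pi.single i 1 : Fin n → ℂ) := by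
    funext k
    simp [Finset.sum_apply, Pi.single_apply]
  rw [hx, map_sum]
  simp only [map_smul, h2, Finset.sum_apply, Pi.smul_apply, smul_eq_mul, Equiv.Perm.coe_one, id]
  simp [Pi.single_apply, mul_comm]

theorem stdSys_mem_moduliPQ (hn : 2 ≤ n) {l β : Fin n → ℂ} (hl : Function.Injective l)
    (hβ : ∀ i, β i ≠ 0) : pencilClass n (stdSys l β) ∈ moduliPQ n :=
  ⟨_, isNonsingularPencil_diagPencil hn _ hl hβ, rfl⟩

/-- Cross ratios are holomorphic on the moduli space of pencils near a pencil
without automorphisms. -/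
theorem exists_crossRatio_germ (hn : 2 ≤ n) {l₀ β₀ : Fin n → ℂ} (hl : Function.Injective l₀)
    (ha : Asym l₀) (hβ : ∀ i, β₀ i ≠ 0) {i j k r : Fin n} (hir : i ≠ r) (hkj : k ≠ j) :
    ∃ h ∈ holGerms n (pencilClass n (stdSys l₀ β₀)), ∀ᶠ p in 𝓝 (l₀, β₀),
      h (pencilClass n (stdSys p.1 p.2)) = crossRatio p.1 i j k r := by
  obtain ⟨l, β, R, hl0, hβ0, -, hnf⟩ := exists_normalForm hl hβ
  obtain ⟨U, hU, hUa⟩ := exists_asym_nhds hl ha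
  have h := exists_germ
    (cls := fun B : Fin 2 → Fin n → Fin n → ℂ => pencilClass n (frameSys B))
    (nf := fun p : (Fin n → ℂ) × (Fin n → ℂ) => pencilClass n (stdSys p.1 p.2))
    (A₀ := stdFrame l₀ β₀) (ν := fun B => (l B, β B)) (φ := fun p => crossRatio p.1 i j k r)
    (U := {p | p.1 ∈ U ∧ ∀ i, p.2 i ≠ 0})
    (by
      rw [hl0, hβ0]
      exact (continuousAt_fst.eventually (Filter.eventually_mem_set.mpr hU)).and
        (continuousAt_snd.eventually (eventually_forall_ne_zero hβ)))
    (hnf.mono fun B hB => hB.1.prodMk hB.2.1)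
    (hnf.mono fun B hB => by
      obtain ⟨T, -, hT⟩ := hB.2.2.2
      exact pencilClass_congr T hT)
    (by
      rw [hl0, hβ0]
      filter_upwards [continuousAt_fst.eventually (eventually_injective hl)] with p hp
      exact (differentiableAt_crossRatio hp hir hkj).comp p differentiableAt_fst)
    (by
      intro y hy y' hy' hyy
      have hmem : stdSys y'.1 y'.2 ∈ pencilClass n (stdSys y.1 y.2) := by
        rw [hyy]
        exact mem_pencilClass_self _
      obtain ⟨T, hT⟩ := hmem
      obtain ⟨a, b, c, d, t, h0, h1, -, -⟩ := diagonal_of_stdSys (hUa _ hy.1).1 hy.2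
        ((hUa _ hy'.1).2 _ hy.1) T hT
      exact crossRatio_eq_of_crossEq (hUa _ hy.1).1 (hUa _ hy'.1).1 (crossEq_of_moebius h0 h1)
        hir hkj)
    (by
      intro A hA
      have hmem : stdSys l₀ β₀ ∈ pencilClass n (frameSys A) := by
        rw [hA, frameSys_stdFrame]
        exact mem_pencilClass_self _
      obtain ⟨T, hT⟩ := hmem
      obtain ⟨L, hL, hLA, hLB⟩ := exists_move_frame hn hl hβ A T hT
      exact ⟨L, hL, hLA, fun B => (pencilClass_congr T (hLB B)).symm⟩)
  simp only [frameSys_stdFrame, hl0, hβ0] at h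
  obtain ⟨h, h1, h2⟩ := h
  exact ⟨h, ⟨stdSys_mem_moduliPQ hn hl hβ, h1⟩, h2⟩

/-- Germs on the moduli space of pencils pull back to the refined moduli space. -/
theorem comp_image_fst_mem_refinedHolGerms {Φ : QuadSys n} {P : Submodule ℂ (Fin n → ℂ)}
    (hm : pairClass n Φ P ∈ refinedModuliPQ n) {h : Set (QuadSys n) → ℂ}
    (hh : h ∈ holGerms n (pencilClass n Φ)) :
    (fun m => h (Prod.fst '' m)) ∈ refinedHolGerms n (pairClass n Φ P) := by
  refine ⟨hm, fun A hA => ?_⟩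
  have hA1 : pencilClass n (frameSys A.1) = pencilClass n Φ := by
    rw [pencilClass_eq_image _ (Submodule.span ℂ (Set.range A.2)), hA, ← pencilClass_eq_image]
  have := hh.2 A.1 hA1
  filter_upwards [continuousAt_fst.eventually this] with B hB
  simp only [← pencilClass_eq_image]
  exact DifferentiableAt.comp (g := fun C => h (pencilClass n (frameSys C))) B hB
    differentiableAt_fst

/-- A Plücker coordinate of the span of three vectors. -/
def plucker (w : Fin 3 → Fin n → ℂ) (s : Fin 3 → Fin n) : ℂ :=
  Matrix.det (Matrix.of fun a b => w a (s b))

/-- The discriminant of three of the points `lᵢ`, up to sign and square root. -/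
def vand (l : Fin n → ℂ) (s : Fin 3 → Fin n) : ℂ :=
  (l (s 0) - l (s 1)) * (l (s 1) - l (s 2)) * (l (s 0) - l (s 2))

/-- A function of a diagonal pencil with a three-dimensional subspace, in terms of a frame of the
subspace. Diagonal isomorphisms and changes of frames multiply all of these functions by
the same constant, so that their ratios are functions on the refined moduli space. -/
def pairInvariant (s : Fin 3 → Fin n)
    (y : (Fin n → ℂ) × (Fin n → ℂ) × (Fin 3 → Fin n → ℂ)) : ℂ :=
  (plucker y.2.2 s ^ 2 * (y.2.1 (s 0) * y.2.1 (s 1) * y.2.1 (s 2))) ^ 2 * vand y.1 s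

theorem differentiable_pairInvariant (s : Fin 3 → Fin n) :
    Differentiable ℂ (pairInvariant s) := by
  unfold pairInvariant plucker vand
  simp only [Matrix.det_fin_three, Matrix.of_apply]
  fun_prop

theorem pairInvariant_transform {l β l' β' : Fin n → ℂ} {w w' : Fin 3 → Fin n → ℂ}
    {a b c d : ℂ} {t : Fin n → ℂ}
    (h1 : ∀ j, l j * (c * l' j + d) = a * l' j + b)
    (h2 : ∀ j, β j * t j ^ 2 = (c * l' j + d) * β' j)
    (R : Matrix (Fin 3) (Fin 3) ℂ) (hR : ∀ m j, t j * w' m j = ∑ p, R m p * w p j)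
    (s : Fin 3 → Fin n) :
    (a * d - b * c) ^ 3 * pairInvariant s (l', β', w') =
      R.det ^ 4 * pairInvariant s (l, β, w) := by
  have hpl : t (s 0) * t (s 1) * t (s 2) * plucker w' s = R.det * plucker w s := by
    have := congrArg Matrix.det (show (Matrix.of fun m q => t (s q) * w' m (s q)) =
        R * Matrix.of (fun m q => w m (s q)) from by
      ext m q
      simp [Matrix.mul_apply, hR])
    rw [Matrix.det_mul] at this
    rw [plucker, plucker, ← this, ← Fin.prod_univ_three (fun q => t (s q)), ← Matrix.det_mul_row]
    rfl
  set D : Fin n → ℂ := fun j => c * l' j + d with hD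
  have hsub : ∀ i j, (l i - l j) * (D i * D j) = (a * d - b * c) * (l' i - l' j) :=
    moebius_sub h1
  have hv : vand l s * (D (s 0) * D (s 1) * D (s 2)) ^ 2 = (a * d - b * c) ^ 3 * vand l' s := by
    unfold vand
    linear_combination ((l (s 1) - l (s 2)) * (D (s 1) * D (s 2))) *
        ((l (s 0) - l (s 2)) * (D (s 0) * D (s 2))) * hsub (s 0) (s 1) +
      ((a * d - b * c) * (l' (s 0) - l' (s 1))) * ((l (s 0) - l (s 2)) * (D (s 0) * D (s 2))) *
        hsub (s 1) (s 2) +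
      ((a * d - b * c) * (l' (s 0) - l' (s 1))) * ((a * d - b * c) * (l' (s 1) - l' (s 2))) *
        hsub (s 0) (s 2)
  have hb : β (s 0) * β (s 1) * β (s 2) * (t (s 0) * t (s 1) * t (s 2)) ^ 2 =
      D (s 0) * D (s 1) * D (s 2) * (β' (s 0) * β' (s 1) * β' (s 2)) := by
    calc _ = (β (s 0) * t (s 0) ^ 2) * (β (s 1) * t (s 1) ^ 2) * (β (s 2) * t (s 2) ^ 2) := by ring
      _ = _ := by rw [h2, h2, h2]; ring
  simp only [pairInvariant]
  calc _ = (plucker w' s) ^ 4 * (β' (s 0) * β' (s 1) * β' (s 2)) ^ 2 *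
        ((a * d - b * c) ^ 3 * vand l' s) := by ring
    _ = (plucker w' s) ^ 4 * (D (s 0) * D (s 1) * D (s 2) *
        (β' (s 0) * β' (s 1) * β' (s 2))) ^ 2 * vand l s := by rw [← hv]; ring
    _ = (t (s 0) * t (s 1) * t (s 2) * plucker w' s) ^ 4 *
        (β (s 0) * β (s 1) * β (s 2)) ^ 2 * vand l s := by rw [← hb]; ring
    _ = _ := by rw [hpl]; ring

theorem comap_span_range {m : ℕ} (T : (Fin n → ℂ) ≃ₗ[ℂ] (Fin n → ℂ)) (w : Fin m → Fin n → ℂ) :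
    (Submodule.span ℂ (Set.range w)).comap (T : (Fin n → ℂ) →ₗ[ℂ] (Fin n → ℂ)) =
      Submodule.span ℂ (Set.range fun p => T.symm (w p)) := by
  rw [Submodule.comap_equiv_eq_map_symm, Submodule.map_span, ← Set.range_comp]
  rfl

/-- Ratios of the functions `pairInvariant` only depend on the isomorphism class of the pair. -/
theorem pairInvariant_ratio_eq (hn : 2 ≤ n) {l β l' β' : Fin n → ℂ} {w w' : Fin 3 → Fin n → ℂ}
    (hl : Function.Injective l) (hβ : ∀ i, β i ≠ 0)
    (ha : ∀ σ : Equiv.Perm (Fin n), CrossEq l' (l ∘ σ) → σ = 1)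
    (hclass : pairClass n (stdSys l β) (Submodule.span ℂ (Set.range w)) =
      pairClass n (stdSys l' β') (Submodule.span ℂ (Set.range w'))) (s s' : Fin 3 → Fin n)
    (hs : pairInvariant s' (l, β, w) ≠ 0) (hs' : pairInvariant s' (l', β', w') ≠ 0) :
    pairInvariant s (l, β, w) / pairInvariant s' (l, β, w) =
      pairInvariant s (l', β', w') / pairInvariant s' (l', β', w') := by
  have hmem : (stdSys l' β', Submodule.span ℂ (Set.range w')) ∈
      pairClass n (stdSys l β) (Submodule.span ℂ (Set.range w)) := by
    rw [hclass]
    exact mem_pairClass_self _ _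
  obtain ⟨T, hT, hP⟩ := hmem
  obtain ⟨a, b, c, d, t, h0, h1, h2, h3⟩ := diagonal_of_stdSys hl hβ ha T hT
  have hspan : ∀ m, T (w' m) ∈ Submodule.span ℂ (Set.range w) := by
    intro m
    have h : w' m ∈ Submodule.span ℂ (Set.range w') := Submodule.subset_span ⟨m, rfl⟩
    rw [show Submodule.span ℂ (Set.range w') = _ from hP] at h
    exact h
  choose Q hQ using fun m => (Submodule.mem_span_range_iff_exists_fun ℂ).mp (hspan m)
  have hkey := pairInvariant_transform (w := w) (w' := w') h1 h3 (Matrix.of Q)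
    (fun m j => by
      have := congrFun (hQ m) j
      rw [← h2, ← this]
      simp)
  have hdet : a * d - b * c ≠ 0 := by
    intro hz
    have hlt : (⟨0, by omega⟩ : Fin n) ≠ ⟨1, by omega⟩ := by simp
    have := moebius_sub h1 ⟨0, by omega⟩ ⟨1, by omega⟩
    rw [hz, zero_mul] at this
    exact mul_ne_zero (sub_ne_zero.mpr (hl.ne hlt)) (mul_ne_zero (h0 _) (h0 _)) this
  have hQ0 : (Matrix.of Q).det ^ 4 ≠ 0 := by
    intro hz
    have := hkey s'
    rw [hz, zero_mul] at this
    exact mul_ne_zero (pow_ne_zero 3 hdet) hs' this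
  rw [div_eq_div_iff hs hs']
  refine mul_left_cancel₀ (mul_ne_zero (pow_ne_zero 3 hdet) hQ0) ?_
  calc _ = ((Matrix.of Q).det ^ 4 * pairInvariant s (l, β, w)) *
        ((a * d - b * c) ^ 3 * pairInvariant s' (l', β', w')) := by ring
    _ = ((a * d - b * c) ^ 3 * pairInvariant s (l', β', w')) *
        ((Matrix.of Q).det ^ 4 * pairInvariant s' (l, β, w)) := by rw [hkey s, hkey s']
    _ = _ := by ring

theorem exists_move_pair (hn : 2 ≤ n) {l₀ β₀ : Fin n → ℂ} (hl : Function.Injective l₀)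
    (hβ : ∀ i, β₀ i ≠ 0) {w₀ : Fin 3 → Fin n → ℂ} (hw : LinearIndependent ℂ w₀)
    (A : (Fin 2 → Fin n → Fin n → ℂ) × (Fin 3 → Fin n → ℂ))
    (hA : pairClass n (frameSys A.1) (Submodule.span ℂ (Set.range A.2)) =
      pairClass n (stdSys l₀ β₀) (Submodule.span ℂ (Set.range w₀))) :
    ∃ L : (Fin 2 → Fin n → Fin n → ℂ) × (Fin 3 → Fin n → ℂ) →
        (Fin 2 → Fin n → Fin n → ℂ) × (Fin 3 → Fin n → ℂ),
      Differentiable ℂ L ∧ L A = (stdFrame l₀ β₀, w₀) ∧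
      ∀ B, pairClass n (frameSys (L B).1) (Submodule.span ℂ (Set.range (L B).2)) =
        pairClass n (frameSys B.1) (Submodule.span ℂ (Set.range B.2)) := by
  have hmem : (stdSys l₀ β₀, Submodule.span ℂ (Set.range w₀)) ∈
      pairClass n (frameSys A.1) (Submodule.span ℂ (Set.range A.2)) := by
    rw [hA]
    exact mem_pairClass_self _ _
  obtain ⟨T, hT, hP⟩ := hmem
  obtain ⟨L, hL, hLA, hLB⟩ := exists_move_frame hn hl hβ A.1 T hT
  have hmemw : ∀ m, w₀ m ∈ Submodule.span ℂ (Set.range fun m => T.symm (A.2 m)) := by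
    intro m
    have h : w₀ m ∈ Submodule.span ℂ (Set.range w₀) := Submodule.subset_span ⟨m, rfl⟩
    rw [show Submodule.span ℂ (Set.range w₀) = _ from hP, comap_span_range] at h
    exact h
  choose Q hQ using fun m => (Submodule.mem_span_range_iff_exists_fun ℂ).mp (hmemw m)
  have hdet : (Matrix.of Q).det ≠ 0 :=
    det_ne_zero_of_linearIndependent (Matrix.of Q) _ _ hw fun m => (hQ m).symm
  have hTs : Differentiable ℂ fun x => T.symm x :=
    (LinearMap.toContinuousLinearMap
      (T.symm : (Fin n → ℂ) →ₗ[ℂ] (Fin n → ℂ))).differentiable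
  refine ⟨fun B => (L B.1, fun m => ∑ p, Q m p • T.symm (B.2 p)), ?_, ?_, fun B => ?_⟩
  · refine (hL.comp differentiable_fst).prodMk (differentiable_pi.mpr fun m => ?_)
    refine Differentiable.fun_sum fun p _ => Differentiable.fun_const_smul ?_ _
    exact hTs.comp (by fun_prop)
  · exact Prod.ext hLA (funext hQ)
  · refine (pairClass_congr T (hLB B.1) ?_).symm
    rw [comap_span_range]
    exact span_range_comb (Matrix.of Q) hdet fun p => T.symm (B.2 p)

/-- Ratios of the functions `pairInvariant` are holomorphic on the refined moduli space near a pair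
whose pencil has no automorphisms. -/
theorem exists_pairInvariant_germ (hn : 2 ≤ n) {l₀ β₀ : Fin n → ℂ} (hl : Function.Injective l₀)
    (ha : Asym l₀) (hβ : ∀ i, β₀ i ≠ 0) {w₀ : Fin 3 → Fin n → ℂ} (hw : LinearIndependent ℂ w₀)
    (s s' : Fin 3 → Fin n) (hs : pairInvariant s' (l₀, β₀, w₀) ≠ 0) :
    ∃ h ∈ refinedHolGerms n (pairClass n (stdSys l₀ β₀) (Submodule.span ℂ (Set.range w₀))),
      ∀ᶠ y in 𝓝 (l₀, β₀, w₀),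
        h (pairClass n (stdSys y.1 y.2.1) (Submodule.span ℂ (Set.range y.2.2))) =
          pairInvariant s y / pairInvariant s' y := by
  obtain ⟨l, β, R, hl0, hβ0, hR0, hnf⟩ := exists_normalForm hl hβ
  obtain ⟨U, hU, hUa⟩ := exists_asym_nhds hl ha
  have hν0 : (fun m : Fin 3 => (R (stdFrame l₀ β₀)).mulVec (w₀ m)) = w₀ := by
    funext m
    rw [hR0, Matrix.one_mulVec]
  have hne : ∀ᶠ y in 𝓝 (l₀, β₀, w₀), pairInvariant s' y ≠ 0 :=
    (differentiable_pairInvariant s').continuous.continuousAt.eventually_ne hs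
  have hU' : {y : (Fin n → ℂ) × (Fin n → ℂ) × (Fin 3 → Fin n → ℂ) |
      (y.1 ∈ U ∧ ∀ i, y.2.1 i ≠ 0) ∧ pairInvariant s' y ≠ 0} ∈ 𝓝 (l₀, β₀, w₀) :=
    ((continuousAt_fst.eventually (Filter.eventually_mem_set.mpr hU)).and
      ((continuousAt_fst.comp continuousAt_snd).eventually (eventually_forall_ne_zero hβ))).and hne
  have hnf' : ∀ᶠ B in 𝓝 ((stdFrame l₀ β₀, w₀) :
      (Fin 2 → Fin n → Fin n → ℂ) × (Fin 3 → Fin n → ℂ)), _ := continuousAt_fst.eventually hnf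
  have hdiff : ∀ᶠ B in 𝓝 ((stdFrame l₀ β₀, w₀) :
      (Fin 2 → Fin n → Fin n → ℂ) × (Fin 3 → Fin n → ℂ)), DifferentiableAt ℂ
        (fun B : (Fin 2 → Fin n → Fin n → ℂ) × (Fin 3 → Fin n → ℂ) =>
          (l B.1, β B.1, fun m => (R B.1).mulVec (B.2 m))) B := by
    filter_upwards [hnf'] with B hB
    refine (hB.1.comp B differentiableAt_fst).prodMk
      ((hB.2.1.comp B differentiableAt_fst).prodMk ?_)
    refine differentiableAt_pi.mpr fun m => differentiableAt_pi.mpr fun i => ?_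
    simp only [Matrix.mulVec, dotProduct]
    refine DifferentiableAt.fun_sum fun j _ => DifferentiableAt.mul ?_ (by fun_prop)
    exact DifferentiableAt.comp (g := fun C => R C i j) B (hB.2.2.1 i j) differentiableAt_fst
  have hφ : ∀ᶠ y in 𝓝 (l₀, β₀, w₀), DifferentiableAt ℂ
      (fun y => pairInvariant s y / pairInvariant s' y) y := by
    filter_upwards [hne] with y hy
    simp only [div_eq_mul_inv]
    exact (differentiable_pairInvariant s y).fun_mul ((differentiable_pairInvariant s' y).fun_inv hy)
  have h := exists_germ
    (cls := fun B : (Fin 2 → Fin n → Fin n → ℂ) × (Fin 3 → Fin n → ℂ) =>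
      pairClass n (frameSys B.1) (Submodule.span ℂ (Set.range B.2)))
    (nf := fun y : (Fin n → ℂ) × (Fin n → ℂ) × (Fin 3 → Fin n → ℂ) =>
      pairClass n (stdSys y.1 y.2.1) (Submodule.span ℂ (Set.range y.2.2)))
    (A₀ := (stdFrame l₀ β₀, w₀))
    (ν := fun B => (l B.1, β B.1, fun m => (R B.1).mulVec (B.2 m)))
    (φ := fun y => pairInvariant s y / pairInvariant s' y)
    (U := {y | (y.1 ∈ U ∧ ∀ i, y.2.1 i ≠ 0) ∧ pairInvariant s' y ≠ 0})
    (by simpa only [hl0, hβ0, hν0] using hU') hdiff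
    (by
      filter_upwards [hnf'] with B hB
      obtain ⟨T, hTR, hT⟩ := hB.2.2.2
      refine pairClass_congr T hT ?_
      simp only [comap_span_range, hTR])
    (by simpa only [hl0, hβ0, hν0] using hφ)
    (by
      rintro ⟨l, β, w⟩ hy ⟨l', β', w'⟩ hy' hyy
      exact pairInvariant_ratio_eq hn (hUa _ hy.1.1).1 hy.1.2 ((hUa _ hy'.1.1).2 _ hy.1.1) hyy s s'
        hy.2 hy'.2)
    (by
      intro A hA
      simp only [frameSys_stdFrame] at hA
      exact exists_move_pair hn hl hβ hw A hA)
  simp only [frameSys_stdFrame, hl0, hβ0, hν0] at h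
  obtain ⟨h, h1, h2⟩ := h
  refine ⟨h, ⟨⟨_, _, isNonsingularPencil_diagPencil hn _ hl hβ, ?_, rfl⟩, h1⟩, h2⟩
  rw [finrank_span_eq_card hw, Fintype.card_fin]

end Germs

/-! ### The second fundamental form in standard coordinates -/

section Lagrange
variable {N : ℕ}

theorem coeff_eq_sum_nodalWeight {τ : Fin (N + 1) → ℂ} (hτ : Function.Injective τ)
    (P : Polynomial ℂ) (hP : P.degree < (N + 1 : ℕ)) :
    P.coeff N = ∑ i, Lagrange.nodalWeight Finset.univ τ i * P.eval (τ i) := by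
  have h := Lagrange.coeff_eq_sum (s := Finset.univ) (hτ.injOn) (P := P) (hP.trans_le (by simp))
  rw [Finset.card_univ, Fintype.card_fin, Nat.add_sub_cancel] at h
  rw [h]
  refine Finset.sum_congr rfl fun i _ => ?_
  rw [Lagrange.nodalWeight, Finset.prod_inv_distrib, div_eq_mul_inv, mul_comm]

theorem sum_nodalWeight_eval {τ : Fin (N + 1) → ℂ} (hτ : Function.Injective τ) (P : Polynomial ℂ)
    (hP : P.degree < N) : ∑ i, Lagrange.nodalWeight Finset.univ τ i * P.eval (τ i) = 0 := by
  rw [← coeff_eq_sum_nodalWeight hτ P (hP.trans_le (mod_cast Nat.le_succ N)),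
    Polynomial.coeff_eq_zero_of_degree_lt hP]

theorem sum_nodalWeight_div {τ : Fin (N + 1) → ℂ} (hτ : Function.Injective τ) (P : Polynomial ℂ)
    (hP : P.degree < N) {x : ℂ} (hx : ∀ i, τ i ≠ x) :
    ∑ i, Lagrange.nodalWeight Finset.univ τ i * P.eval (τ i) / (τ i - x) =
      -P.eval x / ∏ i, (x - τ i) := by
  have h := Lagrange.eq_interpolate (s := Finset.univ) (hτ.injOn) (f := P)
    (hP.trans_le (by simpa using mod_cast Nat.le_succ N))
  have h2 := Lagrange.eval_interpolate_not_at_node (s := Finset.univ) (v := τ) (x := x)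
    (fun i => P.eval (τ i)) (fun i _ => (hx i).symm)
  rw [← h, Lagrange.eval_nodal] at h2
  have hne : ∏ i, (x - τ i) ≠ 0 :=
    Finset.prod_ne_zero_iff.mpr fun i _ => sub_ne_zero.mpr (hx i).symm
  rw [h2, neg_div, mul_div_cancel_left₀ _ hne, ← Finset.sum_neg_distrib]
  refine Finset.sum_congr rfl fun i _ => ?_
  have h1 := sub_ne_zero.mpr (hx i)
  have h1' := sub_ne_zero.mpr (hx i).symm
  field_simp
  ring

end Lagrange

section Roots
variable {n : ℕ}

/-- The squares of the coordinates of the points of the cone over `X` are the values at the `τᵢ` of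
polynomials of degree `n`, divided by `∏_{j ≠ i} (τᵢ - τⱼ)`. The datum says that the polynomial
of `v` has the simple roots `l`, all different from the `τᵢ`. -/
structure RootDatum (b : Module.Basis (Fin (n + 3)) ℂ (Fin (n + 3) → ℂ)) (τ : Fin (n + 3) → ℂ)
    (v : Fin (n + 3) → ℂ) (l : Fin n → ℂ) : Prop where
  injective : Function.Injective l
  ne : ∀ i k, τ i ≠ l k
  sq_eq : ∃ s : ℂ, s ≠ 0 ∧ ∀ i, b.repr v i ^ 2 =
    s * (Lagrange.nodalWeight Finset.univ τ i * ∏ k, (τ i - l k))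

/-- The squared length of the `k`-th eigenvector of the second fundamental form, up to scaling. -/
def sqLength (τ : Fin (n + 3) → ℂ) (l : Fin n → ℂ) (k : Fin n) : ℂ :=
  -(∏ j ∈ Finset.univ.erase k, (l k - l j)) / ∏ i, (l k - τ i)

theorem sqLength_ne_zero {τ : Fin (n + 3) → ℂ} {l : Fin n → ℂ} (hl : Function.Injective l)
    (hne : ∀ i k, τ i ≠ l k) (k : Fin n) : sqLength τ l k ≠ 0 := by
  refine div_ne_zero (neg_ne_zero.mpr (Finset.prod_ne_zero_iff.mpr fun j hj => ?_))
    (Finset.prod_ne_zero_iff.mpr fun i _ => sub_ne_zero.mpr (hne i k).symm)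
  exact sub_ne_zero.mpr (hl.ne (Finset.ne_of_mem_erase hj).symm)

end Roots

/-- The coordinates with respect to a basis, as continuous linear forms. -/
def coordL {N : ℕ} (b : Module.Basis (Fin N) ℂ (Fin N → ℂ)) (i : Fin N) :
    (Fin N → ℂ) →L[ℂ] ℂ := LinearMap.toContinuousLinearMap (b.coord i)

/-- The vector with given coordinates, as a continuous linear map. -/
def ofCoordL {N : ℕ} (b : Module.Basis (Fin N) ℂ (Fin N → ℂ)) :
    (Fin N → ℂ) →L[ℂ] (Fin N → ℂ) :=
  LinearMap.toContinuousLinearMap (b.equivFun.symm : (Fin N → ℂ) →ₗ[ℂ] (Fin N → ℂ))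

theorem repr_ofCoordL {N : ℕ} (b : Module.Basis (Fin N) ℂ (Fin N → ℂ)) (c : Fin N → ℂ)
    (i : Fin N) : b.repr (ofCoordL b c) i = c i :=
  congrFun (b.equivFun.apply_symm_apply c) i

theorem ofCoordL_repr {N : ℕ} (b : Module.Basis (Fin N) ℂ (Fin N → ℂ)) (v : Fin N → ℂ) :
    ofCoordL b (fun i => b.repr v i) = v := b.equivFun.symm_apply_apply v

section Cone
variable {N : ℕ} {b : Module.Basis (Fin N) ℂ (Fin N → ℂ)} {τ : Fin N → ℂ}

theorem span_diagForm_eq (b : Module.Basis (Fin N) ℂ (Fin N → ℂ)) (τ : Fin N → ℂ) :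
    Submodule.span ℂ {diagForm b τ, diagForm b 1} = diagPencil b τ 1 := by
  simp [diagPencil]

theorem mem_cone_iff {v : Fin N → ℂ} : v ∈ cone (diagPencil b τ 1) ↔
    v ≠ 0 ∧ ∑ i, b.repr v i ^ 2 = 0 ∧ ∑ i, τ i * b.repr v i ^ 2 = 0 := by
  refine and_congr_right fun _ => ⟨fun h => ⟨?_, ?_⟩, fun h φ hφ => ?_⟩
  · have := h (diagForm b 1) (Submodule.subset_span (by simp))
    simpa [diagForm_apply] using this
  · have := h (diagForm b τ) (Submodule.subset_span (by simp))
    simpa [diagForm_apply] using this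
  · obtain ⟨s, t, rfl⟩ := (mem_diagPencil ..).mp hφ
    have : diagForm b (fun i => (s * τ i + t) * (1 : Fin N → ℂ) i) v =
        s * ∑ i, τ i * b.repr v i ^ 2 + t * ∑ i, b.repr v i ^ 2 := by
      rw [diagForm_apply, Finset.mul_sum, Finset.mul_sum, ← Finset.sum_add_distrib]
      exact Finset.sum_congr rfl fun i _ => by simp; ring
    rw [this, h.1, h.2]
    ring

theorem mem_affineTangent_iff {v u : Fin N → ℂ} : u ∈ affineTangent (diagPencil b τ 1) v ↔
    ∑ i, b.repr v i * b.repr u i = 0 ∧ ∑ i, τ i * (b.repr v i * b.repr u i) = 0 := by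
  simp only [affineTangent, Submodule.mem_iInf, LinearMap.mem_ker,
    QuadraticMap.polarBilin_apply_apply]
  refine ⟨fun h => ⟨?_, ?_⟩, fun h φ hφ => ?_⟩
  · have := h (diagForm b 1) (Submodule.subset_span (by simp))
    simpa [polar_diagForm] using this
  · have := h (diagForm b τ) (Submodule.subset_span (by simp))
    simpa [polar_diagForm] using this
  · obtain ⟨s, t, rfl⟩ := (mem_diagPencil ..).mp hφ
    rw [polar_diagForm]
    have : ∑ i, (s * τ i + t) * (1 : Fin N → ℂ) i * (b.repr v i * b.repr u i) =
        s * ∑ i, τ i * (b.repr v i * b.repr u i) + t * ∑ i, b.repr v i * b.repr u i := by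
      rw [Finset.mul_sum, Finset.mul_sum, ← Finset.sum_add_distrib]
      exact Finset.sum_congr rfl fun i _ => by simp; ring
    rw [this, h.1, h.2]
    ring

/-- Differentiation of the equation of the affine tangent spaces along a curve. -/
theorem polar_deriv_add {φ : QuadraticForm ℂ (Fin N → ℂ)} (hφ : φ ∈ diagPencil b τ 1)
    {γ w : ℂ → Fin N → ℂ} (hγ : DifferentiableAt ℂ γ 0) (hw : DifferentiableAt ℂ w 0)
    (h : ∀ᶠ t in 𝓝 (0 : ℂ), w t ∈ affineTangent (diagPencil b τ 1) (γ t)) :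
    QuadraticMap.polar φ (deriv γ 0) (w 0) + QuadraticMap.polar φ (γ 0) (deriv w 0) = 0 := by
  have h0 : ∀ᶠ t in 𝓝 (0 : ℂ), QuadraticMap.polar φ (γ t) (w t) = 0 := by
    filter_upwards [h] with t ht
    simp only [affineTangent, Submodule.mem_iInf, LinearMap.mem_ker] at ht
    exact ht φ hφ
  obtain ⟨s, t, rfl⟩ := (mem_diagPencil ..).mp hφ
  simp only [polar_diagForm] at h0 ⊢
  have hd : HasDerivAt (fun z => 2 * ∑ i, (s * τ i + t) * (1 : Fin N → ℂ) i *
      (b.repr (γ z) i * b.repr (w z) i))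
      (2 * ∑ i, (s * τ i + t) * (1 : Fin N → ℂ) i *
        (b.repr (deriv γ 0) i * b.repr (w 0) i + b.repr (γ 0) i * b.repr (deriv w 0) i)) 0 := by
    refine HasDerivAt.const_mul _ (HasDerivAt.fun_sum fun i _ => HasDerivAt.const_mul _ ?_)
    exact HasDerivAt.fun_mul ((coordL b i).hasFDerivAt.comp_hasDerivAt 0 hγ.hasDerivAt)
      ((coordL b i).hasFDerivAt.comp_hasDerivAt 0 hw.hasDerivAt)
  have hz := hd.unique ((hasDerivAt_const (0 : ℂ) (0 : ℂ)).congr_of_eventuallyEq h0)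
  rw [← mul_add, ← Finset.sum_add_distrib]
  refine Eq.trans ?_ hz
  congr 1
  exact Finset.sum_congr rfl fun i _ => by ring

end Cone

/-- The principal branch of the square root. -/
def csqrt (x : ℂ) : ℂ := x ^ (((2 : ℕ) : ℂ)⁻¹)

theorem csqrt_sq (x : ℂ) : csqrt x ^ 2 = x := Complex.cpow_nat_inv_pow x two_ne_zero

theorem csqrt_one : csqrt 1 = 1 := Complex.one_cpow _

theorem hasDerivAt_csqrt {g : ℂ → ℂ} {g' t : ℂ} (hg : HasDerivAt g g' t) (h1 : g t = 1) :
    HasDerivAt (fun z => csqrt (g z)) (g' / 2) t := by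
  have := hg.cpow_const (c := ((2 : ℕ) : ℂ)⁻¹) (by rw [h1]; exact Complex.one_mem_slitPlane)
  refine this.congr_deriv ?_
  rw [h1, Complex.one_cpow]
  push_cast
  ring

theorem analyticAt_csqrt {g : ℂ → ℂ} {t : ℂ} (hg : AnalyticAt ℂ g t) (h1 : g t = 1) :
    AnalyticAt ℂ (fun z => csqrt (g z)) t :=
  hg.cpow analyticAt_const (by rw [h1]; exact Complex.one_mem_slitPlane)

/-- Every tangent vector of the cone is tangent to a curve in the cone, along which every tangent
vector extends to a curve of tangent vectors. The squares of the coordinates satisfy linear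
equations, so that the curve can be written down with square roots. -/
theorem exists_curve_pair {N : ℕ} {b : Module.Basis (Fin N) ℂ (Fin N → ℂ)} {τ : Fin N → ℂ}
    {v : Fin N → ℂ} (hv : v ∈ cone (diagPencil b τ 1)) (hz : ∀ i, b.repr v i ≠ 0)
    {a c : Fin N → ℂ} (ha : a ∈ affineTangent (diagPencil b τ 1) v)
    (hc : c ∈ affineTangent (diagPencil b τ 1) v) :
    ∃ γ w : ℂ → Fin N → ℂ, AnalyticAt ℂ γ 0 ∧ AnalyticAt ℂ w 0 ∧ γ 0 = v ∧ deriv γ 0 = a ∧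
      w 0 = c ∧ (∀ᶠ t in 𝓝 (0 : ℂ), γ t ∈ cone (diagPencil b τ 1)) ∧
      ∀ᶠ t in 𝓝 (0 : ℂ), w t ∈ affineTangent (diagPencil b τ 1) (γ t) := by
  rw [mem_affineTangent_iff] at ha hc
  obtain ⟨hv0, hv1, hv2⟩ := mem_cone_iff.mp hv
  let g : Fin N → ℂ → ℂ := fun i t => 1 + t * (2 * b.repr a i / b.repr v i)
  have hg0 : ∀ i, g i 0 = 1 := fun i => by simp [g]
  have hga : ∀ i, AnalyticAt ℂ (g i) 0 := fun i => by fun_prop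
  have hgd : ∀ i, HasDerivAt (g i) (2 * b.repr a i / b.repr v i) 0 := fun i => by
    simpa [g] using ((hasDerivAt_id (0 : ℂ)).mul_const (2 * b.repr a i / b.repr v i)).const_add 1
  have hgne : ∀ᶠ t in 𝓝 (0 : ℂ), ∀ i, csqrt (g i t) ≠ 0 := by
    rw [Filter.eventually_all]
    intro i
    refine (analyticAt_csqrt (hga i) (hg0 i)).continuousAt.eventually_ne ?_
    rw [hg0, csqrt_one]
    exact one_ne_zero
  have hγa : AnalyticAt ℂ (fun t => ofCoordL b (fun i => b.repr v i * csqrt (g i t))) 0 :=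
    ((ofCoordL b).analyticAt _).comp
      (AnalyticAt.pi fun i => analyticAt_const.mul (analyticAt_csqrt (hga i) (hg0 i)))
  have hγ0 : ofCoordL b (fun i => b.repr v i * csqrt (g i 0)) = v := by
    simp only [hg0, csqrt_one, mul_one, ofCoordL_repr]
  refine ⟨fun t => ofCoordL b (fun i => b.repr v i * csqrt (g i t)),
    fun t => ofCoordL b (fun i => b.repr c i * (csqrt (g i t))⁻¹), hγa, ?_, hγ0, ?_, ?_, ?_, ?_⟩
  · refine ((ofCoordL b).analyticAt _).comp
      (AnalyticAt.pi fun i => analyticAt_const.mul ((analyticAt_csqrt (hga i) (hg0 i)).inv ?_))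
    rw [hg0, csqrt_one]
    exact one_ne_zero
  · have hd : HasDerivAt (fun t => fun i => b.repr v i * csqrt (g i t)) (fun i => b.repr a i) 0 := by
      rw [hasDerivAt_pi]
      intro i
      refine ((hasDerivAt_csqrt (hgd i) (hg0 i)).const_mul (b.repr v i)).congr_deriv ?_
      have := hz i
      field_simp
    exact (((ofCoordL b).hasFDerivAt.comp_hasDerivAt 0 hd).deriv).trans (ofCoordL_repr b a)
  · simp only [hg0, csqrt_one, inv_one, mul_one, ofCoordL_repr]
  · have hne : ∀ᶠ t in 𝓝 (0 : ℂ), ofCoordL b (fun i => b.repr v i * csqrt (g i t)) ≠ 0 :=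
      hγa.continuousAt.eventually_ne (by rw [hγ0]; exact hv0)
    filter_upwards [hne] with t ht
    rw [mem_cone_iff]
    have hsq : ∀ i, (b.repr v i * csqrt (g i t)) ^ 2 =
        b.repr v i ^ 2 + 2 * t * (b.repr v i * b.repr a i) := by
      intro i
      rw [mul_pow, csqrt_sq]
      have := hz i
      simp only [g]
      field_simp
    simp only [repr_ofCoordL, hsq]
    refine ⟨ht, ?_, ?_⟩
    · rw [Finset.sum_add_distrib, ← Finset.mul_sum, hv1, ha.1]; ring
    · simp only [mul_add, Finset.sum_add_distrib]
      rw [hv2, zero_add]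
      have : ∀ i, τ i * (2 * t * (b.repr v i * b.repr a i)) =
          2 * t * (τ i * (b.repr v i * b.repr a i)) := fun i => by ring
      simp only [this]
      rw [← Finset.mul_sum, ha.2, mul_zero]
  · filter_upwards [hgne] with t ht
    rw [mem_affineTangent_iff]
    have hp : ∀ i, b.repr v i * csqrt (g i t) * (b.repr c i * (csqrt (g i t))⁻¹) =
        b.repr v i * b.repr c i := by
      intro i
      have := ht i
      field_simp
    simp only [repr_ofCoordL, hp]
    exact hc

/-! ### Eigenvectors of the second fundamental form -/

namespace RootDatum
variable {n : ℕ} {b : Module.Basis (Fin (n + 3)) ℂ (Fin (n + 3) → ℂ)} {τ : Fin (n + 3) → ℂ}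
  {v : Fin (n + 3) → ℂ} {l : Fin n → ℂ}

theorem repr_ne_zero (hτ : Function.Injective τ) (h : RootDatum b τ v l) (i : Fin (n + 3)) :
    b.repr v i ≠ 0 := by
  obtain ⟨s, hs, hsq⟩ := h.sq_eq
  intro h0
  have := hsq i
  rw [h0] at this
  refine mul_ne_zero hs (mul_ne_zero
    (Lagrange.nodalWeight_ne_zero hτ.injOn (Finset.mem_univ i)) ?_) (by rw [← this]; norm_num)
  exact Finset.prod_ne_zero_iff.mpr fun k _ => sub_ne_zero.mpr (h.ne i k)

theorem smul (h : RootDatum b τ v l) {c : ℂ} (hc : c ≠ 0) : RootDatum b τ (c • v) l := by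
  obtain ⟨s, hs, hsq⟩ := h.sq_eq
  refine ⟨h.injective, h.ne, c ^ 2 * s, mul_ne_zero (pow_ne_zero 2 hc) hs, fun i => ?_⟩
  rw [map_smul, Finsupp.smul_apply, smul_eq_mul, mul_pow, hsq]
  ring

theorem sum_sq (hτ : Function.Injective τ) (h : RootDatum b τ v l) :
    ∑ i, b.repr v i ^ 2 = 0 ∧ ∑ i, τ i * b.repr v i ^ 2 = 0 := by
  obtain ⟨s, hs, hsq⟩ := h.sq_eq
  have hdeg : (Lagrange.nodal Finset.univ l).degree = (n : WithBot ℕ) := by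
    rw [Lagrange.degree_nodal, Finset.card_univ, Fintype.card_fin]
  constructor
  · have := sum_nodalWeight_eval hτ (Lagrange.nodal Finset.univ l)
      (by rw [hdeg]; exact_mod_cast (by omega : n < n + 2))
    simp only [Lagrange.eval_nodal] at this
    simp only [hsq]
    rw [← Finset.mul_sum, this, mul_zero]
  · have := sum_nodalWeight_eval hτ (Polynomial.X * Lagrange.nodal Finset.univ l) (by
      rw [Polynomial.degree_mul, Polynomial.degree_X, hdeg]
      exact_mod_cast (by omega : 1 + n < n + 2))
    simp only [Polynomial.eval_mul, Polynomial.eval_X, Lagrange.eval_nodal] at this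
    calc _ = s * ∑ i, Lagrange.nodalWeight Finset.univ τ i * (τ i * ∏ k, (τ i - l k)) := by
          rw [Finset.mul_sum]
          exact Finset.sum_congr rfl fun i _ => by rw [hsq]; ring
      _ = 0 := by rw [this, mul_zero]

theorem sum_div (hτ : Function.Injective τ) (h : RootDatum b τ v l) (k : Fin n) :
    ∑ i, b.repr v i ^ 2 / (τ i - l k) = 0 := by
  obtain ⟨s, hs, hsq⟩ := h.sq_eq
  have := sum_nodalWeight_eval hτ (Lagrange.nodal (Finset.univ.erase k) l) (by
    rw [Lagrange.degree_nodal, Finset.card_erase_of_mem (Finset.mem_univ k), Finset.card_univ,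
      Fintype.card_fin]
    exact_mod_cast (by omega : n - 1 < n + 2))
  simp only [Lagrange.eval_nodal] at this
  calc _ = s * ∑ i, Lagrange.nodalWeight Finset.univ τ i *
        ∏ j ∈ Finset.univ.erase k, (τ i - l j) := by
        rw [Finset.mul_sum]
        refine Finset.sum_congr rfl fun i _ => ?_
        have h0 := sub_ne_zero.mpr (h.ne i k)
        rw [hsq, ← Finset.mul_prod_erase _ _ (Finset.mem_univ k)]
        field_simp
    _ = 0 := by rw [this, mul_zero]

theorem sum_div_mul_div (hτ : Function.Injective τ) (h : RootDatum b τ v l) {k m : Fin n}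
    (hkm : k ≠ m) : ∑ i, b.repr v i ^ 2 / ((τ i - l k) * (τ i - l m)) = 0 := by
  have hlm := sub_ne_zero.mpr (h.injective.ne hkm)
  have : ∀ i, b.repr v i ^ 2 / ((τ i - l k) * (τ i - l m)) = (l k - l m)⁻¹ *
      (b.repr v i ^ 2 / (τ i - l k) - b.repr v i ^ 2 / (τ i - l m)) := by
    intro i
    have h1 := sub_ne_zero.mpr (h.ne i k)
    have h2 := sub_ne_zero.mpr (h.ne i m)
    field_simp
    ring
  simp only [this]
  rw [← Finset.mul_sum, Finset.sum_sub_distrib, h.sum_div hτ, h.sum_div hτ, sub_self, mul_zero]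

theorem exists_sum_div_sq (hτ : Function.Injective τ) (h : RootDatum b τ v l) :
    ∃ s : ℂ, s ≠ 0 ∧ ∀ k, ∑ i, b.repr v i ^ 2 / (τ i - l k) ^ 2 = s * sqLength τ l k := by
  obtain ⟨s, hs, hsq⟩ := h.sq_eq
  refine ⟨s, hs, fun k => ?_⟩
  have := sum_nodalWeight_div hτ (Lagrange.nodal (Finset.univ.erase k) l) (by
    rw [Lagrange.degree_nodal, Finset.card_erase_of_mem (Finset.mem_univ k), Finset.card_univ,
      Fintype.card_fin]
    exact_mod_cast (by omega : n - 1 < n + 2)) (x := l k) (fun i => h.ne i k)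
  simp only [Lagrange.eval_nodal] at this
  rw [sqLength, ← this, Finset.mul_sum]
  refine Finset.sum_congr rfl fun i _ => ?_
  have h0 := sub_ne_zero.mpr (h.ne i k)
  rw [hsq, ← Finset.mul_prod_erase _ _ (Finset.mem_univ k)]
  field_simp

theorem mem_cone (hτ : Function.Injective τ) (h : RootDatum b τ v l) :
    v ∈ cone (diagPencil b τ 1) := by
  refine mem_cone_iff.mpr ⟨?_, h.sum_sq hτ⟩
  rintro rfl
  exact h.repr_ne_zero hτ 0 (by simp)

/-- The eigenvectors of the second fundamental form, as vectors of the affine tangent space. -/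
def eigenvector (b : Module.Basis (Fin (n + 3)) ℂ (Fin (n + 3) → ℂ)) (τ : Fin (n + 3) → ℂ)
    (v : Fin (n + 3) → ℂ) (l : Fin n → ℂ) (k : Fin n) : Fin (n + 3) → ℂ :=
  ofCoordL b fun i => b.repr v i / (τ i - l k)

theorem repr_eigenvector (k : Fin n) (i : Fin (n + 3)) :
    b.repr (eigenvector b τ v l k) i = b.repr v i / (τ i - l k) := repr_ofCoordL ..

theorem eigenvector_mem (hτ : Function.Injective τ) (h : RootDatum b τ v l) (k : Fin n) :
    eigenvector b τ v l k ∈ affineTangent (diagPencil b τ 1) v := by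
  rw [mem_affineTangent_iff]
  simp only [repr_eigenvector]
  have h1 : ∑ i, b.repr v i * (b.repr v i / (τ i - l k)) = 0 := by
    rw [← h.sum_div hτ k]
    exact Finset.sum_congr rfl fun i _ => by ring
  refine ⟨h1, ?_⟩
  have : ∀ i, τ i * (b.repr v i * (b.repr v i / (τ i - l k))) =
      b.repr v i ^ 2 + l k * (b.repr v i * (b.repr v i / (τ i - l k))) := by
    intro i
    have h0 := sub_ne_zero.mpr (h.ne i k)
    field_simp
    ring
  simp only [this]
  rw [Finset.sum_add_distrib, ← Finset.mul_sum, h1, (h.sum_sq hτ).1]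
  ring

/-- The eigenvectors are orthogonal for all forms of the pencil. -/
theorem polar_eigenvector (hτ : Function.Injective τ) (h : RootDatum b τ v l) (p q : ℂ)
    (k m : Fin n) :
    QuadraticMap.polar (diagForm b fun i => (p * τ i + q) * (1 : Fin (n + 3) → ℂ) i)
      (eigenvector b τ v l k) (eigenvector b τ v l m) =
      if k = m then 2 * ((p * l k + q) * ∑ i, b.repr v i ^ 2 / (τ i - l k) ^ 2) else 0 := by
  rw [polar_diagForm]
  simp only [repr_eigenvector]
  have : ∀ i, (p * τ i + q) * (1 : Fin (n + 3) → ℂ) i * (b.repr v i / (τ i - l k) *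
      (b.repr v i / (τ i - l m))) = p * (b.repr v i ^ 2 / (τ i - l m)) +
        (p * l k + q) * (b.repr v i ^ 2 / ((τ i - l k) * (τ i - l m))) := by
    intro i
    have h1 := sub_ne_zero.mpr (h.ne i k)
    have h2 := sub_ne_zero.mpr (h.ne i m)
    simp only [Pi.one_apply]
    field_simp
    ring
  simp only [this]
  rw [Finset.sum_add_distrib, ← Finset.mul_sum, ← Finset.mul_sum, h.sum_div hτ]
  split_ifs with hkm
  · subst hkm
    simp only [← pow_two]
    ring
  · rw [h.sum_div_mul_div hτ hkm]
    ring

end RootDatum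

section Tangent
variable {n : ℕ} {b : Module.Basis (Fin (n + 3)) ℂ (Fin (n + 3) → ℂ)} {τ : Fin (n + 3) → ℂ}
  {x : ℙ ℂ (Fin (n + 3) → ℂ)} {l : Fin n → ℂ}

open RootDatum

theorem mem_submodule_iff {y : Fin (n + 3) → ℂ} : y ∈ x.submodule ↔ ∃ c : ℂ, c • x.rep = y := by
  rw [Projectivization.submodule_eq, Submodule.mem_span_singleton]

theorem rep_mem_affineTangent (hx : x.rep ∈ cone (diagPencil b τ 1)) :
    x.rep ∈ affineTangent (diagPencil b τ 1) x.rep := by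
  rw [mem_affineTangent_iff]
  obtain ⟨-, h1, h2⟩ := mem_cone_iff.mp hx
  exact ⟨by simpa only [pow_two] using h1, by simpa only [pow_two] using h2⟩

theorem toTangent_eq_zero_iff (Φ : QuadSys (n + 3)) (u : affineTangent Φ x.rep) :
    toTangent Φ x u = 0 ↔ (u : Fin (n + 3) → ℂ) ∈ x.submodule := by
  rw [toTangent, Submodule.mkQ_apply, Submodule.Quotient.mk_eq_zero]
  rfl

theorem polar_rep_eq_zero {Φ : QuadSys (n + 3)} {φ : QuadraticForm ℂ (Fin (n + 3) → ℂ)}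
    (hφ : φ ∈ Φ) {u : Fin (n + 3) → ℂ} (hu : u ∈ affineTangent Φ x.rep) :
    QuadraticMap.polar φ x.rep u = 0 := by
  simp only [affineTangent, Submodule.mem_iInf, LinearMap.mem_ker] at hu
  exact hu φ hφ

theorem finrank_affineTangent {v : Fin (n + 3) → ℂ} (hτ : Function.Injective τ)
    (hz : ∀ i, b.repr v i ≠ 0) :
    Module.finrank ℂ (affineTangent (diagPencil b τ 1) v) = n + 1 := by
  let f : (Fin (n + 3) → ℂ) →ₗ[ℂ] ℂ × ℂ :=
    LinearMap.prod (∑ i, b.repr v i • b.coord i) (∑ i, (τ i * b.repr v i) • b.coord i)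
  have hker : affineTangent (diagPencil b τ 1) v = LinearMap.ker f := by
    ext u
    rw [mem_affineTangent_iff, LinearMap.mem_ker]
    simp [f, Prod.ext_iff, mul_assoc]
  have hsurj : LinearMap.range f = ⊤ := by
    rw [LinearMap.range_eq_top]
    rintro ⟨p, q⟩
    have h01 : τ 1 - τ 0 ≠ 0 := sub_ne_zero.mpr (hτ.ne (by simp))
    have h0 := hz 0
    have h1 := hz 1
    refine ⟨((p - (q - τ 0 * p) / (τ 1 - τ 0)) / b.repr v 0) • b 0 +
      ((q - τ 0 * p) / (τ 1 - τ 0) / b.repr v 1) • b 1, ?_⟩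
    have hf : ∀ i, f (b i) = (b.repr v i, τ i * b.repr v i) := by
      intro i
      simp [f, Finsupp.single_apply]
    rw [map_add, map_smul, map_smul, hf, hf]
    ext
    · simp
      field_simp
      ring
    · simp
      field_simp
      ring
  have := LinearMap.finrank_range_add_finrank_ker f
  rw [hsurj, finrank_top, Module.finrank_prod, Module.finrank_self, Module.finrank_fin_fun,
    ← hker] at this
  omega

theorem finrank_tangent (hτ : Function.Injective τ) (hx : x.rep ∈ cone (diagPencil b τ 1))
    (hz : ∀ i, b.repr x.rep i ≠ 0) :
    Module.finrank ℂ (TangentAt (diagPencil b τ 1) x) = n := by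
  have hle : x.submodule ≤ affineTangent (diagPencil b τ 1) x.rep := by
    rw [Projectivization.submodule_eq, Submodule.span_singleton_le_iff_mem]
    exact rep_mem_affineTangent hx
  have h1 := Submodule.finrank_quotient_add_finrank
    (x.submodule.submoduleOf (affineTangent (diagPencil b τ 1) x.rep))
  rw [finrank_affineTangent hτ hz, (Submodule.submoduleOfEquivOfLe hle).finrank_eq,
    Projectivization.finrank_submodule] at h1
  exact Nat.add_right_cancel h1

/-- The squared lengths of the eigenvectors. -/
def beta (b : Module.Basis (Fin (n + 3)) ℂ (Fin (n + 3) → ℂ)) (τ : Fin (n + 3) → ℂ)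
    (v : Fin (n + 3) → ℂ) (l : Fin n → ℂ) (k : Fin n) : ℂ :=
  ∑ i, b.repr v i ^ 2 / (τ i - l k) ^ 2

theorem beta_ne_zero {v : Fin (n + 3) → ℂ} (hτ : Function.Injective τ) (h : RootDatum b τ v l)
    (k : Fin n) : beta b τ v l k ≠ 0 := by
  obtain ⟨s, hs, hb⟩ := h.exists_sum_div_sq hτ
  rw [beta, hb]
  exact mul_ne_zero hs (sqLength_ne_zero h.injective h.ne k)

/-- The eigenvectors of the second fundamental form are a basis of the tangent space that
diagonalizes the forms of the pencil. -/
theorem exists_tangentBasis (hn : 0 < n) (hτ : Function.Injective τ) (h : RootDatum b τ x.rep l) :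
    ∃ e : Module.Basis (Fin n) ℂ (TangentAt (diagPencil b τ 1) x),
      (∀ k, e k = toTangent _ x ⟨eigenvector b τ x.rep l k, h.eigenvector_mem hτ k⟩) ∧
      (∀ u : affineTangent (diagPencil b τ 1) x.rep, ∃ c : ℂ, (u : Fin (n + 3) → ℂ) =
        c • x.rep + ∑ k, e.repr (toTangent _ x u) k • eigenvector b τ x.rep l k) ∧
      ∀ (p q : ℂ) (u w : affineTangent (diagPencil b τ 1) x.rep),
        QuadraticMap.polar (diagForm b fun i => (p * τ i + q) * (1 : Fin (n + 3) → ℂ) i)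
          (u : Fin (n + 3) → ℂ) w =
        QuadraticMap.polar (diagForm e fun k => (p * l k + q) * beta b τ x.rep l k)
          (toTangent _ x u) (toTangent _ x w) := by
  classical
  set Φ := diagPencil b τ 1 with hΦ
  let E : Fin n → affineTangent Φ x.rep := fun k =>
    ⟨eigenvector b τ x.rep l k, h.eigenvector_mem hτ k⟩
  have hφ : ∀ p q : ℂ, diagForm b (fun i => (p * τ i + q) * (1 : Fin (n + 3) → ℂ) i) ∈ Φ :=
    fun p q => (mem_diagPencil ..).mpr ⟨p, q, rfl⟩
  have hli : LinearIndependent ℂ fun k => toTangent Φ x (E k) := by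
    rw [Fintype.linearIndependent_iff]
    intro c hc k
    have hc' : toTangent Φ x (∑ k, c k • E k) = 0 := by
      rw [map_sum, ← hc]
      exact Finset.sum_congr rfl fun k _ => map_smul ..
    rw [toTangent_eq_zero_iff, mem_submodule_iff] at hc'
    obtain ⟨r, hr⟩ := hc'
    have h1 : QuadraticMap.polar (diagForm b fun i => (0 * τ i + 1) * (1 : Fin (n + 3) → ℂ) i)
        (r • x.rep) (E k) = 0 := by
      rw [QuadraticMap.polar_smul_left, polar_rep_eq_zero (hφ 0 1) (E k).2, smul_zero]
    rw [hr, ← QuadraticMap.polarBilin_apply_apply] at h1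
    simp only [AddSubmonoidClass.coe_finsetSum, Submodule.coe_smul, map_sum, map_smul,
      LinearMap.sum_apply, LinearMap.smul_apply, QuadraticMap.polarBilin_apply_apply, E] at h1
    rw [Finset.sum_eq_single k] at h1
    · rw [h.polar_eigenvector hτ, if_pos rfl] at h1
      have hb : ∑ i, b.repr x.rep i ^ 2 / (τ i - l k) ^ 2 ≠ 0 := beta_ne_zero hτ h k
      simpa [hb] using h1
    · intro m _ hm
      rw [h.polar_eigenvector hτ, if_neg hm, smul_zero]
    · simp
  have hcard : Fintype.card (Fin n) = Module.finrank ℂ (TangentAt Φ x) := by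
    rw [Fintype.card_fin, finrank_tangent hτ (h.mem_cone hτ) (h.repr_ne_zero hτ)]
  have : Nonempty (Fin n) := ⟨⟨0, hn⟩⟩
  let e := basisOfLinearIndependentOfCardEqFinrank hli hcard
  have he : ∀ k, e k = toTangent Φ x (E k) := fun k => by
    simp [e]
  have hdec : ∀ u : affineTangent Φ x.rep, ∃ c : ℂ, (u : Fin (n + 3) → ℂ) =
      c • x.rep + ∑ k, e.repr (toTangent Φ x u) k • eigenvector b τ x.rep l k := by
    intro u
    have h0 : toTangent Φ x (u - ∑ k, e.repr (toTangent Φ x u) k • E k) = 0 := by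
      rw [map_sub, map_sum]
      simp only [map_smul, ← he]
      rw [e.sum_repr, sub_self]
    rw [toTangent_eq_zero_iff, mem_submodule_iff] at h0
    obtain ⟨c, hc⟩ := h0
    refine ⟨c, ?_⟩
    rw [hc]
    simp [E]
  refine ⟨e, he, hdec, fun p q u w => ?_⟩
  obtain ⟨c, hc⟩ := hdec u
  obtain ⟨d, hd⟩ := hdec w
  have h1 : QuadraticMap.polar (diagForm b fun i => (p * τ i + q) * (1 : Fin (n + 3) → ℂ) i)
      (u : Fin (n + 3) → ℂ) w =
      QuadraticMap.polar (diagForm b fun i => (p * τ i + q) * (1 : Fin (n + 3) → ℂ) i)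
        (∑ k, e.repr (toTangent Φ x u) k • eigenvector b τ x.rep l k) w := by
    conv_lhs => rw [hc]
    rw [QuadraticMap.polar_add_left, QuadraticMap.polar_smul_left,
      polar_rep_eq_zero (hφ p q) w.2, smul_zero, zero_add]
  have hmem : ∑ k, e.repr (toTangent Φ x u) k • eigenvector b τ x.rep l k ∈
      affineTangent Φ x.rep :=
    Submodule.sum_mem _ fun k _ => Submodule.smul_mem _ _ (h.eigenvector_mem hτ k)
  rw [h1]
  conv_lhs => rw [hd]
  rw [QuadraticMap.polar_add_right, QuadraticMap.polar_smul_right, QuadraticMap.polar_comm _ _ x.rep,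
    polar_rep_eq_zero (hφ p q) hmem, smul_zero, zero_add, ← QuadraticMap.polarBilin_apply_apply]
  simp only [map_sum, map_smul, LinearMap.sum_apply, LinearMap.smul_apply,
    QuadraticMap.polarBilin_apply_apply, h.polar_eigenvector hτ]
  rw [polar_diagForm, Finset.mul_sum]
  refine Finset.sum_congr rfl fun k _ => ?_
  simp only [smul_eq_mul, mul_ite, mul_zero, Finset.sum_ite_eq', Finset.mem_univ, if_true,
    beta]
  ring

/-- The second fundamental form consists of the forms induced by the pencil of equations. -/
theorem secondFundamentalForm_eq (hτ : Function.Injective τ) (h : RootDatum b τ x.rep l)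
    (e : Module.Basis (Fin n) ℂ (TangentAt (diagPencil b τ 1) x))
    (he : ∀ (p q : ℂ) (u w : affineTangent (diagPencil b τ 1) x.rep),
        QuadraticMap.polar (diagForm b fun i => (p * τ i + q) * (1 : Fin (n + 3) → ℂ) i)
          (u : Fin (n + 3) → ℂ) w =
        QuadraticMap.polar (diagForm e fun k => (p * l k + q) * beta b τ x.rep l k)
          (toTangent _ x u) (toTangent _ x w)) :
    secondFundamentalForm (diagPencil b τ 1) x = diagPencil e l (beta b τ x.rep l) := by
  set Φ := diagPencil b τ 1 with hΦ
  have hφ : ∀ p q : ℂ, diagForm b (fun i => (p * τ i + q) * (1 : Fin (n + 3) → ℂ) i) ∈ Φ :=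
    fun p q => (mem_diagPencil ..).mpr ⟨p, q, rfl⟩
  ext Q
  rw [mem_diagPencil]
  constructor
  · rintro ⟨L, hL, hQ⟩
    let P : Fin 2 → (Fin (n + 3) → ℂ) →ₗ[ℂ] ℂ :=
      ![(diagForm b (fun i => (1 * τ i + 0) * (1 : Fin (n + 3) → ℂ) i)).polarBilin x.rep,
        (diagForm b (fun i => (0 * τ i + 1) * (1 : Fin (n + 3) → ℂ) i)).polarBilin x.rep]
    have hspan : L ∈ Submodule.span ℂ (Set.range P) := by
      refine mem_span_of_iInf_ker_le_ker fun u hu => hL u ?_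
      rw [Submodule.mem_iInf] at hu
      have h0 : QuadraticMap.polar
        (diagForm b (fun i => (1 * τ i + 0) * (1 : Fin (n + 3) → ℂ) i)) x.rep u = 0 := hu 0
      have h1 : QuadraticMap.polar
        (diagForm b (fun i => (0 * τ i + 1) * (1 : Fin (n + 3) → ℂ) i)) x.rep u = 0 := hu 1
      rw [polar_diagForm] at h0 h1
      rw [mem_affineTangent_iff]
      exact ⟨by simpa using h1, by simpa using h0⟩
    rw [span_range_two] at hspan
    obtain ⟨p, q, hpq⟩ := Submodule.mem_span_pair.mp hspan
    have hLpol : ∀ u, L u = QuadraticMap.polar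
        (diagForm b (fun i => (p * τ i + q) * (1 : Fin (n + 3) → ℂ) i)) x.rep u := by
      intro u
      rw [← hpq]
      simp only [P, Matrix.cons_val_zero, Matrix.cons_val_one, LinearMap.add_apply,
        LinearMap.smul_apply, QuadraticMap.polarBilin_apply_apply, polar_diagForm, smul_eq_mul,
        Finset.mul_sum, ← Finset.sum_add_distrib]
      exact Finset.sum_congr rfl fun i _ => by ring
    refine ⟨-p, -q, quadraticForm_ext_polar fun y y' => ?_⟩
    obtain ⟨a, rfl⟩ := Submodule.mkQ_surjective _ y
    obtain ⟨c, rfl⟩ := Submodule.mkQ_surjective _ y'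
    obtain ⟨γ, w, hγ, hw, hγ0, hγ1, hw0, hcone, htan⟩ :=
      exists_curve_pair (h.mem_cone hτ) (h.repr_ne_zero hτ) a.2 c.2
    have h1 := hQ γ w hγ hw hγ0 hcone htan a c hγ1.symm hw0.symm
    have h2 := polar_deriv_add (hφ p q) hγ.differentiableAt hw.differentiableAt htan
    rw [hγ1, hw0, hγ0, ← hLpol, he] at h2
    rw [hLpol, ← hLpol] at h1
    change QuadraticMap.polar Q (toTangent Φ x a) (toTangent Φ x c) =
      QuadraticMap.polar _ (toTangent Φ x a) (toTangent Φ x c)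
    rw [h1, eq_neg_of_add_eq_zero_right h2, polar_diagForm, polar_diagForm, ← mul_neg,
      ← Finset.sum_neg_distrib]
    congr 1
    exact Finset.sum_congr rfl fun i _ => by ring
  · rintro ⟨p, q, rfl⟩
    refine ⟨(diagForm b (fun i => (-p * τ i + -q) * (1 : Fin (n + 3) → ℂ) i)).polarBilin x.rep,
      fun u hu => polar_rep_eq_zero (hφ (-p) (-q)) hu, ?_⟩
    intro γ w hγ hw hγ0 hcone htan a c ha hc
    have h2 := polar_deriv_add (hφ (-p) (-q)) hγ.differentiableAt hw.differentiableAt htan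
    rw [← ha, ← hc, hγ0, he] at h2
    rw [QuadraticMap.polarBilin_apply_apply, eq_neg_of_add_eq_zero_right h2, polar_diagForm,
      polar_diagForm, ← mul_neg, ← Finset.sum_neg_distrib]
    congr 1
    exact Finset.sum_congr rfl fun i _ => by ring

end Tangent

/-! ### Curves and functions on the cone in terms of the roots -/

section Roots
variable {n : ℕ} {b : Module.Basis (Fin (n + 3)) ℂ (Fin (n + 3) → ℂ)} {τ : Fin (n + 3) → ℂ}
  {v : Fin (n + 3) → ℂ} {l : Fin n → ℂ}

theorem eventually_ne_nodes (hne : ∀ i k, τ i ≠ l k) : ∀ᶠ l' in 𝓝 l, ∀ i k, τ i ≠ l' k := by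
  simp only [Filter.eventually_all]
  intro i k
  filter_upwards [(continuous_apply k).continuousAt.eventually_ne (hne i k).symm] with l' hl'
  exact hl'.symm

/-- Every motion of the roots is realized by a curve in the cone, and its velocity is
read off in the basis of eigenvectors. -/
theorem RootDatum.exists_curve (h : RootDatum b τ v l) {L : ℂ → Fin n → ℂ}
    {μ : Fin n → ℂ} (hL : HasDerivAt L μ 0) (hL0 : L 0 = l) (c : ℂ) :
    ∃ γ : ℂ → Fin (n + 3) → ℂ, γ 0 = v ∧
      HasDerivAt γ (c • v + ∑ k, (-μ k / 2) • RootDatum.eigenvector b τ v l k) 0 ∧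
      ∀ᶠ t in 𝓝 0, RootDatum b τ (γ t) (L t) := by
  let f : Fin (n + 3) → ℂ → ℂ := fun i t => ∏ k, (τ i - L t k) / (τ i - l k)
  have hf0 : ∀ i, f i 0 = 1 := fun i => Finset.prod_eq_one fun k _ => by
    rw [hL0]; exact div_self (sub_ne_zero.mpr (h.ne i k))
  have hfd : ∀ i, HasDerivAt (f i) (∑ k, -μ k / (τ i - l k)) 0 := by
    intro i
    have : HasLogDerivAt (f i) (∑ k, -μ k / (τ i - l k)) 0 := by
      refine HasLogDerivAt.prod _ fun k _ => ?_
      have h1 := ((hasDerivAt_pi.mp hL k).const_sub (τ i)).div_const (τ i - l k)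
      refine h1.congr_deriv ?_
      simp only [hL0, div_self (sub_ne_zero.mpr (h.ne i k)), one_mul]
    exact this.congr_deriv (by rw [hf0, one_mul])
  let z : ℂ → Fin (n + 3) → ℂ := fun t i => (1 + c * t) * (b.repr v i * csqrt (f i t))
  have hc : HasDerivAt (fun t : ℂ => 1 + c * t) c 0 := by
    simpa using ((hasDerivAt_id (0 : ℂ)).const_mul c).const_add 1
  have hz : HasDerivAt z (fun i => c * b.repr v i + ∑ k, (-μ k / 2) *
      (b.repr v i / (τ i - l k))) 0 := by
    rw [hasDerivAt_pi]
    intro i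
    refine (hc.fun_mul ((hasDerivAt_csqrt (hfd i) (hf0 i)).const_mul (b.repr v i))).congr_deriv ?_
    rw [hf0, csqrt_one, mul_zero, add_zero, one_mul, mul_one, Finset.sum_div, Finset.mul_sum]
    congr 1
    exact Finset.sum_congr rfl fun k _ => by ring
  refine ⟨fun t => ofCoordL b (z t), ?_, ?_, ?_⟩
  · have : z 0 = fun i => b.repr v i := by
      funext i
      simp [z, hf0, csqrt_one]
    change ofCoordL b (z 0) = v
    rw [this, ofCoordL_repr]
  · refine ((ofCoordL b).hasFDerivAt.comp_hasDerivAt 0 hz).congr_deriv ?_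
    apply b.repr.injective
    ext i
    rw [repr_ofCoordL]
    simp [RootDatum.repr_eigenvector]
  · obtain ⟨s, hs, hsq⟩ := h.sq_eq
    have hLc : Filter.Tendsto L (𝓝 0) (𝓝 l) := by
      have := hL.continuousAt.tendsto
      rwa [hL0] at this
    have hcne : ∀ᶠ t in 𝓝 (0 : ℂ), 1 + c * t ≠ 0 :=
      hc.continuousAt.eventually_ne (by simp)
    filter_upwards [hcne, hLc.eventually (eventually_injective h.injective),
      hLc.eventually (eventually_ne_nodes h.ne)] with t h1 h2 h3
    refine ⟨h2, h3, (1 + c * t) ^ 2 * s, mul_ne_zero (pow_ne_zero 2 h1) hs, fun i => ?_⟩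
    rw [repr_ofCoordL]
    have h4 : ∏ k, (τ i - l k) ≠ 0 :=
      Finset.prod_ne_zero_iff.mpr fun k _ => sub_ne_zero.mpr (h.ne i k)
    simp only [z, mul_pow, csqrt_sq, hsq, f, Finset.prod_div_distrib]
    field_simp

/-- The polynomial whose roots parametrize the point `v` of the cone: it has the value
`∏_{j ≠ i} (τᵢ - τⱼ) zᵢ²` at `τᵢ`. -/
def rootPoly (b : Module.Basis (Fin (n + 3)) ℂ (Fin (n + 3) → ℂ)) (τ : Fin (n + 3) → ℂ)
    (v : Fin (n + 3) → ℂ) : Polynomial ℂ :=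
  Lagrange.interpolate Finset.univ τ fun i =>
    b.repr v i ^ 2 / Lagrange.nodalWeight Finset.univ τ i

theorem eval_rootPoly (hτ : Function.Injective τ) (v : Fin (n + 3) → ℂ) (i : Fin (n + 3)) :
    (rootPoly b τ v).eval (τ i) = b.repr v i ^ 2 / Lagrange.nodalWeight Finset.univ τ i :=
  Lagrange.eval_interpolate_at_node _ hτ.injOn (Finset.mem_univ i)

theorem contDiff_eval_rootPoly (b : Module.Basis (Fin (n + 3)) ℂ (Fin (n + 3) → ℂ))
    (τ : Fin (n + 3) → ℂ) :
    ContDiff ℂ 1 (Function.uncurry fun v z => (rootPoly b τ v).eval z) := by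
  simp only [rootPoly, Lagrange.interpolate_apply, Polynomial.eval_finsetSum, Polynomial.eval_mul,
    Polynomial.eval_C, div_eq_mul_inv]
  refine ContDiff.sum fun i _ => ?_
  refine ContDiff.mul (ContDiff.mul (ContDiff.pow ?_ 2) contDiff_const) ?_
  · exact (coordL b i).contDiff.comp contDiff_fst
  · have := fun P : Polynomial ℂ => (Polynomial.contDiff_aeval (𝕜 := ℂ) P 1).comp
      (contDiff_snd (E := Fin (n + 3) → ℂ))
    simp only [Polynomial.coe_aeval_eq_eval] at this
    exact this _

theorem RootDatum.rootPoly_eq (hτ : Function.Injective τ) (h : RootDatum b τ v l) :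
    ∃ s : ℂ, s ≠ 0 ∧ rootPoly b τ v = Polynomial.C s * Lagrange.nodal Finset.univ l := by
  obtain ⟨s, hs, hsq⟩ := h.sq_eq
  refine ⟨s, hs, (Lagrange.eq_interpolate_of_eval_eq _ hτ.injOn ?_ fun i _ => ?_).symm⟩
  · rw [Polynomial.degree_C_mul hs, Lagrange.degree_nodal, Finset.card_univ, Finset.card_univ,
      Fintype.card_fin, Fintype.card_fin]
    exact_mod_cast (by omega : n < n + 3)
  · rw [Polynomial.eval_mul, Polynomial.eval_C, Lagrange.eval_nodal, hsq]
    have := Lagrange.nodalWeight_ne_zero hτ.injOn (Finset.mem_univ i)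
    field_simp

/-- For points of the cone the degree of the polynomial drops by two. -/
theorem degree_rootPoly_lt (hτ : Function.Injective τ) (hv : v ∈ cone (diagPencil b τ 1)) :
    (rootPoly b τ v).degree < (n + 1 : ℕ) := by
  obtain ⟨-, h1, h2⟩ := mem_cone_iff.mp hv
  have hw : ∀ i : Fin (n + 3), Lagrange.nodalWeight Finset.univ τ i ≠ 0 := fun i =>
    Lagrange.nodalWeight_ne_zero hτ.injOn (Finset.mem_univ i)
  have hd : ∀ {P : Polynomial ℂ} {m : ℕ}, P.degree < (m + 1 : ℕ) → P.coeff m = 0 →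
      P.degree < (m : ℕ) := by
    intro P m hP h0
    rw [Polynomial.degree_lt_iff_coeff_zero] at hP ⊢
    intro k hk
    rcases hk.eq_or_lt with rfl | hk
    · exact h0
    · exact hP k hk
  have hd3 : (rootPoly b τ v).degree < (n + 3 : ℕ) :=
    (Lagrange.degree_interpolate_lt _ hτ.injOn).trans_le (by simp)
  have hd2 : (rootPoly b τ v).degree < (n + 2 : ℕ) := by
    refine hd hd3 ?_
    rw [coeff_eq_sum_nodalWeight hτ _ hd3, ← h1]
    refine Finset.sum_congr rfl fun i _ => ?_
    rw [eval_rootPoly hτ, mul_div_cancel₀ _ (hw i)]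
  refine hd hd2 ?_
  have hX : (Polynomial.X * rootPoly b τ v).degree < ((n + 3 : ℕ) : WithBot ℕ) := by
    rw [Polynomial.degree_lt_iff_coeff_zero] at hd2 ⊢
    intro k hk
    obtain ⟨k, rfl⟩ : ∃ j, k = j + 1 := ⟨k - 1, by omega⟩
    rw [Polynomial.coeff_X_mul]
    exact hd2 k (by omega)
  rw [← Polynomial.coeff_X_mul, coeff_eq_sum_nodalWeight hτ _ hX, ← h2]
  refine Finset.sum_congr rfl fun i _ => ?_
  rw [Polynomial.eval_mul, Polynomial.eval_X, eval_rootPoly hτ]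
  have := hw i
  field_simp

theorem rootDatum_of_isRoot (hτ : Function.Injective τ) (hv : v ∈ cone (diagPencil b τ 1))
    (hz : ∃ i, b.repr v i ≠ 0) (hl : Function.Injective l) (hne : ∀ i k, τ i ≠ l k)
    (hroot : ∀ k, (rootPoly b τ v).eval (l k) = 0) : RootDatum b τ v l := by
  set s := (rootPoly b τ v).coeff n with hs
  have hdeg := degree_rootPoly_lt hτ hv
  have hnd : (Lagrange.nodal (Finset.univ : Finset (Fin n)) l).natDegree = n := by
    rw [Lagrange.natDegree_nodal, Finset.card_univ, Fintype.card_fin]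
  have h0 : rootPoly b τ v - Polynomial.C s * Lagrange.nodal Finset.univ l = 0 := by
    refine Polynomial.eq_zero_of_degree_lt_of_eval_index_eq_zero Finset.univ (v := l) hl.injOn ?_ ?_
    · rw [Finset.card_univ, Fintype.card_fin, Polynomial.degree_lt_iff_coeff_zero]
      intro m hm
      rw [Polynomial.coeff_sub, Polynomial.coeff_C_mul]
      rcases hm.eq_or_lt with rfl | hm
      · have h1 : (Lagrange.nodal (Finset.univ : Finset (Fin n)) l).coeff n = 1 := by
          have := Lagrange.nodal_monic (s := (Finset.univ : Finset (Fin n))) (v := l)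
          rw [Polynomial.Monic, Polynomial.leadingCoeff, hnd] at this
          exact this
        rw [h1, mul_one, sub_self]
      · rw [(Polynomial.degree_lt_iff_coeff_zero _ _).mp hdeg m (by omega),
          Polynomial.coeff_eq_zero_of_natDegree_lt (by rw [hnd]; exact hm), mul_zero, sub_zero]
    · intro k _
      rw [Polynomial.eval_sub, hroot, Polynomial.eval_mul,
        Lagrange.eval_nodal_at_node (Finset.mem_univ k), mul_zero, sub_zero]
  have hsq : ∀ i, b.repr v i ^ 2 =
      s * (Lagrange.nodalWeight Finset.univ τ i * ∏ k, (τ i - l k)) := by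
    intro i
    have h1 := eval_rootPoly (b := b) hτ v i
    rw [sub_eq_zero.mp h0, Polynomial.eval_mul, Polynomial.eval_C, Lagrange.eval_nodal,
      eq_div_iff (Lagrange.nodalWeight_ne_zero hτ.injOn (Finset.mem_univ i))] at h1
    rw [← h1]
    ring
  refine ⟨hl, hne, s, ?_, hsq⟩
  rintro h1
  obtain ⟨i, hi⟩ := hz
  exact hi (pow_eq_zero_iff two_ne_zero |>.mp (by rw [hsq, h1, zero_mul]))

/-- The roots are differentiable functions on the cone. -/
theorem RootDatum.exists_roots (hτ : Function.Injective τ) (h : RootDatum b τ v l) :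
    ∃ R : (Fin (n + 3) → ℂ) → Fin n → ℂ, R v = l ∧ DifferentiableAt ℂ R v ∧
      ∀ᶠ u in 𝓝[cone (diagPencil b τ 1)] v, RootDatum b τ u (R u) := by
  obtain ⟨s, hs, hP⟩ := h.rootPoly_eq hτ
  have hbranch : ∀ k, ∃ r : (Fin (n + 3) → ℂ) → ℂ, r v = l k ∧
      (∀ᶠ x in 𝓝 v, DifferentiableAt ℂ r x) ∧
      ∀ᶠ x in 𝓝 v, (rootPoly b τ x).eval (r x) = 0 := by
    intro k
    refine exists_root_branch (fun v z => (rootPoly b τ v).eval z) (contDiff_eval_rootPoly b τ) v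
      (l k) _ ?_ ((rootPoly b τ v).hasDerivAt (l k)) ?_
    · simp only [hP, Polynomial.eval_mul, Lagrange.eval_nodal_at_node (Finset.mem_univ k), mul_zero]
    · rw [hP, Polynomial.derivative_C_mul, Polynomial.eval_mul, Polynomial.eval_C,
        Lagrange.eval_nodal_derivative_eval_node_eq (Finset.mem_univ k), Lagrange.eval_nodal]
      refine mul_ne_zero hs (Finset.prod_ne_zero_iff.mpr fun j hj => sub_ne_zero.mpr ?_)
      exact h.injective.ne (Finset.ne_of_mem_erase hj).symm
  choose r hr0 hrd hr using hbranch
  have hRd : DifferentiableAt ℂ (fun x k => r k x) v :=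
    differentiableAt_pi.mpr fun k => (hrd k).self_of_nhds
  have hR0 : (fun k => r k v) = l := funext hr0
  have hRt : Filter.Tendsto (fun x k => r k x) (𝓝 v) (𝓝 l) := by
    have := hRd.continuousAt.tendsto
    rwa [hR0] at this
  refine ⟨fun x k => r k x, hR0, hRd, ?_⟩
  have hz : ∀ᶠ u in 𝓝 v, b.repr u 0 ≠ 0 :=
    (coordL b 0).continuous.continuousAt.eventually_ne (h.repr_ne_zero hτ 0)
  filter_upwards [self_mem_nhdsWithin, nhdsWithin_le_nhds hz,
    nhdsWithin_le_nhds (hRt.eventually (eventually_injective h.injective)),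
    nhdsWithin_le_nhds (hRt.eventually (eventually_ne_nodes h.ne)),
    nhdsWithin_le_nhds (Filter.eventually_all.mpr hr)] with u h1 h2 h3 h4 h5
  exact rootDatum_of_isRoot hτ h1 ⟨0, h2⟩ h3 h4 h5

end Roots

section ConeFun
variable {n : ℕ} {b : Module.Basis (Fin (n + 3)) ℂ (Fin (n + 3) → ℂ)} {τ : Fin (n + 3) → ℂ}
  {x : ℙ ℂ (Fin (n + 3) → ℂ)} {l : Fin n → ℂ} {g : ℙ ℂ (Fin (n + 3) → ℂ) → ℂ}

theorem exists_coneFun_eq (hτ : Function.Injective τ) {v : Fin (n + 3) → ℂ}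
    (h : RootDatum b τ v l) :
    ∃ y : ℙ ℂ (Fin (n + 3) → ℂ), coneFun g v = g y ∧ RootDatum b τ y.rep l := by
  have hv : v ≠ 0 := (h.mem_cone hτ).1
  refine ⟨Projectivization.mk ℂ v hv, dif_neg hv, ?_⟩
  obtain ⟨a, ha⟩ := Projectivization.exists_smul_eq_mk_rep ℂ v hv
  rw [← ha, Units.smul_def]
  exact h.smul a.ne_zero

theorem differentiableWithinAt_coneFun (hτ : Function.Injective τ) (h : RootDatum b τ x.rep l)
    {G : (Fin n → ℂ) → ℂ} (hG : DifferentiableAt ℂ G l)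
    (hg : ∀ᶠ m in 𝓝 l, ∀ y : ℙ ℂ (Fin (n + 3) → ℂ), RootDatum b τ y.rep m → g y = G m) :
    DifferentiableWithinAt ℂ (coneFun g) (cone (diagPencil b τ 1)) x.rep := by
  obtain ⟨R, hR0, hRd, hR⟩ := h.exists_roots hτ
  have hRt : Filter.Tendsto R (𝓝 x.rep) (𝓝 l) := by
    have := hRd.continuousAt.tendsto
    rwa [hR0] at this
  have hd : DifferentiableWithinAt ℂ (G ∘ R) (cone (diagPencil b τ 1)) x.rep :=
    (DifferentiableAt.comp x.rep (by rwa [hR0]) hRd).differentiableWithinAt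
  refine hd.congr_of_eventuallyEq_of_mem ?_ (h.mem_cone hτ)
  filter_upwards [hR, nhdsWithin_le_nhds (hRt.eventually hg)] with u hu hu'
  obtain ⟨y, hy, hyd⟩ := exists_coneFun_eq (g := g) hτ hu
  rw [hy, hu' y hyd]
  rfl

/-- Derivatives of functions on the cone along motions of the roots. -/
theorem fderivWithin_coneFun (hτ : Function.Injective τ) (h : RootDatum b τ x.rep l)
    (hd : DifferentiableWithinAt ℂ (coneFun g) (cone (diagPencil b τ 1)) x.rep)
    {L : ℂ → Fin n → ℂ} {μ : Fin n → ℂ} (hL : HasDerivAt L μ 0) (hL0 : L 0 = l)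
    {H : ℂ → ℂ} {d : ℂ} (hH : HasDerivAt H d 0)
    (hg : ∀ᶠ t in 𝓝 0, ∀ y : ℙ ℂ (Fin (n + 3) → ℂ), RootDatum b τ y.rep (L t) → g y = H t) (c : ℂ) :
    fderivWithin ℂ (coneFun g) (cone (diagPencil b τ 1)) x.rep
      (c • x.rep + ∑ k, (-μ k / 2) • RootDatum.eigenvector b τ x.rep l k) = d := by
  obtain ⟨γ, hγ0, hγd, hγ⟩ := h.exists_curve hL hL0 c
  have h1 := hd.hasFDerivWithinAt.comp_hasDerivAt_of_eq (0 : ℂ) hγd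
    (hγ.mono fun t ht => ht.mem_cone hτ) hγ0.symm
  refine (h1.congr_of_eventuallyEq ?_).unique hH
  filter_upwards [hγ, hg] with t ht ht'
  obtain ⟨y, hy, hyd⟩ := exists_coneFun_eq (g := g) hτ ht
  rw [Function.comp_apply, hy, ht' y hyd]

end ConeFun

/-! ### The moduli map and the kernel of its differential -/

section Classes
variable {n : ℕ} {W : Type*} [AddCommGroup W] [Module ℂ W]

theorem diagForm_comp_symm (e : Module.Basis (Fin n) ℂ W) (w : Fin n → ℂ) :
    (diagForm e w).comp (e.equivFun.symm : (Fin n → ℂ) →ₗ[ℂ] W) =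
      diagForm (Pi.basisFun ℂ (Fin n)) w := by
  ext v
  rw [QuadraticMap.comp_apply, diagForm_apply, diagForm_apply]
  simp only [LinearEquiv.coe_coe, ← e.equivFun_apply, LinearEquiv.apply_symm_apply,
    Pi.basisFun_repr]

theorem stdSys_eq_image (e : Module.Basis (Fin n) ℂ W) (l β : Fin n → ℂ) :
    (stdSys l β : Set (QuadraticForm ℂ (Fin n → ℂ))) =
      (fun q : QuadraticForm ℂ W => q.comp (e.equivFun.symm : (Fin n → ℂ) →ₗ[ℂ] W)) ''
        (diagPencil e l β) := by
  rw [diagPencil, image_comp_span_pair, diagForm_comp_symm, diagForm_comp_symm]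
  rfl

/-- Pencils whose degenerate members correspond under a projective transformation of the line
are isomorphic: the scaling factors of the coordinates are square roots. -/
theorem pencilClass_stdSys_eq_of_moebius {l β l' β' : Fin n → ℂ} (hβ : ∀ i, β i ≠ 0)
    (hβ' : ∀ i, β' i ≠ 0) {a b c d : ℂ} (hdet : a * d - b * c ≠ 0) (h0 : ∀ k, c * l k + d ≠ 0)
    (h : ∀ k, l' k * (c * l k + d) = a * l k + b) :
    pencilClass n (stdSys l' β') = pencilClass n (stdSys l β) := by
  have hex : ∀ k, ∃ t : ℂˣ, (t : ℂ) ^ 2 = (c * l k + d) * β k / β' k := by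
    intro k
    have hne : (c * l k + d) * β k / β' k ≠ 0 := div_ne_zero (mul_ne_zero (h0 k) (hβ k)) (hβ' k)
    have hs := csqrt_sq ((c * l k + d) * β k / β' k)
    refine ⟨Units.mk0 (csqrt ((c * l k + d) * β k / β' k)) fun h1 => hne ?_, hs⟩
    rw [← hs, h1]
    ring
  choose t ht using hex
  let T : (Fin n → ℂ) ≃ₗ[ℂ] (Fin n → ℂ) := LinearEquiv.piCongrRight fun k =>
    LinearEquiv.smulOfUnit (t k)
  have hcomp : ∀ w : Fin n → ℂ, (diagForm (Pi.basisFun ℂ (Fin n)) w).comp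
      (T : (Fin n → ℂ) →ₗ[ℂ] (Fin n → ℂ)) =
      diagForm (Pi.basisFun ℂ (Fin n)) (fun k => w k * (t k : ℂ) ^ 2) := by
    intro w
    ext v
    rw [QuadraticMap.comp_apply, diagForm_apply, diagForm_apply]
    refine Finset.sum_congr rfl fun k _ => ?_
    have : (Pi.basisFun ℂ (Fin n)).repr (T v) k = (t k : ℂ) * v k := rfl
    rw [LinearEquiv.coe_coe, this, Pi.basisFun_repr]
    ring
  refine pencilClass_congr T ?_
  rw [stdSys, stdSys, diagPencil.eq_def _ l' β', image_comp_span_pair, hcomp, hcomp]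
  rw [SetLike.coe_set_eq]
  have e2 : (fun k => β' k * (t k : ℂ) ^ 2) = fun k => (c * l k + d) * β k := by
    funext k
    rw [ht]
    field_simp [hβ' k]
  have e1 : (fun k => l' k * β' k * (t k : ℂ) ^ 2) = fun k => (a * l k + b) * β k := by
    funext k
    rw [← h k, mul_assoc, mul_assoc]
    exact congrArg _ (congrFun e2 k)
  rw [e1, e2]
  apply le_antisymm
  · have hmem : ∀ s r : ℂ, ∃ p q : ℂ,
        diagForm (Pi.basisFun ℂ (Fin n)) (fun k => (s * l k + r) * β k) =
        p • diagForm (Pi.basisFun ℂ (Fin n)) (fun k => (a * l k + b) * β k) +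
        q • diagForm (Pi.basisFun ℂ (Fin n)) (fun k => (c * l k + d) * β k) := by
      intro s r
      refine ⟨(s * d - r * c) / (a * d - b * c), (r * a - s * b) / (a * d - b * c), ?_⟩
      rw [diagForm_comb]
      congr 1
      funext k
      have h1 : (a * d - b * c) * (a * d - b * c)⁻¹ = 1 := mul_inv_cancel₀ hdet
      linear_combination -(s * l k + r) * β k * h1
    intro q hq
    obtain ⟨s, r, rfl⟩ := (mem_diagPencil ..).mp hq
    obtain ⟨p, q, hpq⟩ := hmem s r
    rw [hpq]
    exact Submodule.mem_span_pair.mpr ⟨p, q, rfl⟩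
  · rw [Submodule.span_le]
    rintro _ (rfl | rfl)
    · exact (mem_diagPencil ..).mpr ⟨a, b, rfl⟩
    · exact (mem_diagPencil ..).mpr ⟨c, d, rfl⟩

end Classes

section Length
variable {n : ℕ} {τ : Fin (n + 3) → ℂ} {l : Fin n → ℂ}

theorem differentiableAt_sqLength (hne : ∀ i k, τ i ≠ l k) :
    DifferentiableAt ℂ (sqLength τ) l := by
  rw [differentiableAt_pi]
  intro k
  unfold sqLength
  simp only [div_eq_mul_inv]
  refine DifferentiableAt.fun_mul (by fun_prop) (DifferentiableAt.fun_inv (by fun_prop) ?_)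
  exact Finset.prod_ne_zero_iff.mpr fun i _ => sub_ne_zero.mpr (hne i k).symm

end Length

section Kernel
variable {n : ℕ} {b : Module.Basis (Fin (n + 3)) ℂ (Fin (n + 3) → ℂ)} {τ : Fin (n + 3) → ℂ}
  {x : ℙ ℂ (Fin (n + 3) → ℂ)} {l : Fin n → ℂ}

theorem stdSys_beta (hτ : Function.Injective τ) {v : Fin (n + 3) → ℂ} (h : RootDatum b τ v l) :
    stdSys l (beta b τ v l) = stdSys l (sqLength τ l) := by
  obtain ⟨s, hs, hb⟩ := h.exists_sum_div_sq hτ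
  rw [← stdSys_smul l (sqLength τ l) hs]
  exact congrArg _ (funext hb)

theorem moduliMap_eq (hn : 0 < n) (hτ : Function.Injective τ) (h : RootDatum b τ x.rep l) :
    moduliMap (diagPencil b τ 1) x = pencilClass n (stdSys l (sqLength τ l)) := by
  obtain ⟨e, -, -, he⟩ := exists_tangentBasis hn hτ h
  rw [moduliMap, secondFundamentalForm_eq hτ h e he,
    pencilClass_congr e.equivFun.symm (stdSys_eq_image e l _), stdSys_beta hτ h]

/-- Motions of the roots that infinitesimally preserve the cross ratios are given by
polynomials of degree two. -/
theorem exists_quadratic_of_crossRatio (hl : Function.Injective l) {μ : Fin n → ℂ}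
    {i j k : Fin n} (hij : i ≠ j) (hjk : j ≠ k) (hik : i ≠ k)
    (hμ : ∀ r, r ≠ i → r ≠ j → r ≠ k → (μ i - μ j) / (l i - l j) + (μ k - μ r) / (l k - l r) -
      ((μ i - μ r) / (l i - l r) + (μ k - μ j) / (l k - l j)) = 0) :
    ∃ A B C : ℂ, ∀ r, μ r = A + B * l r + C * l r ^ 2 := by
  have h1 := sub_ne_zero.mpr (hl.ne hij)
  have h2 := sub_ne_zero.mpr (hl.ne hjk)
  have h3 := sub_ne_zero.mpr (hl.ne hik)
  have h2' := sub_ne_zero.mpr (hl.ne hjk.symm)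
  -- Newton's form of the interpolation polynomial at the three points
  set D := (μ i - μ j) / (l i - l j) with hD
  set C := ((μ k - μ j) / (l k - l j) - D) / (l k - l i) with hC
  have h3' := sub_ne_zero.mpr (hl.ne hik.symm)
  have ej : μ j = μ i + D * (l j - l i) := by rw [hD]; field_simp; ring
  have ek : μ k = μ i + D * (l k - l i) + C * (l k - l i) * (l k - l j) := by
    rw [hC]
    field_simp
    rw [ej]
    ring
  refine ⟨μ i - D * l i + C * l i * l j, D - C * (l i + l j), C, fun r => ?_⟩
  by_cases hri : r = i
  · rw [hri]; ring
  by_cases hrj : r = j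
  · rw [hrj]; linear_combination ej
  by_cases hrk : r = k
  · rw [hrk]; linear_combination ek
  have h := hμ r hri hrj hrk
  have h4 := sub_ne_zero.mpr (hl.ne (Ne.symm hri))
  have h5 := sub_ne_zero.mpr (hl.ne (Ne.symm hrk))
  have hdk : (μ k - μ j) / (l k - l j) = D + C * (l k - l i) := by
    rw [hC]; field_simp; ring
  rw [hdk] at h
  clear_value C D
  field_simp at h
  have h6 : (l k - l i) * (μ r - (μ i - D * l i + C * l i * l j + (D - C * (l i + l j)) * l r +
      C * l r ^ 2)) = 0 := by
    rw [ek] at h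
    linear_combination h
  exact sub_eq_zero.mp ((mul_eq_zero.mp h6).resolve_left h3')

theorem hasLogDerivAt_sub (hl : Function.Injective l) (μ : Fin n → ℂ) {i j : Fin n} (hij : i ≠ j) :
    HasLogDerivAt (fun t => (l + t • μ) i - (l + t • μ) j) ((μ i - μ j) / (l i - l j)) 0 := by
  have h0 := sub_ne_zero.mpr (hl.ne hij)
  have h : ∀ m : Fin n, HasDerivAt (fun t : ℂ => (l + t • μ) m) (μ m) 0 := fun m => by
    simpa using ((hasDerivAt_id (0 : ℂ)).mul_const (μ m)).const_add (l m)
  refine ((h i).fun_sub (h j)).congr_deriv ?_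
  simp only [zero_smul, add_zero]
  field_simp

theorem hasLogDerivAt_crossRatio (hl : Function.Injective l) (μ : Fin n → ℂ) {i j k r : Fin n}
    (hij : i ≠ j) (hkr : k ≠ r) (hir : i ≠ r) (hkj : k ≠ j) :
    HasLogDerivAt (fun t => crossRatio (l + t • μ) i j k r) ((μ i - μ j) / (l i - l j) +
      (μ k - μ r) / (l k - l r) - ((μ i - μ r) / (l i - l r) + (μ k - μ j) / (l k - l j))) 0 := by
  refine HasLogDerivAt.div ((hasLogDerivAt_sub hl μ hij).mul (hasLogDerivAt_sub hl μ hkr))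
    ((hasLogDerivAt_sub hl μ hir).mul (hasLogDerivAt_sub hl μ hkj)) ?_
  simp only [zero_smul, add_zero]
  exact mul_ne_zero (sub_ne_zero.mpr (hl.ne hir)) (sub_ne_zero.mpr (hl.ne hkj))

theorem hasDerivAt_line (l μ : Fin n → ℂ) : HasDerivAt (fun t : ℂ => l + t • μ) μ 0 := by
  simpa using ((hasDerivAt_id (0 : ℂ)).smul_const μ).const_add l

theorem tendsto_line (l μ : Fin n → ℂ) :
    Filter.Tendsto (fun t : ℂ => l + t • μ) (𝓝 0) (𝓝 l) := by
  have := (hasDerivAt_line l μ).continuousAt.tendsto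
  simpa using this

/-- If a function on `X` is a holomorphic function `G` of the roots and its differential vanishes
on a tangent vector, then the logarithmic derivative of `G` along the corresponding
motion of the roots vanishes. -/
theorem logDeriv_eq_zero (hτ : Function.Injective τ) (h : RootDatum b τ x.rep l)
    {g : ℙ ℂ (Fin (n + 3) → ℂ) → ℂ} {G : (Fin n → ℂ) → ℂ} (hG : DifferentiableAt ℂ G l)
    (hG0 : G l ≠ 0)
    (hg : ∀ᶠ m in 𝓝 l, ∀ y : ℙ ℂ (Fin (n + 3) → ℂ), RootDatum b τ y.rep m → g y = G m)
    {μ : Fin n → ℂ} {d : ℂ} (hd : HasLogDerivAt (fun t => G (l + t • μ)) d 0) {c : ℂ}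
    (hker : fderivWithin ℂ (coneFun g) (cone (diagPencil b τ 1)) x.rep
      (c • x.rep + ∑ k, (-μ k / 2) • RootDatum.eigenvector b τ x.rep l k) = 0) : d = 0 := by
  rw [fderivWithin_coneFun hτ h (differentiableWithinAt_coneFun hτ h hG hg) (hasDerivAt_line l μ)
    (by simp) hd ((tendsto_line l μ).eventually hg) c] at hker
  simpa [hG0] using hker

theorem crossRatio_ne_zero (hl : Function.Injective l) {i j k r : Fin n}
    (hij : i ≠ j) (hkr : k ≠ r) (hir : i ≠ r) (hkj : k ≠ j) : crossRatio l i j k r ≠ 0 :=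
  div_ne_zero (mul_ne_zero (sub_ne_zero.mpr (hl.ne hij)) (sub_ne_zero.mpr (hl.ne hkr)))
    (mul_ne_zero (sub_ne_zero.mpr (hl.ne hir)) (sub_ne_zero.mpr (hl.ne hkj)))

/-- A tangent vector that is killed by the differentials of all cross ratios is given by a
polynomial of degree two. -/
theorem exists_quadratic_of_kernel (hn : 3 ≤ n) (hτ : Function.Injective τ)
    (h : RootDatum b τ x.rep l) (ha : Asym l) {μ : Fin n → ℂ} {c : ℂ}
    (hker : ∀ f ∈ holGerms n (pencilClass n (stdSys l (sqLength τ l))),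
      fderivWithin ℂ (coneFun (f ∘ moduliMap (diagPencil b τ 1))) (cone (diagPencil b τ 1)) x.rep
      (c • x.rep + ∑ k, (-μ k / 2) • RootDatum.eigenvector b τ x.rep l k) = 0) :
    ∃ A B C : ℂ, ∀ r, μ r = A + B * l r + C * l r ^ 2 := by
  have hl := h.injective
  have h01 : (⟨0, by omega⟩ : Fin n) ≠ ⟨1, by omega⟩ := by simp
  have h12 : (⟨1, by omega⟩ : Fin n) ≠ ⟨2, by omega⟩ := by simp
  have h02 : (⟨0, by omega⟩ : Fin n) ≠ ⟨2, by omega⟩ := by simp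
  refine exists_quadratic_of_crossRatio hl h01 h12 h02 fun r hr0 hr1 hr2 => ?_
  obtain ⟨f, hf, hfe⟩ := exists_crossRatio_germ (by omega) hl ha
    (sqLength_ne_zero hl h.ne) hr0.symm h12.symm
  refine logDeriv_eq_zero hτ h (differentiableAt_crossRatio hl hr0.symm h12.symm)
    (crossRatio_ne_zero hl h01 hr2.symm hr0.symm h12.symm) ?_
    (hasLogDerivAt_crossRatio hl μ h01 hr2.symm hr0.symm h12.symm) (hker f hf)
  have hc : Filter.Tendsto (fun m => (m, sqLength τ m)) (𝓝 l) (𝓝 (l, sqLength τ l)) :=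
    (continuousAt_id.prodMk (differentiableAt_sqLength h.ne).continuousAt)
  filter_upwards [hc.eventually hfe] with m hm y hy
  rw [Function.comp_apply, moduliMap_eq (by omega) hτ hy, hm]

/-- The differential of the moduli map vanishes on the tangent vectors that are given by
polynomials of degree two, the velocities of the projective motions of the line. -/
theorem fderivWithin_moduliMap_eq_zero (hn : 0 < n) (hτ : Function.Injective τ)
    (h : RootDatum b τ x.rep l) (f : Set (QuadSys n) → ℂ) (A B C : ℂ) :
    fderivWithin ℂ (coneFun (f ∘ moduliMap (diagPencil b τ 1))) (cone (diagPencil b τ 1)) x.rep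
      (∑ k, (-(A + B * l k + C * l k ^ 2) / 2) • RootDatum.eigenvector b τ x.rep l k) = 0 := by
  by_cases hd : DifferentiableWithinAt ℂ (coneFun (f ∘ moduliMap (diagPencil b τ 1)))
    (cone (diagPencil b τ 1)) x.rep
  swap
  · rw [fderivWithin_zero_of_not_differentiableWithinAt hd]
    rfl
  let L : ℂ → Fin n → ℂ := fun t k => (l k + t * (A + B * l k)) / (1 - t * C * l k)
  have hL : HasDerivAt L (fun k => A + B * l k + C * l k ^ 2) 0 := by
    rw [hasDerivAt_pi]
    intro k
    have h1 : HasDerivAt (fun t : ℂ => l k + t * (A + B * l k)) (A + B * l k) 0 := by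
      simpa using ((hasDerivAt_id (0 : ℂ)).mul_const (A + B * l k)).const_add (l k)
    have h2 : HasDerivAt (fun t : ℂ => 1 - t * C * l k) (-(C * l k)) 0 := by
      simpa [mul_assoc] using ((hasDerivAt_id (0 : ℂ)).mul_const (C * l k)).const_sub 1
    refine (h1.fun_div h2 (by simp)).congr_deriv ?_
    simp
    ring
  have hL0 : L 0 = l := by funext k; simp [L]
  have hLt : Filter.Tendsto L (𝓝 0) (𝓝 l) := by
    have := hL.continuousAt.tendsto
    rwa [hL0] at this
  have key := fderivWithin_coneFun hτ h hd hL hL0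
    (hasDerivAt_const (0 : ℂ) (f (pencilClass n (stdSys l (sqLength τ l))))) ?_ 0
  · simpa using key
  have hden : ∀ᶠ t in 𝓝 (0 : ℂ), ∀ k, -t * C * l k + 1 ≠ 0 := by
    rw [Filter.eventually_all]
    intro k
    have hc : ContinuousAt (fun t : ℂ => -t * C * l k + 1) 0 := by fun_prop
    exact hc.eventually_ne (by simp)
  have hdet : ∀ᶠ t in 𝓝 (0 : ℂ), (1 + t * B) * 1 - t * A * (-t * C) ≠ 0 := by
    have hc : ContinuousAt (fun t : ℂ => (1 + t * B) * 1 - t * A * (-t * C)) 0 := by fun_prop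
    exact hc.eventually_ne (by simp)
  filter_upwards [hden, hdet] with t h1 h2 y hy
  rw [Function.comp_apply, moduliMap_eq hn hτ hy]
  congr 1
  refine pencilClass_stdSys_eq_of_moebius (sqLength_ne_zero h.injective h.ne)
    (sqLength_ne_zero hy.injective hy.ne) h2 h1 fun k => ?_
  have h3 : 1 - t * C * l k ≠ 0 := by
    have := h1 k
    contrapose! this
    linear_combination this
  rw [show -t * C * l k + 1 = 1 - t * C * l k by ring, div_mul_cancel₀ _ h3]
  ring

theorem mem_kerDifferential {M : Type*} {germs : M → Set (M → ℂ)}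
    {f : ℙ ℂ (Fin (n + 3) → ℂ) → M} {Φ : QuadSys (n + 3)} {w : TangentAt Φ x} :
    w ∈ kerDifferential Φ germs f x ↔ ∃ u : affineTangent Φ x.rep,
      (∀ h ∈ germs (f x), fderivWithin ℂ (coneFun (h ∘ f)) (cone Φ) x.rep u = 0) ∧
        toTangent Φ x u = w := by
  simp only [kerDifferential, Submodule.mem_map, Submodule.mem_iInf, LinearMap.mem_ker]
  rfl

/-- The vectors `(1)`, `(lₖ)`, `(lₖ²)`. In the basis of eigenvectors they span the kernel of the
differential of the moduli map. -/
def quadFrame (l : Fin n → ℂ) (j : Fin 3) (k : Fin n) : ℂ := l k ^ (j : ℕ)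

theorem linearIndependent_quadFrame (hn : 3 ≤ n) (hl : Function.Injective l) :
    LinearIndependent ℂ (quadFrame l) := by
  rw [Fintype.linearIndependent_iff]
  intro c hc
  have h : ∀ k, c 0 + c 1 * l k + c 2 * l k ^ 2 = 0 := by
    intro k
    have := congrFun hc k
    simpa [Fin.sum_univ_three, quadFrame] using this
  have h01 : (⟨0, by omega⟩ : Fin n) ≠ ⟨1, by omega⟩ := by simp
  have h12 : (⟨1, by omega⟩ : Fin n) ≠ ⟨2, by omega⟩ := by simp
  have h02 : (⟨0, by omega⟩ : Fin n) ≠ ⟨2, by omega⟩ := by simp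
  obtain ⟨h0, h1, h2⟩ := quadratic_eq_zero (hl.ne h01) (hl.ne h12) (hl.ne h02) (h _) (h _) (h _)
  intro j
  fin_cases j <;> assumption

theorem kerModuliMap_eq (hn : 3 ≤ n) (hτ : Function.Injective τ) (h : RootDatum b τ x.rep l)
    (ha : Asym l) {e : Module.Basis (Fin n) ℂ (TangentAt (diagPencil b τ 1) x)}
    (he : ∀ k, e k = toTangent _ x ⟨RootDatum.eigenvector b τ x.rep l k, h.eigenvector_mem hτ k⟩)
    (hdec : ∀ u : affineTangent (diagPencil b τ 1) x.rep, ∃ c : ℂ, (u : Fin (n + 3) → ℂ) =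
        c • x.rep + ∑ k, e.repr (toTangent _ x u) k • RootDatum.eigenvector b τ x.rep l k) :
    kerModuliMap (diagPencil b τ 1) x =
      (Submodule.span ℂ (Set.range (quadFrame l))).comap (e.equivFun : _ →ₗ[ℂ] (Fin n → ℂ)) := by
  have hm := moduliMap_eq (by omega) hτ h
  ext w
  rw [kerModuliMap, mem_kerDifferential, Submodule.mem_comap, Submodule.mem_span_range_iff_exists_fun]
  constructor
  · rintro ⟨u, hu, rfl⟩
    obtain ⟨c, hc⟩ := hdec u
    have hμ : ∀ k, e.repr (toTangent _ x u) k = -(-2 * e.repr (toTangent _ x u) k) / 2 :=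
      fun k => by ring
    rw [hm] at hu
    obtain ⟨A, B, C, hABC⟩ := exists_quadratic_of_kernel hn hτ h ha
      (μ := fun k => -2 * e.repr (toTangent _ x u) k) (c := c) (fun f hf => by
        have := hu f hf
        rw [hc] at this
        simpa only [← hμ] using this)
    refine ⟨![-A / 2, -B / 2, -C / 2], ?_⟩
    funext k
    have := hABC k
    simp [Fin.sum_univ_three, quadFrame]
    linear_combination this / 2
  · rintro ⟨c, hc⟩
    let u : affineTangent (diagPencil b τ 1) x.rep :=
      ∑ k, (e.equivFun w k) • ⟨RootDatum.eigenvector b τ x.rep l k, h.eigenvector_mem hτ k⟩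
    refine ⟨u, fun f _ => ?_, ?_⟩
    · have hu : (u : Fin (n + 3) → ℂ) = ∑ k, (-(-2 * c 0 + -2 * c 1 * l k + -2 * c 2 * l k ^ 2) / 2) •
          RootDatum.eigenvector b τ x.rep l k := by
        simp only [u, AddSubmonoidClass.coe_finsetSum, Submodule.coe_smul]
        refine Finset.sum_congr rfl fun k _ => ?_
        congr 1
        have := congrFun hc k
        rw [LinearEquiv.coe_coe] at this
        rw [← this]
        simp [Fin.sum_univ_three, quadFrame]
        ring
      rw [hu]
      exact fderivWithin_moduliMap_eq_zero (by omega) hτ h f _ _ _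
    · simp only [u, map_sum, map_smul, ← he]
      exact e.sum_equivFun w

theorem refinedModuliMap_eq (hn : 3 ≤ n) (hτ : Function.Injective τ) (h : RootDatum b τ x.rep l)
    (ha : Asym l) : refinedModuliMap (diagPencil b τ 1) x =
      pairClass n (stdSys l (sqLength τ l)) (Submodule.span ℂ (Set.range (quadFrame l))) := by
  obtain ⟨e, he1, he2, he⟩ := exists_tangentBasis (by omega) hτ h
  rw [refinedModuliMap, kerModuliMap_eq hn hτ h ha he1 he2, secondFundamentalForm_eq hτ h e he,
    pairClass_congr e.equivFun.symm (stdSys_eq_image e l _) rfl, stdSys_beta hτ h]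
  congr 1
  ext v
  simp only [Submodule.mem_comap, LinearEquiv.coe_coe, LinearEquiv.apply_symm_apply]

end Kernel

/-! ### The kernel of the differential of the refined moduli map -/

section Refined
variable {n : ℕ} {b : Module.Basis (Fin (n + 3)) ℂ (Fin (n + 3) → ℂ)} {τ : Fin (n + 3) → ℂ}
  {x : ℙ ℂ (Fin (n + 3) → ℂ)} {l : Fin n → ℂ}

theorem pairInvariant_quadFrame (s : Fin 3 → Fin n) (l β : Fin n → ℂ) :
    pairInvariant s (l, β, quadFrame l) =
      vand l s ^ 5 * (β (s 0) * β (s 1) * β (s 2)) ^ 2 := by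
  simp only [pairInvariant, plucker, vand, quadFrame, Matrix.det_fin_three, Matrix.of_apply,
    Fin.val_zero, Fin.val_one, Fin.val_two]
  ring

theorem vand_ne_zero (hl : Function.Injective l) {s : Fin 3 → Fin n} (hs : Function.Injective s) :
    vand l s ≠ 0 := by
  have h := hl.comp hs
  exact mul_ne_zero (mul_ne_zero (sub_ne_zero.mpr (h.ne (by decide)))
    (sub_ne_zero.mpr (h.ne (by decide)))) (sub_ne_zero.mpr (h.ne (by decide)))

theorem pairInvariant_ne_zero (hl : Function.Injective l) (hne : ∀ i k, τ i ≠ l k)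
    {s : Fin 3 → Fin n} (hs : Function.Injective s) :
    pairInvariant s (l, sqLength τ l, quadFrame l) ≠ 0 := by
  have h := sqLength_ne_zero hl hne
  rw [pairInvariant_quadFrame]
  exact mul_ne_zero (pow_ne_zero 5 (vand_ne_zero hl hs))
    (pow_ne_zero 2 (mul_ne_zero (mul_ne_zero (h _) (h _)) (h _)))

theorem quadratic_slope (hl : Function.Injective l) {μ : Fin n → ℂ} {A B C : ℂ}
    (hμ : ∀ r, μ r = A + B * l r + C * l r ^ 2) {i j : Fin n} (hij : i ≠ j) :
    (μ i - μ j) / (l i - l j) = B + C * (l i + l j) := by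
  have := sub_ne_zero.mpr (hl.ne hij)
  rw [hμ, hμ, div_eq_iff this]
  ring

theorem hasLogDerivAt_sqLength (hl : Function.Injective l) (hne : ∀ i k, τ i ≠ l k)
    {μ : Fin n → ℂ} {A B C : ℂ} (hμ : ∀ r, μ r = A + B * l r + C * l r ^ 2) (k : Fin n) :
    HasLogDerivAt (fun t => sqLength τ (l + t • μ) k)
      ((n - 1) * B + C * ∑ j, l j + (n - 2) * C * l k - μ k * ∑ i, (l k - τ i)⁻¹) 0 := by
  have h1 : HasLogDerivAt
      (fun t => ∏ j ∈ Finset.univ.erase k, ((l + t • μ) k - (l + t • μ) j))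
      (∑ j ∈ Finset.univ.erase k, (B + C * (l k + l j))) 0 := by
    refine HasLogDerivAt.prod _ fun j hj => ?_
    rw [← quadratic_slope hl hμ (Finset.ne_of_mem_erase hj).symm]
    exact hasLogDerivAt_sub hl μ (Finset.ne_of_mem_erase hj).symm
  have h2 : HasLogDerivAt (fun t => ∏ i, ((l + t • μ) k - τ i)) (∑ i, μ k * (l k - τ i)⁻¹) 0 := by
    refine HasLogDerivAt.prod _ fun i _ => ?_
    have h0 := sub_ne_zero.mpr (hne i k).symm
    have h3 : HasDerivAt (fun t : ℂ => (l + t • μ) k) (μ k) 0 :=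
      hasDerivAt_pi.mp (hasDerivAt_line l μ) k
    refine (h3.sub_const (τ i)).congr_deriv ?_
    simp only [zero_smul, add_zero]
    field_simp
  have h3 : HasLogDerivAt (fun _ => (-1 : ℂ)) 0 0 := HasLogDerivAt.const (-1)
  have h4 := (h3.mul h1).div h2 (by
    simp only [zero_smul, add_zero]
    exact Finset.prod_ne_zero_iff.mpr fun i _ => sub_ne_zero.mpr (hne i k).symm)
  convert h4 using 1
  · funext t
    rw [sqLength, neg_one_mul]
  · rw [Finset.sum_erase_eq_sub (Finset.mem_univ k), ← Finset.mul_sum]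
    simp only [mul_add, Finset.sum_add_distrib, ← Finset.mul_sum, Finset.sum_const,
      Finset.card_univ, Fintype.card_fin, nsmul_eq_mul]
    ring

theorem hasLogDerivAt_vand (hl : Function.Injective l) {μ : Fin n → ℂ} {A B C : ℂ}
    (hμ : ∀ r, μ r = A + B * l r + C * l r ^ 2) {s : Fin 3 → Fin n} (hs : Function.Injective s) :
    HasLogDerivAt (fun t => vand (l + t • μ) s)
      (3 * B + 2 * C * (l (s 0) + l (s 1) + l (s 2))) 0 := by
  have h : ∀ p q : Fin 3, p ≠ q → HasLogDerivAt
      (fun t => (l + t • μ) (s p) - (l + t • μ) (s q)) (B + C * (l (s p) + l (s q))) 0 := by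
    intro p q hpq
    rw [← quadratic_slope hl hμ (hs.ne hpq)]
    exact hasLogDerivAt_sub hl μ (hs.ne hpq)
  have h1 := ((h 0 1 (by decide)).mul (h 1 2 (by decide))).mul (h 0 2 (by decide))
  have hsum : 3 * B + 2 * C * (l (s 0) + l (s 1) + l (s 2)) =
      B + C * (l (s 0) + l (s 1)) + (B + C * (l (s 1) + l (s 2))) +
        (B + C * (l (s 0) + l (s 2))) := by ring
  rw [hsum]
  exact h1

/-- The contribution of the `k`-th root to the logarithmic derivatives of the
functions `pairInvariant` along a quadratic motion of the roots. -/
def rootRate (τ : Fin (n + 3) → ℂ) (l μ : Fin n → ℂ) (C : ℂ) (k : Fin n) : ℂ :=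
  (n + 3) * C * l k - μ k * ∑ i, (l k - τ i)⁻¹

theorem hasLogDerivAt_pairInvariant (hl : Function.Injective l) (hne : ∀ i k, τ i ≠ l k)
    {μ : Fin n → ℂ} {A B C : ℂ} (hμ : ∀ r, μ r = A + B * l r + C * l r ^ 2)
    {s : Fin 3 → Fin n} (hs : Function.Injective s) :
    HasLogDerivAt
      (fun t => pairInvariant s (l + t • μ, sqLength τ (l + t • μ), quadFrame (l + t • μ)))
      (15 * B + 6 * ((n - 1) * B + C * ∑ j, l j) + 2 * (rootRate τ l μ C (s 0) +
        rootRate τ l μ C (s 1) + rootRate τ l μ C (s 2))) 0 := by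
  have hβ := fun k => hasLogDerivAt_sqLength hl hne hμ k
  simp only [pairInvariant_quadFrame]
  have h1 := ((hasLogDerivAt_vand hl hμ hs).pow 5).mul
    ((((hβ (s 0)).mul (hβ (s 1))).mul (hβ (s 2))).pow 2)
  convert h1 using 1
  simp only [rootRate]
  push_cast
  ring

/-- The nonvanishing of the determinant of this matrix says that no nonzero quadratic motion of the
roots gives the same `rootRate` to the first four of them. -/
def rateMatrix (τ : Fin (n + 3) → ℂ) (y : Fin 4 → ℂ) : Matrix (Fin 4) (Fin 4) ℂ :=
  Matrix.of fun k =>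
    let g := Lagrange.nodal Finset.univ τ
    ![g.derivative.eval (y k), y k * g.derivative.eval (y k),
      (n + 3) * y k * g.eval (y k) - y k ^ 2 * g.derivative.eval (y k), g.eval (y k)]

theorem eval_derivative_nodal {z : ℂ} (hz : ∀ i, z ≠ τ i) :
    (Lagrange.nodal Finset.univ τ).derivative.eval z =
      (Lagrange.nodal Finset.univ τ).eval z * ∑ i, (z - τ i)⁻¹ := by
  rw [Lagrange.derivative_nodal, Polynomial.eval_finsetSum, Finset.mul_sum]
  refine Finset.sum_congr rfl fun i hi => ?_
  rw [Lagrange.nodal_eq_mul_nodal_erase hi, Polynomial.eval_mul]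
  have := sub_ne_zero.mpr (hz i)
  simp
  field_simp

theorem eq_zero_of_rootRate_eq (hn : 4 ≤ n) (hne : ∀ i k, τ i ≠ l k)
    (hdet : (rateMatrix τ fun k => l (Fin.castLE hn k)).det ≠ 0)
    {μ : Fin n → ℂ} {A B C : ℂ} (hμ : ∀ r, μ r = A + B * l r + C * l r ^ 2) {κ : ℂ}
    (hκ : ∀ k : Fin 4, rootRate τ l μ C (Fin.castLE hn k) = κ) : μ = 0 := by
  have hv := Matrix.eq_zero_of_mulVec_eq_zero hdet (v := ![-A, -B, C, -κ]) (by
    funext k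
    have h1 := hκ k
    have h2 := eval_derivative_nodal (τ := τ) (z := l (Fin.castLE hn k)) fun i => (hne i _).symm
    rw [rootRate, hμ] at h1
    simp only [Matrix.mulVec, dotProduct, Fin.sum_univ_four, rateMatrix, Matrix.of_apply,
      Matrix.cons_val, h2, Pi.zero_apply]
    linear_combination (Lagrange.nodal Finset.univ τ).eval (l (Fin.castLE hn k)) * h1)
  have hA : A = 0 := by simpa using congrFun hv 0
  have hB : B = 0 := by simpa using congrFun hv 1
  have hC : C = 0 := by simpa using congrFun hv 2
  funext r
  rw [hμ, hA, hB, hC]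
  simp

theorem refinedModuliMap_mem (hn : 3 ≤ n) (hl : Function.Injective l) (hne : ∀ i k, τ i ≠ l k) :
    pairClass n (stdSys l (sqLength τ l)) (Submodule.span ℂ (Set.range (quadFrame l))) ∈
      refinedModuliPQ n :=
  ⟨_, _, isNonsingularPencil_diagPencil (by omega) _ hl (sqLength_ne_zero hl hne), by
    rw [finrank_span_eq_card (linearIndependent_quadFrame hn hl), Fintype.card_fin], rfl⟩

theorem differentiableAt_quadFrame (l : Fin n → ℂ) :
    DifferentiableAt ℂ (quadFrame : (Fin n → ℂ) → Fin 3 → Fin n → ℂ) l := by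
  refine differentiableAt_pi.mpr fun j => differentiableAt_pi.mpr fun k => ?_
  unfold quadFrame
  fun_prop

/-- On a tangent vector that is killed by the differentials of all functions on the refined moduli
space, the sums of the rates over all triples of roots coincide. -/
theorem rootRate_sum_eq (hn : 3 ≤ n) (hτ : Function.Injective τ)
    (h : RootDatum b τ x.rep l) (ha : Asym l) {μ : Fin n → ℂ} {c : ℂ}
    (hker : ∀ f ∈ refinedHolGerms n (refinedModuliMap (diagPencil b τ 1) x),
      fderivWithin ℂ (coneFun (f ∘ refinedModuliMap (diagPencil b τ 1)))
        (cone (diagPencil b τ 1)) x.rep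
        (c • x.rep + ∑ k, (-μ k / 2) • RootDatum.eigenvector b τ x.rep l k) = 0)
    {A B C : ℂ} (hμ : ∀ r, μ r = A + B * l r + C * l r ^ 2)
    {s s' : Fin 3 → Fin n} (hs : Function.Injective s) (hs' : Function.Injective s') :
    rootRate τ l μ C (s 0) + rootRate τ l μ C (s 1) + rootRate τ l μ C (s 2) =
      rootRate τ l μ C (s' 0) + rootRate τ l μ C (s' 1) + rootRate τ l μ C (s' 2) := by
  have hl := h.injective
  have hβ := sqLength_ne_zero hl h.ne
  have hs0 := pairInvariant_ne_zero hl h.ne hs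
  have hs0' := pairInvariant_ne_zero hl h.ne hs'
  obtain ⟨f, hf, hfe⟩ := exists_pairInvariant_germ (by omega) hl ha hβ
    (linearIndependent_quadFrame hn hl) s s' hs0'
  rw [refinedModuliMap_eq hn hτ h ha] at hker
  let Y : (Fin n → ℂ) → (Fin n → ℂ) × (Fin n → ℂ) × (Fin 3 → Fin n → ℂ) :=
    fun m => (m, sqLength τ m, quadFrame m)
  have hY : DifferentiableAt ℂ Y l := differentiableAt_id.prodMk
    ((differentiableAt_sqLength h.ne).prodMk (differentiableAt_quadFrame l))
  have hYd : ∀ r, DifferentiableAt ℂ (fun m => pairInvariant r (Y m)) l := fun r =>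
    DifferentiableAt.comp l (differentiable_pairInvariant r _) hY
  have hd := logDeriv_eq_zero hτ h (G := fun m => pairInvariant s (Y m) / pairInvariant s' (Y m))
    (by
      simp only [div_eq_mul_inv]
      exact (hYd s).fun_mul ((hYd s').fun_inv hs0'))
    (div_ne_zero hs0 hs0') ?_
    ((hasLogDerivAt_pairInvariant hl h.ne hμ hs).div (hasLogDerivAt_pairInvariant hl h.ne hμ hs')
      (by simpa using hs0')) (hker f hf)
  · linear_combination hd / 2
  · filter_upwards [hY.continuousAt.eventually hfe, eventually_asym_self ha] with m hm hm' y hy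
    rw [Function.comp_apply, refinedModuliMap_eq hn hτ hy hm']
    exact hm

/-- The differential of the refined moduli map is injective at the points of `X` whose roots
satisfy the nondegeneracy condition on `rateMatrix`. -/
theorem kerDifferential_refinedModuliMap_eq_bot (hn : 4 ≤ n) (hτ : Function.Injective τ)
    (h : RootDatum b τ x.rep l) (ha : Asym l)
    (hdet : (rateMatrix τ fun k => l (Fin.castLE hn k)).det ≠ 0) :
    kerDifferential (diagPencil b τ 1) (refinedHolGerms n)
      (refinedModuliMap (diagPencil b τ 1)) x = ⊥ := by
  have hl := h.injective
  have hn3 : 3 ≤ n := by omega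
  obtain ⟨e, -, hdec, -⟩ := exists_tangentBasis (by omega) hτ h
  rw [eq_bot_iff]
  rintro w hw
  obtain ⟨u, hu, rfl⟩ := mem_kerDifferential.mp hw
  obtain ⟨c, hc⟩ := hdec u
  set μ : Fin n → ℂ := fun k => -2 * e.repr (toTangent _ x u) k with hμdef
  have hc' : (u : Fin (n + 3) → ℂ) =
      c • x.rep + ∑ k, (-μ k / 2) • RootDatum.eigenvector b τ x.rep l k := by
    rw [hc]
    congr 1
    refine Finset.sum_congr rfl fun k _ => ?_
    congr 1
    simp only [hμdef]
    ring
  rw [hc'] at hu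
  obtain ⟨A, B, C, hμ⟩ := exists_quadratic_of_kernel hn3 hτ h ha (c := c) (μ := μ) fun f hf => by
    have hmem := comp_image_fst_mem_refinedHolGerms (refinedModuliMap_mem hn3 hl h.ne) hf
    rw [← refinedModuliMap_eq hn3 hτ h ha] at hmem
    have hcomp : (fun m => f (Prod.fst '' m)) ∘ refinedModuliMap (diagPencil b τ 1) =
        f ∘ moduliMap (diagPencil b τ 1) := by
      funext y
      simp only [Function.comp_apply, refinedModuliMap, moduliMap]
      rw [← pencilClass_eq_image]
    rw [← hcomp]
    exact hu _ hmem
  have hcast : Function.Injective (Fin.castLE hn) := Fin.castLE_injective hn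
  have hsum : ∀ s s' : Fin 3 → Fin 4, Function.Injective s → Function.Injective s' → _ :=
    fun s s' hs hs' => rootRate_sum_eq hn3 hτ h ha hu hμ (hcast.comp hs) (hcast.comp hs')
  have h1 := hsum ![2, 3, 0] ![2, 3, 1] (by decide) (by decide)
  have h2 := hsum ![0, 3, 1] ![0, 3, 2] (by decide) (by decide)
  have h3 := hsum ![0, 1, 2] ![0, 1, 3] (by decide) (by decide)
  simp only [Function.comp_apply, Matrix.cons_val, add_right_inj] at h1 h2 h3
  have hμ0 := eq_zero_of_rootRate_eq hn h.ne hdet hμ (κ := rootRate τ l μ C (Fin.castLE hn 0))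
    fun k => by
      fin_cases k
      · rfl
      · exact h1.symm
      · exact (h1.trans h2).symm
      · exact ((h1.trans h2).trans h3).symm
  rw [Submodule.mem_bot, toTangent_eq_zero_iff, mem_submodule_iff]
  refine ⟨c, ?_⟩
  rw [hc', hμ0]
  simp

end Refined

/-! ### Generic roots -/

section Generic
variable {n : ℕ}

/-- A property of `n` complex numbers holds generically if it holds outside of a hypersurface. -/
def HoldsGenerically (P : (Fin n → ℂ) → Prop) : Prop :=
  ∃ p : MvPolynomial (Fin n) ℂ, p ≠ 0 ∧ ∀ l, MvPolynomial.eval l p ≠ 0 → P l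

namespace HoldsGenerically

theorem exists_point {P : (Fin n → ℂ) → Prop} (h : HoldsGenerically P) : ∃ l, P l := by
  obtain ⟨p, hp, hP⟩ := h
  by_contra! hne
  refine hp (MvPolynomial.funext fun l => ?_)
  rw [map_zero]
  by_contra h0
  exact hne l (hP l h0)

theorem and {P Q : (Fin n → ℂ) → Prop} (hP : HoldsGenerically P) (hQ : HoldsGenerically Q) :
    HoldsGenerically fun l => P l ∧ Q l := by
  obtain ⟨p, hp, hP⟩ := hP
  obtain ⟨q, hq, hQ⟩ := hQ
  refine ⟨p * q, mul_ne_zero hp hq, fun l hl => ?_⟩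
  rw [map_mul] at hl
  exact ⟨hP l (left_ne_zero_of_mul hl), hQ l (right_ne_zero_of_mul hl)⟩

theorem forall_of {ι : Type*} [Finite ι] {P : ι → (Fin n → ℂ) → Prop}
    (h : ∀ i, HoldsGenerically (P i)) : HoldsGenerically fun l => ∀ i, P i l := by
  have := Fintype.ofFinite ι
  choose p hp hP using h
  refine ⟨∏ i, p i, Finset.prod_ne_zero_iff.mpr fun i _ => hp i, fun l hl i => hP i l ?_⟩
  rw [map_prod] at hl
  exact Finset.prod_ne_zero_iff.mp hl i (Finset.mem_univ i)

theorem of_imp {p : Prop} {P : (Fin n → ℂ) → Prop} (h : p → HoldsGenerically P) :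
    HoldsGenerically fun l => p → P l := by
  by_cases hp : p
  · obtain ⟨q, hq, hP⟩ := h hp
    exact ⟨q, hq, fun l hl _ => hP l hl⟩
  · exact ⟨1, one_ne_zero, fun _ _ h => absurd h hp⟩

theorem of_eval {P : (Fin n → ℂ) → Prop} (p : MvPolynomial (Fin n) ℂ) (l₀ : Fin n → ℂ)
    (h₀ : MvPolynomial.eval l₀ p ≠ 0) (h : ∀ l, MvPolynomial.eval l p ≠ 0 → P l) :
    HoldsGenerically P :=
  ⟨p, fun h1 => h₀ (by rw [h1, map_zero]), h⟩

end HoldsGenerically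

open MvPolynomial in
theorem holdsGenerically_injective :
    HoldsGenerically fun l : Fin n → ℂ => ∀ i j, i ≠ j → l i ≠ l j := by
  refine .forall_of fun i => .forall_of fun j => .of_imp fun hij => ?_
  refine .of_eval (X i - X j) (Pi.single i 1) ?_ fun l hl => ?_
  · simp [hij.symm]
  · simpa [sub_eq_zero] using hl

open MvPolynomial in
theorem holdsGenerically_ne (k : Fin n) (c : ℂ) : HoldsGenerically fun l => c ≠ l k := by
  refine .of_eval (X k - C c) (fun _ => c + 1) ?_ fun l hl => ?_
  · simp
  · rw [map_sub, eval_X, eval_C, sub_ne_zero] at hl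
    exact hl.symm

/-- At least five generic points of the line have no projective symmetry. A permutation that moves
`i` changes a cross ratio of `i` and three other points different from its image. -/
theorem holdsGenerically_asym (hn : 5 ≤ n) : HoldsGenerically fun l : Fin n → ℂ => Asym l := by
  have hσ : ∀ σ : Equiv.Perm (Fin n), σ ≠ 1 →
      HoldsGenerically fun l : Fin n → ℂ => ¬ CrossEq l (l ∘ σ) := by
    intro σ hσ
    obtain ⟨i, hi⟩ : ∃ i, σ i ≠ i := by
      by_contra! h
      exact hσ (Equiv.ext h)
    have hcard : 3 ≤ (Finset.univ \ {i, σ i} : Finset (Fin n)).card := by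
      have h1 := Finset.le_card_sdiff {i, σ i} (Finset.univ : Finset (Fin n))
      rw [Finset.card_pair hi.symm, Finset.card_univ, Fintype.card_fin] at h1
      omega
    obtain ⟨t, ht, htc⟩ := Finset.exists_subset_card_eq hcard
    obtain ⟨j, k, r, hjk, hjr, hkr, rfl⟩ := Finset.card_eq_three.mp htc
    have hmem : ∀ m ∈ ({j, k, r} : Finset (Fin n)), m ≠ i ∧ m ≠ σ i := fun m hm => by
      simpa using ht hm
    obtain ⟨hji, hjσ⟩ := hmem j (by simp)
    obtain ⟨hki, hkσ⟩ := hmem k (by simp)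
    obtain ⟨hri, hrσ⟩ := hmem r (by simp)
    let l₀ : Fin n → ℂ := fun m => if m = σ i then ((σ j : ℕ) : ℂ) else ((m : ℕ) : ℂ)
    have hl₀ : ∀ m, m ≠ σ i → l₀ m = ((m : ℕ) : ℂ) := fun m hm => if_neg hm
    have hcast : ∀ m m' : Fin n, m ≠ m' → ((m : ℕ) : ℂ) - ((m' : ℕ) : ℂ) ≠ 0 := fun m m' h =>
      sub_ne_zero.mpr fun h' => h (Fin.ext (Nat.cast_injective h'))
    have e1 : l₀ (σ i) = ((σ j : ℕ) : ℂ) := if_pos rfl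
    have hinj := σ.injective
    let p : MvPolynomial (Fin n) ℂ := (.X i - .X j) * (.X k - .X r) *
        ((.X (σ i) - .X (σ r)) * (.X (σ k) - .X (σ j))) -
      (.X (σ i) - .X (σ j)) * (.X (σ k) - .X (σ r)) * ((.X i - .X r) * (.X k - .X j))
    refine .of_eval p l₀ ?_ fun l hl hc => hl ?_
    · simp only [p, map_sub, map_mul, MvPolynomial.eval_X]
      rw [e1, hl₀ (σ j) (hinj.ne hji), hl₀ (σ r) (hinj.ne hri), hl₀ (σ k) (hinj.ne hki),
        hl₀ i hi.symm, hl₀ j hjσ, hl₀ k hkσ, hl₀ r hrσ, sub_self, zero_mul, zero_mul, sub_zero]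
      exact mul_ne_zero (mul_ne_zero (hcast _ _ hji.symm) (hcast _ _ hkr))
        (mul_ne_zero (hcast _ _ (hinj.ne hjr)) (hcast _ _ (hinj.ne hjk.symm)))
    · simp only [p, map_sub, map_mul, MvPolynomial.eval_X]
      exact sub_eq_zero.mpr (hc i j k r)
  obtain ⟨p, hp, hP⟩ := HoldsGenerically.forall_of fun σ => HoldsGenerically.of_imp (hσ σ)
  exact ⟨p, hp, fun l hl σ h => by_contra fun h1 => hP l hl σ h1 h⟩

/-- The matrix `rateMatrix` is invertible if three of the points are roots of its polynomial and the
fourth is not. -/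
theorem exists_det_rateMatrix_ne_zero {τ : Fin (n + 3) → ℂ} (hτ : Function.Injective τ) :
    ∃ y, (rateMatrix τ y).det ≠ 0 := by
  obtain ⟨z, hz⟩ := Infinite.exists_notMem_finset (Finset.univ.image τ)
  have hz' : ∀ i, z ≠ τ i := fun i h => hz (by rw [h]; simp)
  refine ⟨![τ 0, τ 1, τ 2, z], fun h => ?_⟩
  obtain ⟨v, hv0, hv⟩ := Matrix.exists_mulVec_eq_zero_iff.mpr h
  have hd : ∀ i, (Lagrange.nodal Finset.univ τ).derivative.eval (τ i) ≠ 0 := by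
    intro i
    rw [Lagrange.eval_nodal_derivative_eval_node_eq (Finset.mem_univ i), Lagrange.eval_nodal]
    exact Finset.prod_ne_zero_iff.mpr fun j hj =>
      sub_ne_zero.mpr (hτ.ne (Finset.ne_of_mem_erase hj).symm)
  have hg : ∀ i, (Lagrange.nodal Finset.univ τ).eval (τ i) = 0 := fun i =>
    Lagrange.eval_nodal_at_node (Finset.mem_univ i)
  have hrow : ∀ i : Fin (n + 3),
      (Lagrange.nodal Finset.univ τ).derivative.eval (τ i) * v 0 +
        τ i * (Lagrange.nodal Finset.univ τ).derivative.eval (τ i) * v 1 +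
        ((n + 3) * τ i * (Lagrange.nodal Finset.univ τ).eval (τ i) -
          τ i ^ 2 * (Lagrange.nodal Finset.univ τ).derivative.eval (τ i)) * v 2 +
        (Lagrange.nodal Finset.univ τ).eval (τ i) * v 3 = 0 →
      v 0 + v 1 * τ i + -v 2 * τ i ^ 2 = 0 := by
    intro i hi
    rw [hg] at hi
    refine (mul_eq_zero.mp ?_).resolve_left (hd i)
    linear_combination hi
  have hk := fun k => congrFun hv k
  simp only [Matrix.mulVec, dotProduct, Fin.sum_univ_four, rateMatrix, Matrix.of_apply,
    Matrix.cons_val, Pi.zero_apply] at hk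
  have hmod : 2 % (n + 3) = 2 := Nat.mod_eq_of_lt (by omega)
  obtain ⟨h0, h1, h2⟩ := quadratic_eq_zero (hτ.ne (by simp)) (hτ.ne (by simp [Fin.ext_iff, hmod]))
    (hτ.ne (by simp [Fin.ext_iff, hmod])) (hrow 0 (hk 0)) (hrow 1 (hk 1)) (hrow 2 (hk 2))
  have h3 := hk 3
  simp only [Matrix.cons_val, h0, h1, neg_eq_zero.mp h2, mul_zero, zero_add] at h3
  have hgz : (Lagrange.nodal Finset.univ τ).eval z ≠ 0 := by
    rw [Lagrange.eval_nodal]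
    exact Finset.prod_ne_zero_iff.mpr fun i _ => sub_ne_zero.mpr (hz' i)
  apply hv0
  funext k
  fin_cases k
  · exact h0
  · exact h1
  · exact neg_eq_zero.mp h2
  · exact (mul_eq_zero.mp h3).resolve_left hgz

theorem holdsGenerically_det_rateMatrix (hn : 4 ≤ n) {τ : Fin (n + 3) → ℂ}
    (hτ : Function.Injective τ) :
    HoldsGenerically fun l => (rateMatrix τ fun k => l (Fin.castLE hn k)).det ≠ 0 := by
  obtain ⟨y, hy⟩ := exists_det_rateMatrix_ne_zero hτ
  let g : Polynomial ℂ := Lagrange.nodal Finset.univ τ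
  let z : Fin 4 → MvPolynomial (Fin n) ℂ := fun k => .X (Fin.castLE hn k)
  let M : Matrix (Fin 4) (Fin 4) (MvPolynomial (Fin n) ℂ) := Matrix.of fun k =>
    ![Polynomial.aeval (z k) g.derivative, z k * Polynomial.aeval (z k) g.derivative,
      (n + 3) * z k * Polynomial.aeval (z k) g - z k ^ 2 * Polynomial.aeval (z k) g.derivative,
      Polynomial.aeval (z k) g]
  have hev : ∀ (l : Fin n → ℂ) k (p : Polynomial ℂ),
      MvPolynomial.eval l (Polynomial.aeval (z k) p) = p.eval (l (Fin.castLE hn k)) := by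
    intro l k p
    rw [← MvPolynomial.coe_aeval_eq_eval, RingHom.coe_coe, ← Polynomial.aeval_algHom_apply,
      MvPolynomial.aeval_X, Polynomial.coe_aeval_eq_eval]
  have hM : ∀ l : Fin n → ℂ, MvPolynomial.eval l M.det =
      (rateMatrix τ fun k => l (Fin.castLE hn k)).det := by
    intro l
    rw [RingHom.map_det]
    congr 1
    ext k m
    rw [RingHom.mapMatrix_apply, Matrix.map_apply]
    fin_cases m <;> simp [M, rateMatrix, hev, g, z]
  refine .of_eval M.det (fun k => if h : (k : ℕ) < 4 then y ⟨k, h⟩ else 0) ?_ fun l hl => ?_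
  · rw [hM]
    simpa using hy
  · rwa [hM] at hl

end Generic

/-! ### Existence of good points -/

section Good
variable {n : ℕ} {b : Module.Basis (Fin (n + 3)) ℂ (Fin (n + 3) → ℂ)} {τ : Fin (n + 3) → ℂ}
  {l : Fin n → ℂ}

theorem exists_rootDatum (b : Module.Basis (Fin (n + 3)) ℂ (Fin (n + 3) → ℂ))
    (hτ : Function.Injective τ) (hl : Function.Injective l) (hne : ∀ i k, τ i ≠ l k) :
    ∃ x : ℙ ℂ (Fin (n + 3) → ℂ), RootDatum b τ x.rep l := by
  have h : RootDatum b τ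
      (ofCoordL b fun i => csqrt (Lagrange.nodalWeight Finset.univ τ i * ∏ k, (τ i - l k))) l :=
    ⟨hl, hne, 1, one_ne_zero, fun i => by rw [repr_ofCoordL, csqrt_sq, one_mul]⟩
  obtain ⟨x, -, hx⟩ := exists_coneFun_eq (g := fun _ => 0) hτ h
  exact ⟨x, hx⟩

/-- A member of the pencil is nondegenerate on the tangent space if it does not
correspond to one of the roots. -/
theorem mem_submodule_of_polar_eq_zero (hn : 0 < n) (hτ : Function.Injective τ)
    {x : ℙ ℂ (Fin (n + 3) → ℂ)} (h : RootDatum b τ x.rep l) {p q : ℂ}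
    (hpq : ∀ k, p * l k + q ≠ 0) {u : Fin (n + 3) → ℂ}
    (hu : u ∈ affineTangent (diagPencil b τ 1) x.rep)
    (h0 : ∀ w ∈ affineTangent (diagPencil b τ 1) x.rep, QuadraticMap.polar
      (diagForm b fun i => (p * τ i + q) * (1 : Fin (n + 3) → ℂ) i) u w = 0) :
    u ∈ x.submodule := by
  obtain ⟨e, he1, -, he⟩ := exists_tangentBasis hn hτ h
  rw [← toTangent_eq_zero_iff _ ⟨u, hu⟩]
  apply e.repr.injective
  ext k
  have h1 := he p q ⟨u, hu⟩ ⟨RootDatum.eigenvector b τ x.rep l k, h.eigenvector_mem hτ k⟩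
  rw [h0 _ (h.eigenvector_mem hτ k), ← he1, polar_diagForm] at h1
  simpa [Finsupp.single_apply, hpq, beta_ne_zero hτ h] using h1

theorem goodPoints_nonempty (hn : 4 < n) (b : Module.Basis (Fin (n + 3)) ℂ (Fin (n + 3) → ℂ))
    (hτ : Function.Injective τ) (hτ0 : ∀ i, τ i ≠ 0) :
    (goodPoints (diagPencil b τ 1) (diagForm b τ) (diagForm b 1)).Nonempty := by
  have hn4 : 4 ≤ n := hn.le
  obtain ⟨l, hinj, hne, hl0, ha, hdet⟩ := (holdsGenerically_injective.and
    ((HoldsGenerically.forall_of fun i : Fin (n + 3) => .forall_of fun k =>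
      holdsGenerically_ne k (τ i)).and
    ((HoldsGenerically.forall_of fun k => holdsGenerically_ne k 0).and
    ((holdsGenerically_asym hn).and (holdsGenerically_det_rateMatrix hn4 hτ))))).exists_point
  have hl : Function.Injective l := fun i j hij => by_contra fun h => hinj i j h hij
  obtain ⟨x, h⟩ := exists_rootDatum b hτ hl hne
  obtain ⟨e, -, -, he⟩ := exists_tangentBasis (by omega) hτ h
  have hII := secondFundamentalForm_eq hτ h e he
  refine ⟨x, ⟨h.mem_cone hτ, ⟨b, ⟨τ, hτ, hτ0, fun v => diagForm_apply b τ v, fun v => ?_⟩,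
    h.repr_ne_zero hτ⟩, ?_, ?_, fun u hu hw => ?_, fun u hu hw => ?_⟩,
    kerDifferential_refinedModuliMap_eq_bot hn4 hτ h ha hdet⟩
  · simp [diagForm_apply]
  · rw [hII]
    exact isNonsingularPencil_diagPencil (by omega) e hl (beta_ne_zero hτ h)
  · rw [hII]
    exact hasOnlyTrivialAut_diagPencil (by omega) e hl (beta_ne_zero hτ h) ha
  · refine mem_submodule_of_polar_eq_zero (p := 1) (q := 0) (by omega) hτ h
      (fun k => by simpa using (hl0 k).symm) hu fun w hw' => ?_
    simpa using hw w hw'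
  · refine mem_submodule_of_polar_eq_zero (p := 0) (q := 1) (by omega) hτ h
      (fun k => by simp) hu fun w hw' => ?_
    have : (fun i => (0 * τ i + 1) * (1 : Fin (n + 3) → ℂ) i) = 1 := by
      funext i; simp
    rw [this]
    exact hw w hw'

end Good

end TwoQuadrics

end

theorem theorem5 (n : ℕ) (hn : 4 < n) (ψ₁ ψ₂ : QuadraticForm ℂ (Fin (n + 3) → ℂ))
    (hX : TwoQuadrics.IsNonsingularIntersection ψ₁ ψ₂) :
    (∃ φ₁ φ₂ : QuadraticForm ℂ (Fin (n + 3) → ℂ),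
      TwoQuadrics.IsGoodPair (Submodule.span ℂ {ψ₁, ψ₂}) φ₁ φ₂) ∧
    ∀ φ₁ φ₂ : QuadraticForm ℂ (Fin (n + 3) → ℂ),
      TwoQuadrics.IsGoodPair (Submodule.span ℂ {ψ₁, ψ₂}) φ₁ φ₂ →
      (TwoQuadrics.goodPoints (Submodule.span ℂ {ψ₁, ψ₂}) φ₁ φ₂).Nonempty := by
  refine ⟨TwoQuadrics.exists_isGoodPair (by omega) ψ₁ ψ₂ hX, fun φ₁ φ₂ hφ => ?_⟩
  obtain ⟨b, τ, hτ, hτ0, rfl, rfl⟩ := TwoQuadrics.exists_standard_basis ψ₁ ψ₂ φ₁ φ₂ hX hφ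
  rw [← hφ.span_eq, TwoQuadrics.span_diagForm_eq]
  exact TwoQuadrics.goodPoints_nonempty hn b hτ hτ0
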